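/- Conventions. Graphs are finite and simple. An instance of Token Jumping Independent Set Reconfiguration is a triple $(G,I_s,I_t)$, where $I_s$ and $I_t$ are independent sets of $G$ of the same size $k$ (the parameter). A token jump replaces an independent set $A$ by an independent set $(A\setminus\{v\})\cup\{w\}$ with $v\in A$ and $w\notin A$. The instance is a yes-instance if some finite (possibly empty) sequence of token jumps transforms $I_s$ into $I_t$. Two instances are equivalent if both or neither are yes-instances. Theorem. For every fixed positive integer $r$, Token Jumping Independent Set Reconfiguration on $K_{3,r}$-minor-free graphs has a kernel of size linear in $k$, which moreover is given by a subgraph. That is, for every positive integer $r$ there are a constant $c_r$, depending only on $r$, and a polynomial-time algorithm that, given an instance $(G,I_s,I_t)$ with $|I_s|=|I_t|=k$ and with $G$ being $K_{3,r}$-minor-free, outputs an equivalent instance $(G',I_s,I_t)$, where $G'$ is a ($K_{3,r}$-minor-free) subgraph of $G$ that contains $I_s\cup I_t$ and has at most $c_r k$ vertices. (The running time is at most a polynomial, depending only on $r$, in the number of vertices of $G$.) -/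

import Mathlib

namespace TokenJumping

/-- `H` is a minor of `G`: there are pairwise disjoint connected (in particular non-empty) branch
sets in `G`, one for each vertex of `H`, with an edge of `G` between the branch sets of any two
adjacent vertices of `H`. -/
def IsMinor {V W : Type*} (H : SimpleGraph W) (G : SimpleGraph V) : Prop :=
  ∃ B : W → Set V,
    (∀ w, (G.induce (B w)).Connected) ∧
    (∀ w w', w ≠ w' → Disjoint (B w) (B w')) ∧
    (∀ w w', H.Adj w w' → ∃ x ∈ B w, ∃ y ∈ B w', G.Adj x y)

/-- One token jump: the token on `v ∈ A` is moved to some other vertex `w` that carries no token,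
and the resulting token set is again independent. -/
def Jump {V : Type*} [DecidableEq V] (G : SimpleGraph V) (A B : Finset V) : Prop :=
  ∃ v ∈ A, ∃ w, w ∉ A ∧ B = insert w (A.erase v) ∧ G.IsIndepSet (B : Set V)

/-- An instance of Token Jumping Independent Set Reconfiguration: a finite graph with a source and
a target independent set of the same size. -/
structure Instance where
  /-- number of vertices -/
  n : ℕ
  graph : SimpleGraph (Fin n)
  source : Finset (Fin n)
  target : Finset (Fin n)
  source_indep : graph.IsIndepSet (source : Set (Fin n))
  target_indep : graph.IsIndepSet (target : Set (Fin n))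
  card_eq : source.card = target.card

/-- The parameter `k`: the number of tokens. -/
def Instance.k (I : Instance) : ℕ := I.source.card

/-- `I` is a yes-instance: some sequence of token jumps transforms the source into the target. -/
def Instance.IsYes (I : Instance) : Prop :=
  Relation.ReflTransGen (Jump I.graph) I.source I.target

/-! ### Random access machines

Programs of a random access machine with structured control flow.  The memory consists of
arrays `0, 1, 2, …` of natural numbers (a program mentions only finitely many of them), with indirect
addressing.  The arithmetic operations are addition and truncated subtraction, at unit cost, so
polynomial time on this machine is polynomial time on a Turing machine. -/

/-- The memory: `σ a i` is the content of cell `i` of array `a`. -/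
abbrev Store := ℕ → ℕ → ℕ

inductive Expr where
  | const (c : ℕ)
  | read (a : ℕ) (i : Expr)
  | plus (e f : Expr)
  | monus (e f : Expr)

def Expr.eval (σ : Store) : Expr → ℕ
  | .const c => c
  | .read a i => σ a (i.eval σ)
  | .plus e f => e.eval σ + f.eval σ
  | .monus e f => e.eval σ - f.eval σ

/-- Number of steps for the evaluation of an expression: one for each operation in it. -/
def Expr.cost : Expr → ℕ
  | .const _ => 1
  | .read _ i => i.cost + 1
  | .plus e f => e.cost + f.cost + 1
  | .monus e f => e.cost + f.cost + 1

/-- Programs.  `write a i e` stores the value of `e` in cell `i` of array `a`; the conditions of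
`cond` and `loop` hold when the expression is nonzero. -/
inductive Prog where
  | skip
  | write (a : ℕ) (i e : Expr)
  | seq (p q : Prog)
  | cond (e : Expr) (p q : Prog)
  | loop (e : Expr) (p : Prog)

/-- `Exec p σ t σ'`: the program `p`, started on the memory `σ`, halts after exactly `t` steps with
the memory `σ'`. -/
inductive Exec : Prog → Store → ℕ → Store → Prop where
  | skip (σ : Store) : Exec .skip σ 1 σ
  | write (a : ℕ) (i e : Expr) (σ : Store) :
      Exec (.write a i e) σ (i.cost + e.cost + 1)
        (Function.update σ a (Function.update (σ a) (i.eval σ) (e.eval σ)))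
  | seq {p q : Prog} {σ σ' σ'' : Store} {s t : ℕ} :
      Exec p σ s σ' → Exec q σ' t σ'' → Exec (.seq p q) σ (s + t) σ''
  | cond_true {e : Expr} {p q : Prog} {σ σ' : Store} {t : ℕ} :
      e.eval σ ≠ 0 → Exec p σ t σ' → Exec (.cond e p q) σ (e.cost + t + 1) σ'
  | cond_false {e : Expr} {p q : Prog} {σ σ' : Store} {t : ℕ} :
      e.eval σ = 0 → Exec q σ t σ' → Exec (.cond e p q) σ (e.cost + t + 1) σ'
  | loop_true {e : Expr} {p : Prog} {σ σ' σ'' : Store} {s t : ℕ} :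
      e.eval σ ≠ 0 → Exec p σ s σ' → Exec (.loop e p) σ' t σ'' →
        Exec (.loop e p) σ (e.cost + s + t + 1) σ''
  | loop_false {e : Expr} {p : Prog} {σ : Store} :
      e.eval σ = 0 → Exec (.loop e p) σ (e.cost + 1) σ

open Classical in
/-- The instance `I` is stored in the four arrays from `b` on: the number of vertices, the adjacency
matrix row by row, and the characteristic vectors of the source and of the target. -/
def Stored (σ : Store) (b : ℕ) (I : Instance) : Prop :=
  σ b 0 = I.n ∧
  (∀ u v : Fin I.n, σ (b + 1) (u * I.n + v) = if I.graph.Adj u v then 1 else 0) ∧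
  (∀ u : Fin I.n, σ (b + 2) u = if u ∈ I.source then 1 else 0) ∧
  (∀ u : Fin I.n, σ (b + 3) u = if u ∈ I.target then 1 else 0)

open Classical in
/-- The initial memory on input `I`: the instance is stored in the arrays `0`, `1`, `2`, `3`, and
every other cell is `0`. -/
noncomputable def Instance.input (I : Instance) : Store
  | 0, i => if i = 0 then I.n else 0
  | 1, i => if ∃ u v : Fin I.n, i = u * I.n + v ∧ I.graph.Adj u v then 1 else 0
  | 2, i => if ∃ u ∈ I.source, i = (u : ℕ) then 1 else 0
  | 3, i => if ∃ u ∈ I.target, i = (u : ℕ) then 1 else 0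
  | _, _ => 0

theorem Instance.stored_input (I : Instance) : Stored I.input 0 I := by
  classical
  refine ⟨by simp [Instance.input], fun u v => ?_, fun u => ?_, fun u => ?_⟩
  · simp only [Instance.input]
    refine if_congr ⟨?_, fun h => ⟨u, v, by simp, h⟩⟩ rfl rfl
    rintro ⟨u', v', h, hadj⟩
    have hn : 0 < I.n := u.pos
    have h1 := congrArg (· / I.n) h
    have h2 := congrArg (· % I.n) h
    simp only [Nat.mul_comm _ I.n, Nat.mul_add_div hn, Nat.div_eq_of_lt v.2,
      Nat.div_eq_of_lt v'.2, Nat.mul_add_mod, Nat.mod_eq_of_lt v.2, Nat.mod_eq_of_lt v'.2] at h1 h2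
    obtain rfl : u = u' := Fin.ext (by simpa using h1)
    obtain rfl : v = v' := Fin.ext h2
    exact hadj
  · simp only [Instance.input]
    refine if_congr ⟨?_, fun h => ⟨u, h, rfl⟩⟩ rfl rfl
    rintro ⟨u', hu, h⟩
    obtain rfl : u = u' := Fin.ext h
    exact hu
  · simp only [Instance.input]
    refine if_congr ⟨?_, fun h => ⟨u, h, rfl⟩⟩ rfl rfl
    rintro ⟨u', hu, h⟩
    obtain rfl : u = u' := Fin.ext h
    exact hu

/-- `J` is, through the naming `φ` of its vertices by vertices of `I`, of the form
`(G', I_s, I_t)`, where `(G, I_s, I_t)` is `I` and `G'` is a subgraph of `G`. -/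
def IsSubinstance (J I : Instance) (φ : Fin J.n ↪ Fin I.n) : Prop :=
  (∀ u v, J.graph.Adj u v → I.graph.Adj (φ u) (φ v)) ∧
  J.source.map φ = I.source ∧ J.target.map φ = I.target

end TokenJumping

/-!
A graph without a `K_{3,r}` minor is sparse, and for every set `R` of vertices only `O(|R|)`
vertices outside `R` have three or more neighbours in `R`; the vertices outside `R` therefore have
only `O(|R|)` different neighbourhoods in `R`.

If there are at least `(8 r + 1) k` vertices that are neither terminals (members of `I_s ∪ I_t`) nor
adjacent to a terminal, then by sparsity some `k` of them are independent, and both `I_s` and `I_t`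
can be moved there; the terminals and `(8 r + 1) k` of these free vertices form a kernel.

Otherwise let `X` consist of the terminals and the free vertices, so that every vertex outside `X`
has a neighbour in `X`. Two vertices outside `K ⊇ X` are in the same class if they have the same
neighbours in `K`. Starting from `K = X`, keep adding to `K` every vertex `w` that is not supported:
no neighbour of `w` in `X` has a neighbour outside `K` with a large class. Ordering the added
vertices by the time of their addition, minor-freeness shows that `K` stays of size `O(k)`. Besides
`K`, the kernel keeps a bounded number of vertices of every class and `O(k)` further vertices; the
latter yield a large independent reservoir whose vertices have at most two neighbours in `K`.

A reconfiguration sequence between `I_s` and `I_t` either stays in `K` or has a first move of a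
token to some `w ∉ K`. A large class supporting `w` then has room to park the few tokens in the way,
so that all tokens can be brought into the reservoir by jumps in the kernel. The same holds from
`I_t` backwards, and within the reservoir tokens move freely.
-/

namespace TokenJumping

/-! ### Minors and sparsity -/

section Minors

variable {U V W : Type*} {G : SimpleGraph V} {H : SimpleGraph W}

theorem connected_induce_singleton (G : SimpleGraph V) (v : V) :
    (G.induce ({v} : Set V)).Connected :=
  .of_subsingleton

theorem connected_induce_star {v : V} {S : Set V} (hv : v ∈ S)
    (h : ∀ w ∈ S, w ≠ v → G.Adj v w) : (G.induce S).Connected := by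
  refine (SimpleGraph.connected_iff_exists_forall_reachable _).2 ⟨⟨v, hv⟩, fun w => ?_⟩
  by_cases hwv : (w : V) = v
  · rw [← Subtype.coe_eta w w.2]
    simp only [hwv]
    rfl
  · exact SimpleGraph.Adj.reachable (h w w.2 hwv)

theorem connected_induce_insert {u v : V} {S : Set V} (hS : (G.induce S).Connected)
    (hu : u ∈ S) (h : G.Adj u v) : (G.induce (insert v S)).Connected := by
  rw [← Set.union_singleton]
  exact SimpleGraph.connected_induce_union hS.preconnected
    (connected_induce_singleton G v).preconnected hu rfl h

theorem connected_induce_biUnion {S : Set W} {C : W → Set V} (hS : (H.induce S).Connected)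
    (hC : ∀ w ∈ S, (G.induce (C w)).Connected)
    (hadj : ∀ w w', H.Adj w w' → ∃ x ∈ C w, ∃ y ∈ C w', G.Adj x y) :
    (G.induce (⋃ w ∈ S, C w)).Connected := by
  have reachable_within : ∀ (w : S) x (hx : x ∈ C w) y (hy : y ∈ C w),
      (G.induce (⋃ w ∈ S, C w)).Reachable
        ⟨x, Set.mem_biUnion w.2 hx⟩ ⟨y, Set.mem_biUnion w.2 hy⟩ := fun w x hx y hy =>
    ((hC w w.2).preconnected ⟨x, hx⟩ ⟨y, hy⟩).map
      (SimpleGraph.induceHomOfLE G (Set.subset_biUnion_of_mem (u := C) w.2)).toHom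
  have reachable_across : ∀ {w w' : S}, (H.induce S).Reachable w w' →
      ∀ x (hx : x ∈ C w) y (hy : y ∈ C w'), (G.induce (⋃ w ∈ S, C w)).Reachable
        ⟨x, Set.mem_biUnion w.2 hx⟩ ⟨y, Set.mem_biUnion w'.2 hy⟩ := by
    rintro w w' ⟨p⟩
    induction p with
    | nil => exact reachable_within _
    | @cons a b c hab _ ih =>
      intro x hx y hy
      obtain ⟨s, hs, t, ht, hst⟩ := hadj a b hab
      have hstep : (G.induce (⋃ w ∈ S, C w)).Adj
        ⟨s, Set.mem_biUnion a.2 hs⟩ ⟨t, Set.mem_biUnion b.2 ht⟩ := hst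
      exact (reachable_within a x hx s hs).trans (hstep.reachable.trans (ih t ht y hy))
  obtain ⟨w⟩ := hS.nonempty
  obtain ⟨x⟩ := (hC w w.2).nonempty
  have : Nonempty ↥(⋃ w ∈ S, C w) := ⟨⟨x, Set.mem_biUnion w.2 x.2⟩⟩
  refine ⟨?_⟩
  rintro ⟨x, hx⟩ ⟨y, hy⟩
  obtain ⟨w, hw, hxw⟩ := Set.mem_iUnion₂.1 hx
  obtain ⟨w', hw', hyw'⟩ := Set.mem_iUnion₂.1 hy
  exact reachable_across (hS.preconnected ⟨w, hw⟩ ⟨w', hw'⟩) x hxw y hyw'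

theorem IsMinor.trans {L : SimpleGraph U} (hLH : IsMinor L H) (hHG : IsMinor H G) :
    IsMinor L G := by
  obtain ⟨B, hB, hBdisj, hBadj⟩ := hLH
  obtain ⟨C, hC, hCdisj, hCadj⟩ := hHG
  refine ⟨fun u => ⋃ w ∈ B u, C w,
    fun u => connected_induce_biUnion (hB u) (fun w _ => hC w) hCadj, fun u u' hne => ?_,
    fun u u' huu => ?_⟩
  · rw [Set.disjoint_left]
    intro x hx hx'
    obtain ⟨w, hw, hxw⟩ := Set.mem_iUnion₂.1 hx
    obtain ⟨w', hw', hxw'⟩ := Set.mem_iUnion₂.1 hx'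
    rcases eq_or_ne w w' with rfl | hww'
    · exact Set.disjoint_left.1 (hBdisj u u' hne) hw hw'
    · exact Set.disjoint_left.1 (hCdisj w w' hww') hxw hxw'
  · obtain ⟨w, hw, w', hw', hww'⟩ := hBadj u u' huu
    obtain ⟨x, hx, y, hy, hxy⟩ := hCadj w w' hww'
    exact ⟨x, Set.mem_biUnion hw hx, y, Set.mem_biUnion hw' hy, hxy⟩

theorem isMinor_comap (G : SimpleGraph V) (φ : W ↪ V) : IsMinor (G.comap φ) G :=
  ⟨fun w => {φ w}, fun w => connected_induce_singleton G (φ w),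
    fun _ _ hne => Set.disjoint_singleton.2 fun h => hne (φ.injective h),
    fun w w' h => ⟨φ w, rfl, φ w', rfl, h⟩⟩

theorem isMinor_completeBipartiteGraph {ι κ : Type*} {B : ι → Set V} (f : κ ↪ V)
    (hconn : ∀ i, (G.induce (B i)).Connected) (hdisj : Pairwise fun i i' => Disjoint (B i) (B i'))
    (hf : ∀ i j, f j ∉ B i) (hadj : ∀ i j, ∃ u ∈ B i, G.Adj u (f j)) :
    IsMinor (completeBipartiteGraph ι κ) G := by
  refine ⟨Sum.elim B fun j => {f j}, ?_, ?_, ?_⟩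
  · rintro (i | j)
    · exact hconn i
    · exact connected_induce_singleton G _
  · rintro (i | j) (i' | j') hne
    · exact hdisj fun h => hne (congrArg _ h)
    · exact Set.disjoint_singleton_right.2 (hf i j')
    · exact Set.disjoint_singleton_left.2 (hf i' j)
    · exact Set.disjoint_singleton.2 fun h => hne (congrArg _ (f.injective h))
  · rintro (i | j) (i' | j') h
    · simp at h
    · obtain ⟨u, hu, huj⟩ := hadj i j'
      exact ⟨u, hu, _, rfl, huj⟩
    · obtain ⟨u, hu, huj⟩ := hadj i' j
      exact ⟨_, rfl, u, hu, huj.symm⟩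
    · simp at h

end Minors

section Density

variable {V : Type*} (G : SimpleGraph V) [DecidableRel G.Adj]

/-- The sum of the degrees in the subgraph induced by `A`, i.e. twice its number of edges. -/
def degSum (A : Finset V) : ℕ := ∑ v ∈ A, (A.filter (G.Adj v)).card

variable {G}

theorem mul_card_le_degSum {c : ℕ} {A : Finset V}
    (h : ∀ v ∈ A, c ≤ (A.filter (G.Adj v)).card) : c * A.card ≤ degSum G A := by
  rw [degSum, mul_comm, ← smul_eq_mul]
  exact Finset.card_nsmul_le_sum _ _ _ h

theorem exists_card_filter_adj_le {q : ℕ} {A : Finset V} (hA : A.Nonempty)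
    (h : degSum G A ≤ q * A.card) : ∃ v ∈ A, (A.filter (G.Adj v)).card ≤ q := by
  by_contra! hcon
  have hlarge := mul_card_le_degSum (c := q + 1) hcon
  linarith [Finset.card_pos.2 hA]

theorem degSum_le_sq (A : Finset V) : degSum G A ≤ A.card * A.card :=
  Finset.sum_le_card_nsmul _ _ _ fun _ _ => Finset.card_filter_le _ _

variable [DecidableEq V]

theorem degSum_erase {A : Finset V} {v : V} (hv : v ∈ A) :
    degSum G A = degSum G (A.erase v) + 2 * (A.filter (G.Adj v)).card := by
  have hdeg : ∀ u ∈ A.erase v, (A.filter (G.Adj u)).card =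
      ((A.erase v).filter (G.Adj u)).card + if G.Adj u v then 1 else 0 := by
    intro u _
    conv_lhs => rw [← Finset.insert_erase hv]
    rw [Finset.filter_insert]
    split_ifs with h
    · rw [Finset.card_insert_of_notMem (by simp)]
    · rfl
  have hnbrs : ∑ u ∈ A.erase v, (if G.Adj u v then 1 else 0) = (A.filter (G.Adj v)).card := by
    rw [← Finset.card_filter]
    congr 1
    ext u
    simp only [Finset.mem_filter, Finset.mem_erase]
    exact ⟨fun h => ⟨h.1.2, h.2.symm⟩, fun h => ⟨⟨h.2.ne', h.1⟩, h.2.symm⟩⟩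
  unfold degSum
  rw [← Finset.add_sum_erase A _ hv, Finset.sum_congr rfl hdeg, Finset.sum_add_distrib, hnbrs]
  ring

variable (G) in
/-- The vertices of `A` outside `U` that have a neighbour in `U`. -/
def outerNbrs (A U : Finset V) : Finset V := (A \ U).filter fun v => ∃ u ∈ U, G.Adj u v

variable (G) in
/-- The degree sum of the graph that arises from the subgraph induced by `A` when `U ⊆ A` is
contracted to a single vertex. -/
def contractDegSum (A U : Finset V) : ℕ := degSum G (A \ U) + 2 * (outerNbrs G A U).card

theorem mem_outerNbrs {A U : Finset V} {v : V} :
    v ∈ outerNbrs G A U ↔ (v ∈ A ∧ v ∉ U) ∧ ∃ u ∈ U, G.Adj u v := by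
  rw [outerNbrs, Finset.mem_filter, Finset.mem_sdiff]

theorem contractDegSum_singleton {A : Finset V} {a : V} (ha : a ∈ A) :
    contractDegSum G A {a} = degSum G A := by
  have houter : outerNbrs G A {a} = A.filter (G.Adj a) := by
    ext v
    simp only [mem_outerNbrs, Finset.mem_filter, Finset.mem_singleton, exists_eq_left]
    exact ⟨fun h => ⟨h.1.1, h.2⟩, fun h => ⟨⟨h.1, h.2.ne'⟩, h.2⟩⟩
  rw [contractDegSum, houter, Finset.sdiff_singleton_eq_erase, degSum_erase ha]

theorem card_outerNbrs_insert {A U : Finset V} {v : V} (hv : v ∈ outerNbrs G A U) :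
    (outerNbrs G A (insert v U)).card + ((outerNbrs G A U).filter (G.Adj v)).card + 1 =
      (outerNbrs G A U).card + ((A \ U).filter (G.Adj v)).card := by
  set N := outerNbrs G A U with hN
  set D := (A \ U).filter (G.Adj v)
  have hsplit : outerNbrs G A (insert v U) = N.erase v ∪ D.filter (· ∉ N) := by
    ext x
    simp only [hN, D, mem_outerNbrs, Finset.mem_filter, Finset.mem_sdiff, Finset.mem_insert,
      Finset.mem_union, Finset.mem_erase, exists_eq_or_imp, not_or]
    have hne : G.Adj v x → x ≠ v := SimpleGraph.Adj.ne'
    generalize (∃ a ∈ U, G.Adj a x) = isNbr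
    tauto
  have hdisj : Disjoint (N.erase v) (D.filter (· ∉ N)) :=
    Finset.disjoint_left.2 fun x hx hx' =>
      (Finset.mem_filter.1 hx').2 (Finset.mem_of_mem_erase hx)
  have hD : D.filter (· ∈ N) = N.filter (G.Adj v) := by
    ext x
    simp only [hN, D, mem_outerNbrs, Finset.mem_filter, Finset.mem_sdiff]
    tauto
  rw [hsplit, Finset.card_union_of_disjoint hdisj,
    ← Finset.card_filter_add_card_filter_not (s := D) (· ∈ N), hD,
    ← Finset.card_erase_add_one hv]
  ring

theorem contractDegSum_insert {A U : Finset V} {v : V} (hv : v ∈ outerNbrs G A U) :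
    contractDegSum G A (insert v U) + 2 * (((outerNbrs G A U).filter (G.Adj v)).card + 1) =
      contractDegSum G A U := by
  have herase := degSum_erase (G := G) (Finset.mem_filter.1 hv).1
  have hcard := card_outerNbrs_insert hv
  rw [contractDegSum, contractDegSum, Finset.sdiff_insert]
  omega

variable (G) in
/-- `U` is a connected subset of `A` whose contraction leaves at least `c` edges per vertex. The
maximal sets of this kind provide the branch sets of a complete bipartite minor. -/
structure DenselyContractible (c : ℕ) (A U : Finset V) : Prop where
  subset : U ⊆ A
  connected : (G.induce (U : Set V)).Connected
  dense : 2 * c * ((A \ U).card + 1) ≤ contractDegSum G A U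

theorem denselyContractible_singleton {c : ℕ} {A : Finset V} {a : V} (ha : a ∈ A)
    (h : 2 * c * A.card ≤ degSum G A) : DenselyContractible G c A {a} where
  subset := Finset.singleton_subset_iff.2 ha
  connected := by
    rw [Finset.coe_singleton]
    exact connected_induce_singleton G a
  dense := by
    rwa [contractDegSum_singleton ha, Finset.sdiff_singleton_eq_erase, Finset.card_erase_add_one ha]

theorem DenselyContractible.insert {c : ℕ} {A U : Finset V} (hU : DenselyContractible G c A U)
    {v : V} (hv : v ∈ outerNbrs G A U) (hlt : ((outerNbrs G A U).filter (G.Adj v)).card < c) :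
    DenselyContractible G c A (insert v U) := by
  obtain ⟨⟨hvA, hvU⟩, u, hu, huv⟩ := mem_outerNbrs.1 hv
  refine ⟨Finset.insert_subset hvA hU.subset, ?_, ?_⟩
  · rw [Finset.coe_insert]
    exact connected_induce_insert hU.connected hu huv
  · have hdense := hU.dense
    rw [← contractDegSum_insert hv] at hdense
    rw [Finset.sdiff_insert, Finset.card_erase_add_one (Finset.mem_sdiff.2 ⟨hvA, hvU⟩)]
    linarith

end Density

section BipartiteMinors

variable {V : Type*} {G : SimpleGraph V} [DecidableRel G.Adj]

theorem exists_connected_dense_nbrs {c : ℕ} (hc : 0 < c) (A : Finset V) (hA : A.Nonempty)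
    (h : 2 * c * A.card ≤ degSum G A) :
    ∃ U N : Finset V, U ⊆ A ∧ N ⊆ A ∧ Disjoint U N ∧ (G.induce (U : Set V)).Connected ∧
      N.Nonempty ∧ (∀ v ∈ N, ∃ u ∈ U, G.Adj u v) ∧ ∀ v ∈ N, c ≤ (N.filter (G.Adj v)).card := by
  classical
  induction A using Finset.strongInduction with | H A ih =>
  obtain ⟨a, ha⟩ := hA
  obtain ⟨U, -, hmax⟩ := (A.powerset.filter (DenselyContractible G c A)).exists_le_maximal
    (Finset.mem_filter.2 ⟨Finset.mem_powerset.2 (Finset.singleton_subset_iff.2 ha),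
      denselyContractible_singleton ha h⟩)
  have hU : DenselyContractible G c A U := (Finset.mem_filter.1 hmax.prop).2
  rcases (outerNbrs G A U).eq_empty_or_nonempty with hN | hN
  · have hdense := hU.dense
    rw [contractDegSum, hN, Finset.card_empty, mul_zero, add_zero] at hdense
    have hne : (A \ U).Nonempty := by
      by_contra hempty
      rw [Finset.not_nonempty_iff_eq_empty] at hempty
      simp only [hempty, degSum, Finset.sum_empty, Finset.card_empty] at hdense
      omega
    obtain ⟨u⟩ := hU.connected.nonempty
    have hssubset : A \ U ⊂ A := Finset.sdiff_ssubset hU.subset ⟨u, u.2⟩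
    obtain ⟨U', N, hU', hN, hrest⟩ := ih (A \ U) hssubset hne (by linarith)
    exact ⟨U', N, hU'.trans hssubset.1, hN.trans hssubset.1, hrest⟩
  · refine ⟨U, outerNbrs G A U, hU.subset, (Finset.filter_subset _ _).trans Finset.sdiff_subset,
      Finset.disjoint_sdiff.mono_right (Finset.filter_subset _ _), hU.connected, hN,
      fun v hv => (mem_outerNbrs.1 hv).2, fun v hv => ?_⟩
    by_contra! hlt
    have hinsert := hU.insert hv hlt
    exact (mem_outerNbrs.1 hv).1.2 (hmax.le_of_ge (Finset.mem_filter.2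
      ⟨Finset.mem_powerset.2 hinsert.subset, hinsert⟩) (Finset.subset_insert v U)
        (Finset.mem_insert_self v U))

theorem exists_branchSets_of_degSum {r : ℕ} (hr : 0 < r) (s : ℕ) (A : Finset V)
    (hA : A.Nonempty) (h : 2 ^ s * r * A.card ≤ degSum G A) :
    ∃ (U : Fin s → Finset V) (N : Finset V), (∀ i, U i ⊆ A) ∧ N ⊆ A ∧ r ≤ N.card ∧
      (∀ i, (G.induce (U i : Set V)).Connected) ∧ (Pairwise fun i j => Disjoint (U i) (U j)) ∧
      (∀ i, Disjoint (U i) N) ∧ ∀ i, ∀ v ∈ N, ∃ u ∈ U i, G.Adj u v := by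
  induction s generalizing A with
  | zero =>
    have hrA : r ≤ A.card := by
      refine Nat.le_of_mul_le_mul_right ?_ (Finset.card_pos.2 hA)
      simpa using h.trans (degSum_le_sq A)
    exact ⟨fun i => i.elim0, A, fun i => i.elim0, subset_rfl, hrA, fun i => i.elim0,
      fun i => i.elim0, fun i => i.elim0, fun i => i.elim0⟩
  | succ s ih =>
    obtain ⟨U₀, N₀, hU₀, hN₀, hdisj₀, hconn₀, hne₀, hadj₀, hdeg₀⟩ :=
      exists_connected_dense_nbrs (c := 2 ^ s * r) (by positivity) A hA
        (by rw [pow_succ] at h; linarith)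
    obtain ⟨U, N, hU, hN, hr, hconn, hdisj, hUN, hadj⟩ := ih N₀ hne₀ (mul_card_le_degSum hdeg₀)
    have hdisj₀U : ∀ i, Disjoint U₀ (U i) := fun i => hdisj₀.mono_right (hU i)
    refine ⟨Fin.cons U₀ U, N, Fin.cases hU₀ fun i => (hU i).trans hN₀, hN.trans hN₀, hr,
      Fin.cases hconn₀ hconn, ?_, Fin.cases (hdisj₀.mono_right hN) hUN,
      Fin.cases (fun v hv => hadj₀ v (hN hv)) hadj⟩
    intro i j hij
    induction i using Fin.cases with
    | zero =>
      induction j using Fin.cases with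
      | zero => exact absurd rfl hij
      | succ j => exact hdisj₀U j
    | succ i =>
      induction j using Fin.cases with
      | zero => exact (hdisj₀U i).symm
      | succ j => exact hdisj fun h => hij (congrArg _ h)

theorem degSum_le_of_not_isMinor {s r : ℕ} (hr : 0 < r)
    (hG : ¬ IsMinor (completeBipartiteGraph (Fin s) (Fin r)) G) (A : Finset V) :
    degSum G A ≤ 2 ^ s * r * A.card := by
  rcases A.eq_empty_or_nonempty with rfl | hA
  · simp [degSum]
  by_contra! hlt
  obtain ⟨U, N, -, -, hrN, hconn, hdisj, hUN, hadj⟩ := exists_branchSets_of_degSum hr s A hA hlt.le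
  let f : Fin r ↪ V := (Fin.castLEEmb hrN).trans (N.equivFin.symm.toEmbedding.trans
    (Function.Embedding.subtype _))
  have hf : ∀ j, f j ∈ N := fun j => (N.equivFin.symm (Fin.castLE hrN j)).2
  exact hG (isMinor_completeBipartiteGraph f hconn
    (fun i j hij => Finset.disjoint_coe.2 (hdisj hij))
    (fun i j hmem => Finset.disjoint_left.1 (hUN i) hmem (hf j)) fun i j => hadj i _ (hf j))

end BipartiteMinors

section IndependentSubsets

variable {V : Type*}

theorem isIndepSet_iff_forall_not_adj {G : SimpleGraph V} {S : Set V} :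
    G.IsIndepSet S ↔ ∀ u ∈ S, ∀ v ∈ S, ¬ G.Adj u v :=
  ⟨fun h _ hu _ hv huv => h hu hv huv.ne huv, fun h u hu v hv _ => h u hu v hv⟩

theorem exists_isIndepSet_subset {G : SimpleGraph V} [DecidableRel G.Adj] {q : ℕ}
    (h : ∀ A : Finset V, degSum G A ≤ q * A.card) (A : Finset V) :
    ∃ I ⊆ A, G.IsIndepSet (I : Set V) ∧ A.card ≤ (q + 1) * I.card := by
  classical
  induction A using Finset.strongInduction with | H A ih =>
  rcases A.eq_empty_or_nonempty with rfl | hA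
  · exact ⟨∅, by simp⟩
  obtain ⟨v, hv, hdeg⟩ := exists_card_filter_adj_le hA (h A)
  set R := A.filter fun u => u ≠ v ∧ ¬ G.Adj v u with hR
  have hRA : R ⊂ A := Finset.filter_ssubset.2 ⟨v, hv, by simp⟩
  obtain ⟨I, hIR, hind, hcard⟩ := ih R hRA
  have hI : ∀ u ∈ I, u ≠ v ∧ ¬ G.Adj v u := fun u hu => (Finset.mem_filter.1 (hIR hu)).2
  refine ⟨insert v I, Finset.insert_subset hv (hIR.trans hRA.1), ?_, ?_⟩
  · rw [Finset.coe_insert]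
    exact Set.Pairwise.insert hind fun u hu _ => ⟨(hI u hu).2, fun h => (hI u hu).2 h.symm⟩
  · rw [Finset.card_insert_of_notMem fun hvI => (hI v hvI).1 rfl]
    have hcover : A ⊆ insert v (A.filter (G.Adj v)) ∪ R := by
      intro u hu
      simp only [hR, Finset.mem_union, Finset.mem_insert, Finset.mem_filter]
      tauto
    have h1 := (Finset.card_le_card hcover).trans (Finset.card_union_le _ _)
    have h2 := Finset.card_insert_le v (A.filter (G.Adj v))
    linarith

theorem exists_conflictFree_subset {α : Type*} {q : ℕ} (A : Finset α)
    (forb : α → Finset α) (hq : ∀ a, (forb a).card ≤ q) :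
    ∃ I ⊆ A, (∀ a ∈ I, ∀ b ∈ I, a ≠ b → b ∉ forb a) ∧ A.card ≤ (2 * q + 1) * I.card := by
  classical
  let H : SimpleGraph α := SimpleGraph.fromRel (fun a b => b ∈ forb a)
  have hdegSum : ∀ A : Finset α, degSum H A ≤ 2 * q * A.card := by
    intro A
    have hdeg : ∀ a ∈ A, (A.filter (H.Adj a)).card ≤
        (A.filter (· ∈ forb a)).card + (A.filter (a ∈ forb ·)).card := by
      intro a _
      refine le_trans (Finset.card_le_card fun b hb => ?_) (Finset.card_union_le _ _)
      simp only [Finset.mem_union, Finset.mem_filter, H, SimpleGraph.fromRel_adj] at hb ⊢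
      tauto
    have hout : ∑ a ∈ A, (A.filter (· ∈ forb a)).card ≤ q * A.card := by
      rw [mul_comm, ← smul_eq_mul]
      refine Finset.sum_le_card_nsmul _ _ _ fun a _ =>
        (Finset.card_le_card fun b hb => ?_).trans (hq a)
      exact (Finset.mem_filter.1 hb).2
    have hin : ∑ a ∈ A, (A.filter (a ∈ forb ·)).card = ∑ a ∈ A, (A.filter (· ∈ forb a)).card := by
      simp only [Finset.card_filter]
      exact Finset.sum_comm
    have hsum := Finset.sum_le_sum hdeg
    rw [Finset.sum_add_distrib, hin] at hsum
    unfold degSum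
    linarith
  obtain ⟨I, hI, hind, hcard⟩ := exists_isIndepSet_subset hdegSum A
  refine ⟨I, hI, fun a ha b hb hab hforb => hind ha hb hab ?_, hcard⟩
  exact (SimpleGraph.fromRel_adj _ _ _).2 ⟨hab, Or.inl hforb⟩

end IndependentSubsets

/-! ### Vertices with many neighbours in a set -/

section Counting

variable {V : Type*} {G : SimpleGraph V}

theorem card_lt_of_common_nbrs {s r : ℕ}
    (hG : ¬ IsMinor (completeBipartiteGraph (Fin s) (Fin r)) G) {T S : Finset V}
    (hT : s ≤ T.card) (h : ∀ x ∈ S, ∀ t ∈ T, G.Adj x t) : S.card < r := by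
  by_contra! hr
  let f : Fin r ↪ V := (Fin.castLEEmb hr).trans (S.equivFin.symm.toEmbedding.trans (.subtype _))
  let g : Fin s ↪ V := (Fin.castLEEmb hT).trans (T.equivFin.symm.toEmbedding.trans (.subtype _))
  have hadj : ∀ i j, G.Adj (g i) (f j) := fun i j =>
    (h _ (S.equivFin.symm (Fin.castLE hr j)).2 _ (T.equivFin.symm (Fin.castLE hT i)).2).symm
  exact hG (isMinor_completeBipartiteGraph (B := fun i => {g i}) f
    (fun i => connected_induce_singleton G (g i))
    (fun i i' hne => Set.disjoint_singleton.2 (g.injective.ne hne))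
    (fun i j => (hadj i j).ne') fun i j => ⟨_, rfl, hadj i j⟩)

/-- The star with centre `y` whose leaves are the vertices of `S` that `ρ` sends to `y`. Such stars
serve as branch sets: the vertices of `S` are contracted into their images. -/
def starBag (S : Set V) (ρ : V → V) (y : V) : Set V := insert y {g ∈ S | ρ g = y}

theorem connected_induce_starBag {S : Set V} {ρ : V → V} {y : V}
    (h : ∀ g ∈ S, ρ g = y → G.Adj y g) : (G.induce (starBag S ρ y)).Connected := by
  refine connected_induce_star (Set.mem_insert _ _) ?_
  rintro g (rfl | ⟨hg, hgy⟩) hne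
  · exact absurd rfl hne
  · exact h g hg hgy

theorem disjoint_starBag {S : Set V} {ρ : V → V} {y y' : V} (hy : y ∉ S) (hy' : y' ∉ S)
    (hne : y ≠ y') : Disjoint (starBag S ρ y) (starBag S ρ y') := by
  rw [Set.disjoint_left]
  rintro g (rfl | ⟨hg, hgy⟩) (h | ⟨hg', hgy'⟩)
  · exact hne h
  · exact hy hg'
  · exact hy' (h ▸ hg)
  · exact hne (hgy.symm.trans hgy')

/-- The graph on `R` whose edges are the pairs `p z` with `z ∈ Z`. -/
def pairGraph (R Z : Finset V) (p : V → Sym2 V) : SimpleGraph {y // y ∈ R} :=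
  (SimpleGraph.fromEdgeSet (p '' Z)).comap Subtype.val

variable (G) in
/-- Every `z ∈ Z` is assigned a pair `p z` of distinct neighbours of `z` in `R`. -/
structure IsPairing (R Z : Finset V) (p : V → Sym2 V) : Prop where
  mem : ∀ z ∈ Z, ∀ a ∈ p z, a ∈ R
  adj : ∀ z ∈ Z, ∀ a ∈ p z, G.Adj z a
  not_isDiag : ∀ z ∈ Z, ¬ (p z).IsDiag

theorem IsPairing.isMinor_pairGraph {R Z : Finset V} {p : V → Sym2 V} (hp : IsPairing G R Z p)
    (hd : Disjoint R Z) : IsMinor (pairGraph R Z p) G := by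
  have hRZ : ∀ y : {y // y ∈ R}, (y : V) ∉ Z := fun y => Finset.disjoint_left.1 hd y.2
  -- Contracting `z` into one end of `p z` turns its edge to the other end into the edge `p z`.
  refine ⟨fun y => starBag Z (fun z => (p z).out.1) y, fun y => ?_,
    fun y y' hne => disjoint_starBag (hRZ y) (hRZ y') (Subtype.coe_ne_coe.2 hne), ?_⟩
  · refine connected_induce_starBag fun z hz hzy => ?_
    rw [← hzy]
    exact (hp.adj z hz _ (Sym2.out_fst_mem _)).symm
  · intro a b hab
    obtain ⟨⟨z, hz, hzab⟩, -⟩ := (SimpleGraph.fromEdgeSet_adj _).1 hab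
    have hza := hp.adj z hz a (hzab ▸ Sym2.mem_mk_left _ _)
    have hzb := hp.adj z hz b (hzab ▸ Sym2.mem_mk_right _ _)
    have hend : (p z).out.1 ∈ s((a : V), (b : V)) := by
      simpa only [hzab] using Sym2.out_fst_mem (p z)
    rcases Sym2.mem_iff.1 hend with hout | hout
    · exact ⟨z, Or.inr ⟨hz, hout⟩, b, Or.inl rfl, hzb⟩
    · exact ⟨a, Or.inl rfl, z, Or.inr ⟨hz, hout⟩, hza.symm⟩

theorem IsPairing.card_image_le [DecidableEq V] {s r : ℕ} (hr : 0 < r)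
    (hG : ¬ IsMinor (completeBipartiteGraph (Fin s) (Fin r)) G) {R Z : Finset V} {p : V → Sym2 V}
    (hp : IsPairing G R Z p) (hd : Disjoint R Z) :
    2 * (Z.image p).card ≤ 2 ^ s * r * R.card := by
  classical
  set M := pairGraph R Z p
  have hM : ¬ IsMinor (completeBipartiteGraph (Fin s) (Fin r)) M :=
    fun h => hG (h.trans (hp.isMinor_pairGraph hd))
  have hsum : degSum M Finset.univ = 2 * M.edgeFinset.card := by
    rw [← M.sum_degrees_eq_twice_card_edges]
    refine Finset.sum_congr rfl fun a _ => ?_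
    rw [← M.card_neighborFinset_eq_degree, M.neighborFinset_eq_filter]
  have himage : Z.image p ⊆ M.edgeFinset.image (Sym2.map Subtype.val) := by
    intro e he
    obtain ⟨z, hz, rfl⟩ := Finset.mem_image.1 he
    have hmem := hp.mem z hz
    have hdiag := hp.not_isDiag z hz
    have hzp : p z ∈ p '' (Z : Set V) := Set.mem_image_of_mem p hz
    induction hpz : p z using Sym2.ind with | _ a b =>
    rw [hpz] at hmem hdiag hzp
    refine Finset.mem_image.2 ⟨s(⟨a, hmem a (Sym2.mem_mk_left a b)⟩,
      ⟨b, hmem b (Sym2.mem_mk_right a b)⟩), ?_, rfl⟩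
    rw [SimpleGraph.mem_edgeFinset, SimpleGraph.mem_edgeSet]
    exact (SimpleGraph.fromEdgeSet_adj _).2 ⟨hzp, hdiag⟩
  calc 2 * (Z.image p).card ≤ 2 * M.edgeFinset.card :=
        Nat.mul_le_mul_left 2 ((Finset.card_le_card himage).trans Finset.card_image_le)
    _ ≤ 2 ^ s * r * (Finset.univ : Finset {y // y ∈ R}).card :=
        hsum ▸ degSum_le_of_not_isMinor hr hM Finset.univ
    _ = 2 ^ s * r * R.card := by rw [Finset.card_univ, Fintype.card_coe]

theorem IsPairing.insert [DecidableEq V] {R Z : Finset V} {p : V → Sym2 V}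
    (hp : IsPairing G R Z p) {w : V} (hw : w ∉ Z) {e : Sym2 V} (hmem : ∀ a ∈ e, a ∈ R)
    (hadj : ∀ a ∈ e, G.Adj w a) (hdiag : ¬ e.IsDiag) :
    IsPairing G R (insert w Z) (Function.update p w e) := by
  have hne : ∀ z ∈ Z, z ≠ w := fun z hz h => hw (h ▸ hz)
  constructor <;> intro z hz <;> rcases Finset.mem_insert.1 hz with rfl | hz
  · rwa [Function.update_self]
  · rw [Function.update_of_ne (hne z hz)]
    exact hp.mem z hz
  · rwa [Function.update_self]
  · rw [Function.update_of_ne (hne z hz)]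
    exact hp.adj z hz
  · rwa [Function.update_self]
  · rw [Function.update_of_ne (hne z hz)]
    exact hp.not_isDiag z hz

theorem exists_saturated_pairing (G : SimpleGraph V) (R W : Finset V) :
    ∃ Z ⊆ W, ∃ p, IsPairing G R Z p ∧ Set.InjOn p Z ∧ ∀ w ∈ W, w ∉ Z → ∀ a ∈ R, ∀ b ∈ R,
      G.Adj w a → G.Adj w b → a ≠ b → s(a, b) ∈ p '' (Z : Set V) := by
  classical
  obtain ⟨Z, hZ, hmax⟩ := Finset.exists_max_image
    (W.powerset.filter fun Z => ∃ p, IsPairing G R Z p ∧ Set.InjOn p Z) Finset.card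
    ⟨∅, Finset.mem_filter.2 ⟨Finset.empty_mem_powerset _, fun v => s(v, v),
      ⟨by simp, by simp, by simp⟩, by simp⟩⟩
  obtain ⟨hZW, p, hp, hinj⟩ := Finset.mem_filter.1 hZ
  rw [Finset.mem_powerset] at hZW
  refine ⟨Z, hZW, p, hp, hinj, fun w hw hwZ a ha b hb hwa hwb hab => ?_⟩
  by_contra hnew
  have hne : ∀ z ∈ Z, Function.update p w s(a, b) z = p z :=
    fun z hz => Function.update_of_ne (ne_of_mem_of_not_mem hz hwZ) _ _
  have hinj' : Set.InjOn (Function.update p w s(a, b)) ↑(insert w Z) := by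
    rw [Finset.coe_insert, Set.injOn_insert (by simpa using hwZ), Function.update_self,
      Set.image_congr hne]
    exact ⟨hinj.congr fun z hz => (hne z hz).symm, hnew⟩
  have hpair := hp.insert hwZ (e := s(a, b)) (by simp [ha, hb]) (by simp [hwa, hwb]) hab
  have hle := hmax (insert w Z) (Finset.mem_filter.2
    ⟨Finset.mem_powerset.2 (Finset.insert_subset hw hZW), _, hpair, hinj'⟩)
  rw [Finset.card_insert_of_notMem hwZ] at hle
  omega

section Cliques

variable {α ι : Type*} [DecidableEq ι] {M : SimpleGraph ι} {s q r : ℕ} {W : Finset α}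
  {T : α → Finset ι}

theorem card_cliques_through_le [DecidableRel M.Adj] (hT : ∀ w ∈ W, (T w).card = s + 1)
    (hadj : ∀ w ∈ W, M.IsClique (T w : Set ι))
    (hr : ∀ S : Finset ι, (W.filter fun w => T w = S).card ≤ r) {A : Finset ι} {a : ι}
    (ha : (A.filter (M.Adj a)).card ≤ q) :
    (W.filter fun w => T w ⊆ A ∧ a ∈ T w).card ≤ r * q ^ s := by
  set X := W.filter fun w => T w ⊆ A ∧ a ∈ T w
  have himage : X.image (fun w => (T w).erase a) ⊆ (A.filter (M.Adj a)).powersetCard s := by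
    intro S hS
    obtain ⟨w, hw, rfl⟩ := Finset.mem_image.1 hS
    obtain ⟨hw, hwA, haw⟩ := Finset.mem_filter.1 hw
    refine Finset.mem_powersetCard.2
      ⟨fun b hb => ?_, by rw [Finset.card_erase_of_mem haw, hT w hw, Nat.add_sub_cancel]⟩
    obtain ⟨hba, hb⟩ := Finset.mem_erase.1 hb
    exact Finset.mem_filter.2 ⟨hwA hb, hadj w hw haw hb hba.symm⟩
  have hfiber : ∀ S ∈ X.image (fun w => (T w).erase a),
      (X.filter fun w => (T w).erase a = S).card ≤ r := by
    intro S _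
    refine (Finset.card_le_card fun w hw => ?_).trans (hr (insert a S))
    obtain ⟨hwX, rfl⟩ := Finset.mem_filter.1 hw
    obtain ⟨hwW, -, haw⟩ := Finset.mem_filter.1 hwX
    exact Finset.mem_filter.2 ⟨hwW, (Finset.insert_erase haw).symm⟩
  calc X.card ≤ r * (X.image fun w => (T w).erase a).card :=
        Finset.card_le_mul_card_image _ r hfiber
    _ ≤ r * (A.filter (M.Adj a)).card.choose s := by
        rw [← Finset.card_powersetCard]
        exact Nat.mul_le_mul_left r (Finset.card_le_card himage)
    _ ≤ r * q ^ s :=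
        Nat.mul_le_mul_left r ((Nat.choose_le_pow _ _).trans (Nat.pow_le_pow_left ha s))

theorem card_cliques_le [DecidableRel M.Adj] (hq : ∀ A : Finset ι, degSum M A ≤ q * A.card)
    (hT : ∀ w ∈ W, (T w).card = s + 1) (hadj : ∀ w ∈ W, M.IsClique (T w : Set ι))
    (hr : ∀ S : Finset ι, (W.filter fun w => T w = S).card ≤ r) (A : Finset ι) :
    (W.filter fun w => T w ⊆ A).card ≤ r * q ^ s * A.card := by
  classical
  induction A using Finset.strongInduction with | H A ih =>
  rcases A.eq_empty_or_nonempty with rfl | hA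
  · refine (Finset.card_eq_zero.2 (Finset.filter_eq_empty_iff.2 fun w hw hempty => ?_)).le
    have hcard := hT w hw
    rw [Finset.subset_empty.1 hempty] at hcard
    simp at hcard
  obtain ⟨a, ha, hdeg⟩ := exists_card_filter_adj_le hA (hq A)
  have hsplit : W.filter (fun w => T w ⊆ A) ⊆
      W.filter (fun w => T w ⊆ A.erase a) ∪ W.filter (fun w => T w ⊆ A ∧ a ∈ T w) := by
    intro w hw
    simp only [Finset.mem_union, Finset.mem_filter, Finset.subset_erase] at hw ⊢
    tauto
  calc (W.filter fun w => T w ⊆ A).card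
      ≤ r * q ^ s * (A.erase a).card + r * q ^ s :=
        (Finset.card_le_card hsplit).trans <| (Finset.card_union_le _ _).trans <|
          add_le_add (ih _ (Finset.erase_ssubset ha)) (card_cliques_through_le hT hadj hr hdeg)
    _ = r * q ^ s * A.card := by rw [← Finset.card_erase_add_one ha]; ring

end Cliques

/-- The factor in the linear bound for the number of vertices that have at least `s + 1` neighbours
in a given set, in graphs without a `K_{s+1,r}` minor. -/
def manyNbrsConst (s r : ℕ) : ℕ := 2 ^ s * r + r * (2 ^ (s + 1) * r) ^ s

theorem card_le_of_nbrs_clique [DecidableRel G.Adj] {s r : ℕ} (hr : 0 < r)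
    (hG : ¬ IsMinor (completeBipartiteGraph (Fin (s + 1)) (Fin r)) G) {R W : Finset V}
    {M : SimpleGraph {y // y ∈ R}}
    (hM : ¬ IsMinor (completeBipartiteGraph (Fin (s + 1)) (Fin r)) M)
    (hW : ∀ w ∈ W, s + 1 ≤ (R.filter (G.Adj w)).card)
    (hclique : ∀ w ∈ W, M.IsClique {a | G.Adj w a}) :
    W.card ≤ r * (2 ^ (s + 1) * r) ^ s * R.card := by
  classical
  have hnbrs : ∀ w ∈ W, ∃ T ⊆ (R.filter (G.Adj w)).subtype (· ∈ R), T.card = s + 1 := by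
    intro w hw
    refine Finset.exists_subset_card_eq ((hW w hw).trans_eq ?_)
    rw [Finset.card_subtype, Finset.filter_true_of_mem fun a ha => Finset.mem_of_mem_filter a ha]
  choose! T hT hTcard using hnbrs
  have hTadj : ∀ w ∈ W, ∀ a ∈ T w, G.Adj w a :=
    fun w hw a ha => (Finset.mem_filter.1 (Finset.mem_subtype.1 (hT w hw ha))).2
  have hfiber : ∀ S, (W.filter fun w => T w = S).card ≤ r := by
    intro S
    rcases (W.filter fun w => T w = S).eq_empty_or_nonempty with hempty | ⟨w, hwS⟩
    · simp [hempty]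
    obtain ⟨hw, rfl⟩ := Finset.mem_filter.1 hwS
    refine (card_lt_of_common_nbrs hG (T := (T w).map (.subtype _)) ?_ fun x hx t ht => ?_).le
    · rw [Finset.card_map, hTcard w hw]
    · obtain ⟨hx, hxw⟩ := Finset.mem_filter.1 hx
      obtain ⟨a, ha, rfl⟩ := Finset.mem_map.1 ht
      exact hTadj x hx a (hxw ▸ ha)
  have hcard := card_cliques_le (degSum_le_of_not_isMinor hr hM) hTcard
    (fun w hw => (hclique w hw).subset (hTadj w hw)) hfiber Finset.univ
  rwa [Finset.filter_true_of_mem fun w _ => Finset.subset_univ _, Finset.card_univ,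
    Fintype.card_coe] at hcard

-- The neighbourhood in `R` of a vertex outside a saturated pairing is a clique of `pairGraph`.
theorem card_le_of_many_nbrs [DecidableRel G.Adj] {s r : ℕ} (hr : 0 < r)
    (hG : ¬ IsMinor (completeBipartiteGraph (Fin (s + 1)) (Fin r)) G) {R W : Finset V}
    (hd : Disjoint R W) (hW : ∀ w ∈ W, s + 1 ≤ (R.filter (G.Adj w)).card) :
    W.card ≤ manyNbrsConst s r * R.card := by
  classical
  obtain ⟨Z, hZW, p, hp, hinj, hsat⟩ := exists_saturated_pairing G R W
  have hdZ : Disjoint R Z := hd.mono_right hZW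
  have hpaired : 2 * Z.card ≤ 2 ^ (s + 1) * r * R.card :=
    Finset.card_image_of_injOn hinj ▸ hp.card_image_le hr hG hdZ
  have hM : ¬ IsMinor (completeBipartiteGraph (Fin (s + 1)) (Fin r)) (pairGraph R Z p) :=
    fun h => hG (h.trans (hp.isMinor_pairGraph hdZ))
  have hrest : (W \ Z).card ≤ r * (2 ^ (s + 1) * r) ^ s * R.card := by
    refine card_le_of_nbrs_clique hr hG hM (fun w hw => hW w (Finset.mem_sdiff.1 hw).1)
      fun w hw a ha b hb hab => ?_
    obtain ⟨hwW, hwZ⟩ := Finset.mem_sdiff.1 hw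
    have hne : (a : V) ≠ b := Subtype.coe_ne_coe.2 hab
    exact (SimpleGraph.fromEdgeSet_adj _).2 ⟨hsat w hwW hwZ a a.2 b b.2 ha hb hne, hne⟩
  have hcard := Finset.card_sdiff_add_card_eq_card hZW
  rw [pow_succ] at hpaired
  unfold manyNbrsConst
  linarith

/-- The bipartite graph between two families of vertex sets in which two sets are adjacent if they
are joined by an edge of `G`. -/
def contactGraph {ι κ : Type*} (G : SimpleGraph V) (T : ι → Set V) (P : κ → Set V) :
    SimpleGraph (ι ⊕ κ) :=
  SimpleGraph.fromRel fun s t =>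
    ∃ i j, s = Sum.inl i ∧ t = Sum.inr j ∧ ∃ x ∈ T i, ∃ y ∈ P j, G.Adj x y

section Contact

variable {ι κ : Type*} {T : ι → Set V} {P : κ → Set V}

theorem contactGraph_adj_inr_inl {i : ι} {j : κ} :
    (contactGraph G T P).Adj (.inr j) (.inl i) ↔ ∃ x ∈ T i, ∃ y ∈ P j, G.Adj x y := by
  simp [contactGraph]

theorem isMinor_contactGraph (hT : ∀ i, (G.induce (T i)).Connected)
    (hP : ∀ j, (G.induce (P j)).Connected) (hTd : Pairwise fun i i' => Disjoint (T i) (T i'))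
    (hPd : Pairwise fun j j' => Disjoint (P j) (P j')) (hTP : ∀ i j, Disjoint (T i) (P j)) :
    IsMinor (contactGraph G T P) G := by
  refine ⟨Sum.elim T P, ?_, ?_, ?_⟩
  · rintro (i | j)
    · exact hT i
    · exact hP j
  · rintro (i | j) (i' | j') hne
    · exact hTd fun h => hne (congrArg _ h)
    · exact hTP i j'
    · exact (hTP i' j).symm
    · exact hPd fun h => hne (congrArg _ h)
  · intro s t hst
    obtain ⟨-, ⟨i, j, rfl, rfl, x, hx, y, hy, hxy⟩ | ⟨i, j, rfl, rfl, x, hx, y, hy, hxy⟩⟩ := hst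
    · exact ⟨x, hx, y, hy, hxy⟩
    · exact ⟨y, hy, x, hx, hxy.symm⟩

theorem card_pieces_le [Fintype ι] [Fintype κ] {s r : ℕ} (hr : 0 < r)
    (hG : ¬ IsMinor (completeBipartiteGraph (Fin (s + 1)) (Fin r)) G)
    (hT : ∀ i, (G.induce (T i)).Connected) (hP : ∀ j, (G.induce (P j)).Connected)
    (hTd : Pairwise fun i i' => Disjoint (T i) (T i'))
    (hPd : Pairwise fun j j' => Disjoint (P j) (P j')) (hTP : ∀ i j, Disjoint (T i) (P j))
    (htouch : ∀ j, ∃ N : Finset ι, s + 1 ≤ N.card ∧ ∀ i ∈ N, ∃ x ∈ T i, ∃ y ∈ P j, G.Adj x y) :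
    Fintype.card κ ≤ manyNbrsConst s r * Fintype.card ι := by
  classical
  have hM : ¬ IsMinor (completeBipartiteGraph (Fin (s + 1)) (Fin r)) (contactGraph G T P) :=
    fun h => hG (h.trans (isMinor_contactGraph hT hP hTd hPd hTP))
  have hcard := card_le_of_many_nbrs hr hM (R := Finset.univ.map .inl) (W := Finset.univ.map .inr)
    (by simp [Finset.disjoint_left]) ?_
  · simpa using hcard
  · intro w hw
    obtain ⟨j, -, rfl⟩ := Finset.mem_map.1 hw
    obtain ⟨N, hN, hNadj⟩ := htouch j
    refine (hN.trans_eq (Finset.card_map .inl).symm).trans (Finset.card_le_card fun x hx => ?_)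
    obtain ⟨i, hi, rfl⟩ := Finset.mem_map.1 hx
    exact Finset.mem_filter.2 ⟨Finset.mem_map_of_mem _ (Finset.mem_univ i),
      contactGraph_adj_inr_inl.2 (hNadj i hi)⟩

theorem card_le_of_touch_stars {s r : ℕ} (hr : 0 < r)
    (hG : ¬ IsMinor (completeBipartiteGraph (Fin (s + 1)) (Fin r)) G) {R : Finset V} {S : Set V}
    {ρ : V → V} (hRS : ∀ y ∈ R, y ∉ S) (hρ : ∀ g ∈ S, G.Adj (ρ g) g) {I : Finset κ}
    (hP : ∀ i ∈ I, (G.induce (P i)).Connected)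
    (hPd : ∀ i ∈ I, ∀ j ∈ I, i ≠ j → Disjoint (P i) (P j))
    (hPR : ∀ i ∈ I, ∀ v ∈ P i, v ∉ R ∧ v ∉ S)
    (htouch : ∀ i ∈ I, ∃ N ⊆ R, s + 1 ≤ N.card ∧
      ∀ a ∈ N, ∃ x ∈ starBag S ρ a, ∃ y ∈ P i, G.Adj x y) :
    I.card ≤ manyNbrsConst s r * R.card := by
  classical
  have hcard := card_pieces_le hr hG (T := fun y : {y // y ∈ R} => starBag S ρ y)
    (P := fun i : {i // i ∈ I} => P i)
    (fun y => connected_induce_starBag fun g hg hgy => hgy ▸ hρ g hg) (fun i => hP i i.2)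
    (fun y y' hne => disjoint_starBag (hRS y y.2) (hRS y' y'.2) (Subtype.coe_ne_coe.2 hne))
    (fun i j hne => hPd i i.2 j j.2 (Subtype.coe_ne_coe.2 hne)) ?_ ?_
  · simpa only [Fintype.card_coe] using hcard
  · rintro y i
    rw [Set.disjoint_left]
    rintro g (rfl | ⟨hg, -⟩) hgP
    · exact (hPR i i.2 _ hgP).1 y.2
    · exact (hPR i i.2 g hgP).2 hg
  · intro i
    obtain ⟨N, hNR, hN, hadj⟩ := htouch i i.2
    refine ⟨N.subtype (· ∈ R), ?_, fun a ha => hadj a (Finset.mem_subtype.1 ha)⟩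
    rwa [Finset.card_subtype, Finset.filter_true_of_mem fun a ha => hNR ha]

end Contact

end Counting

/-! ### The closure of a set of vertices -/

section Closure

variable {V : Type*} [Fintype V] [DecidableEq V] (G : SimpleGraph V) [DecidableRel G.Adj]

/-- The vertices outside `K` that have the same neighbours in `K` as `z`. -/
def nbrClass (K : Finset V) (z : V) : Finset V :=
  Finset.univ.filter fun z' => z' ∉ K ∧ K.filter (G.Adj z') = K.filter (G.Adj z)

/-- Some neighbour of `w` in `X` has a neighbour outside `K` with a class of size at least `B`. -/
def Supported (X : Finset V) (B : ℕ) (K : Finset V) (w : V) : Prop :=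
  ∃ x ∈ X, G.Adj x w ∧ ∃ z, z ∉ K ∧ G.Adj x z ∧ B ≤ (nbrClass G K z).card

open Classical in
/-- One round of the closure of `X`: all unsupported vertices are added to `K`. -/
noncomputable def closureStep (X : Finset V) (B : ℕ) (K : Finset V) : Finset V :=
  K ∪ Finset.univ.filter fun w => ¬ Supported G X B K w

/-- `L x` is the stage of the closure at which the first neighbours of `x` outside `X` are about to
be added, recorded in terms of a later stage `K`. -/
structure IsEntryStage (X : Finset V) (B : ℕ) (K : Finset V) (L : V → Finset V) (x : V) :
    Prop where
  subset_stage : X ⊆ L x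
  stage_subset : L x ⊆ K
  not_adj : ∀ h ∈ L x, h ∉ X → ¬ G.Adj x h
  card_nbrClass_lt : ∀ z, z ∉ L x → G.Adj x z → (nbrClass G (L x) z).card < B
  stage_mono : ∀ h ∈ L x, h ∉ X → ∀ y ∈ X, G.Adj y h → L y ⊆ L x

/-- `L` records the entry stages of all vertices of `X` with a neighbour in `K \ X`. -/
def ClosureRecord (X : Finset V) (B : ℕ) (K : Finset V) (L : V → Finset V) : Prop :=
  ∀ x ∈ X, (∃ h ∈ K, h ∉ X ∧ G.Adj x h) → IsEntryStage G X B K L x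

theorem closureRecord_self (X : Finset V) (B : ℕ) (L : V → Finset V) : ClosureRecord G X B X L :=
  fun _ _ ⟨_, h, h', _⟩ => absurd h h'

variable {G}

theorem ClosureRecord.exists_step {X K : Finset V} {B : ℕ} {L : V → Finset V} (hXK : X ⊆ K)
    (hL : ClosureRecord G X B K L) : ∃ L', ClosureRecord G X B (closureStep G X B K) L' := by
  classical
  have hsub : K ⊆ closureStep G X B K := Finset.subset_union_left
  refine ⟨fun x => if ∃ h ∈ K, h ∉ X ∧ G.Adj x h then L x else K, fun x hx hentered => ?_⟩
  have hold : ∀ h ∈ K, h ∉ X → ∀ y, G.Adj y h →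
      (if ∃ h ∈ K, h ∉ X ∧ G.Adj y h then L y else K) = L y :=
    fun h hh hX y hy => if_pos ⟨h, hh, hX, hy⟩
  by_cases hx_old : ∃ h ∈ K, h ∉ X ∧ G.Adj x h
  · obtain ⟨hXL, hLK, hnadj, hclass, hmono⟩ := hL x hx hx_old
    constructor <;> simp only [if_pos hx_old]
    · exact hXL
    · exact hLK.trans hsub
    · exact hnadj
    · exact hclass
    · intro h hh hX y hy hyh
      rw [hold h (hLK hh) hX y hyh]
      exact hmono h hh hX y hy hyh
  · constructor <;> simp only [if_neg hx_old]
    · exact hXK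
    · exact hsub
    · exact fun h hh hX hxh => hx_old ⟨h, hh, hX, hxh⟩
    · intro z hz hxz
      obtain ⟨w, hw, hwX, hxw⟩ := hentered
      rcases Finset.mem_union.1 hw with hw | hw
      · exact absurd ⟨w, hw, hwX, hxw⟩ hx_old
      · by_contra! hlarge
        exact (Finset.mem_filter.1 hw).2 ⟨x, hx, hxw, z, hz, hxz, hlarge⟩
    · intro h hh hX y hy hyh
      rw [hold h hh hX y hyh]
      exact (hL y hy ⟨h, hh, hX, hyh⟩).stage_subset

end Closure

theorem card_le_of_helper {V : Type*} {G : SimpleGraph V} {X : Finset V} {r : ℕ} (hr : 0 < r)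
    (hG : ¬ IsMinor (completeBipartiteGraph (Fin 3) (Fin r)) G) {A : Finset V}
    {a b g ρ : V → V}
    (hA : ∀ z ∈ A, z ∉ X) (ha : ∀ z ∈ A, a z ∈ X ∧ G.Adj z (a z))
    (hb : ∀ z ∈ A, b z ∈ X ∧ G.Adj z (b z)) (hab : ∀ z ∈ A, a z ≠ b z)
    (hg : ∀ z ∈ A, g z ∉ X ∧ G.Adj z (g z)) (hρ : ∀ z ∈ A, ρ (g z) ∈ X ∧ G.Adj (ρ (g z)) (g z))
    (hane : ∀ z ∈ A, a z ≠ ρ (g z)) (hbne : ∀ z ∈ A, b z ≠ ρ (g z)) :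
    A.card ≤ 3 * manyNbrsConst 2 r * X.card := by
  classical
  obtain ⟨I, hIA, hI, hcard⟩ := exists_conflictFree_subset (q := 1) A (fun z => {g z})
    fun z => (Finset.card_singleton (g z)).le
  have hgI : ∀ z ∈ I, ∀ z' ∈ I, g z ≠ z' := by
    rintro z hz z' hz' rfl
    exact hI z hz (g z) hz' (hg z (hIA hz)).2.ne (Finset.mem_singleton_self _)
  suffices hIcard : I.card ≤ manyNbrsConst 2 r * X.card by linarith
  refine card_le_of_touch_stars hr hG (S := g '' I) (ρ := ρ) (P := fun z => {z}) ?_ ?_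
    (fun z _ => connected_induce_singleton G z)
    (fun z _ z' _ hne => Set.disjoint_singleton.2 hne) ?_ fun z hz => ?_
  · rintro y hy ⟨z, hz, rfl⟩
    exact (hg z (hIA hz)).1 hy
  · rintro _ ⟨z, hz, rfl⟩
    exact (hρ z (hIA hz)).2
  · rintro z hz _ rfl
    exact ⟨hA _ (hIA hz), fun ⟨z', hz', heq⟩ => hgI z' hz' _ hz heq⟩
  · have hzA := hIA hz
    refine ⟨{a z, b z, ρ (g z)}, ?_, (Finset.card_eq_three.2
      ⟨_, _, _, hab z hzA, hane z hzA, hbne z hzA, rfl⟩).ge, ?_⟩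
    · simp [Finset.insert_subset_iff, (ha z hzA).1, (hb z hzA).1, (hρ z hzA).1]
    · simp only [Finset.mem_insert, Finset.mem_singleton]
      rintro _ (rfl | rfl | rfl)
      · exact ⟨_, Or.inl rfl, z, rfl, (ha z hzA).2.symm⟩
      · exact ⟨_, Or.inl rfl, z, rfl, (hb z hzA).2.symm⟩
      · exact ⟨g z, Or.inr ⟨⟨z, hz, rfl⟩, rfl⟩, z, rfl, (hg z hzA).2.symm⟩

section Layering

variable {V : Type*} [DecidableEq V]

/-- Every `z ∈ H` has an anchor `f z` in `X`, and `L z` is a set of vertices older than `z`: it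
contains no other neighbour of the anchor in `H`. -/
structure IsLayering (G : SimpleGraph V) (X H : Finset V) (f : V → V) (L : V → Finset V) :
    Prop where
  disjoint : Disjoint X H
  anchor_mem : ∀ z ∈ H, f z ∈ X
  anchor_adj : ∀ z ∈ H, G.Adj (f z) z
  anchor_mem_older : ∀ z ∈ H, f z ∈ L z
  older_subset : ∀ z ∈ H, L z ⊆ X ∪ H
  not_adj : ∀ z ∈ H, ∀ h ∈ L z, h ∈ H → ¬ G.Adj (f z) h
  older_trans : ∀ z ∈ H, ∀ h ∈ L z, h ∈ H → L h ⊆ L z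

variable {G : SimpleGraph V} {X H : Finset V} {f p : V → V} {L : V → Finset V} {B r : ℕ}

namespace IsLayering

theorem absorb (hL : IsLayering G X H f L) (Q : Finset V) :
    IsLayering G (X ∪ Q) (H \ Q) f L where
  disjoint := by
    rw [Finset.disjoint_union_left]
    exact ⟨hL.disjoint.mono_right Finset.sdiff_subset, Finset.disjoint_sdiff⟩
  anchor_mem z hz := Finset.mem_union_left _ (hL.anchor_mem z (Finset.sdiff_subset hz))
  anchor_adj z hz := hL.anchor_adj z (Finset.sdiff_subset hz)
  anchor_mem_older z hz := hL.anchor_mem_older z (Finset.sdiff_subset hz)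
  older_subset z hz := by
    rw [Finset.union_assoc, Finset.union_sdiff_self_eq_union]
    exact (hL.older_subset z (Finset.sdiff_subset hz)).trans
      (Finset.union_subset_union_right Finset.subset_union_right)
  not_adj z hz h hh hhH := hL.not_adj z (Finset.sdiff_subset hz) h hh (Finset.sdiff_subset hhH)
  older_trans z hz h hh hhH :=
    hL.older_trans z (Finset.sdiff_subset hz) h hh (Finset.sdiff_subset hhH)

theorem notMem (hL : IsLayering G X H f L) {z : V} (hz : z ∈ H) : z ∉ X :=
  fun hzX => Finset.disjoint_left.1 hL.disjoint hzX hz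

theorem notMem_older (hL : IsLayering G X H f L) {z : V} (hz : z ∈ H) : z ∉ L z :=
  fun hzL => hL.not_adj z hz z hzL hz (hL.anchor_adj z hz)

theorem exists_third_anchor (hL : IsLayering G X H f L)
    (hp : ∀ z ∈ H, p z ∈ L z ∧ G.Adj z (p z) ∧ p z ≠ f z) {z h : V} (hz : z ∈ H) (hh : h ∈ H)
    (hhz : h ∈ L z) :
    ∃ c ∈ X, c ≠ f z ∧ c ≠ f h ∧ (c = p h ∨ p h ∈ H ∧ f (p h) = c) := by
  obtain ⟨hpL, hadj, hpf⟩ := hp h hh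
  by_cases hpX : p h ∈ X
  · refine ⟨p h, hpX, fun heq => ?_, hpf, Or.inl rfl⟩
    exact hL.not_adj z hz h hhz hh (heq ▸ hadj.symm)
  · have hpH : p h ∈ H := (Finset.mem_union.1 (hL.older_subset h hh hpL)).resolve_left hpX
    refine ⟨f (p h), hL.anchor_mem _ hpH, fun heq => ?_, fun heq => ?_, Or.inr ⟨hpH, rfl⟩⟩
    · exact hL.not_adj z hz _ (hL.older_trans z hz h hhz hh hpL) hpH (heq ▸ hL.anchor_adj _ hpH)
    · exact hL.not_adj h hh _ hpL hpH (heq ▸ hL.anchor_adj _ hpH)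

end IsLayering

theorem exists_scattered_subset {α : Type*} (Q : Finset α) (ζ p : α → α) (hζ : Set.InjOn ζ Q) :
    ∃ I ⊆ Q, (∀ h ∈ I, ∀ h' ∈ I, h ≠ h' → h' ≠ ζ h ∧ h' ≠ p h ∧ ζ h' ≠ p h) ∧
      Q.card ≤ 9 * I.card := by
  classical
  have hforb : ∀ h, (({ζ h, p h} : Finset α) ∪
      Q.filter fun h' => ζ h' ∈ ({h, p h} : Finset α)).card ≤ 4 := by
    intro h
    have hpreimage : (Q.filter fun h' => ζ h' ∈ ({h, p h} : Finset α)).card ≤ 2 :=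
      (Finset.card_le_card_of_injOn ζ (t := {h, p h}) (fun h' hh' => (Finset.mem_filter.1 hh').2)
        (hζ.mono (Finset.filter_subset _ _))).trans Finset.card_le_two
    exact (Finset.card_union_le _ _).trans (add_le_add Finset.card_le_two hpreimage)
  obtain ⟨I, hIQ, hI, hcard⟩ := exists_conflictFree_subset (q := 4) Q _ hforb
  refine ⟨I, hIQ, fun h hh h' hh' hne => ?_, hcard⟩
  have hfree := hI h hh h' hh' hne
  simp only [Finset.mem_union, Finset.mem_insert, Finset.mem_singleton, Finset.mem_filter,
    hIQ hh', true_and, not_or] at hfree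
  exact ⟨hfree.1.1, hfree.1.2, hfree.2.2⟩

-- The pair `{z h, h}` sees the three anchors `f (z h)`, `f h` and the one of `p h`.
theorem IsLayering.card_le_of_scattered (hL : IsLayering G X H f L) (hr : 0 < r)
    (hG : ¬ IsMinor (completeBipartiteGraph (Fin 3) (Fin r)) G)
    (hp : ∀ z ∈ H, p z ∈ L z ∧ G.Adj z (p z) ∧ p z ≠ f z) {I : Finset V} {z : V → V}
    (hIH : ∀ h ∈ I, h ∈ H) (hzH : ∀ h ∈ I, z h ∈ H) (hadj : ∀ h ∈ I, G.Adj h (z h))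
    (holder : ∀ h ∈ I, h ∈ L (z h))
    (hdisj : ∀ h ∈ I, ∀ h' ∈ I, h ≠ h' → Disjoint ({z h, h} : Set V) {z h', h'})
    (hpz : ∀ h ∈ I, ∀ h' ∈ I, p h' ≠ z h ∧ p h' ≠ h) :
    I.card ≤ manyNbrsConst 2 r * X.card := by
  refine card_le_of_touch_stars hr hG (S := {g | g ∈ H ∧ g ∈ p '' I}) (ρ := f)
    (P := fun h => {z h, h}) (fun y hy hyS => hL.notMem hyS.1 hy)
    (fun g hg => hL.anchor_adj g hg.1) (fun h hh => ?_) hdisj (fun h hh => ?_) fun h hh => ?_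
  · exact connected_induce_star (v := h) (by simp) (by simp [hadj h hh])
  · rintro v (rfl | rfl)
    · refine ⟨hL.notMem (hzH h hh), ?_⟩
      rintro ⟨-, h', hh', heq⟩
      exact (hpz h hh h' hh').1 heq
    · refine ⟨hL.notMem (hIH _ hh), ?_⟩
      rintro ⟨-, h', hh', heq⟩
      exact (hpz _ hh h' hh').2 heq
  · have hz := hzH h hh
    have hhH := hIH h hh
    obtain ⟨c, hcX, hcz, hch, hc⟩ := hL.exists_third_anchor hp hz hhH (holder h hh)
    have hne : f (z h) ≠ f h := fun heq =>
      hL.not_adj _ hz h (holder h hh) hhH (heq ▸ hL.anchor_adj h hhH)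
    refine ⟨{f (z h), f h, c}, ?_,
      (Finset.card_eq_three.2 ⟨_, _, _, hne, hcz.symm, hch.symm, rfl⟩).ge, ?_⟩
    · simp [Finset.insert_subset_iff, hL.anchor_mem _ hz, hL.anchor_mem _ hhH, hcX]
    · simp only [Finset.mem_insert, Finset.mem_singleton]
      rintro a (rfl | rfl | rfl)
      · exact ⟨_, Or.inl rfl, z h, by simp, hL.anchor_adj _ hz⟩
      · exact ⟨_, Or.inl rfl, h, by simp, hL.anchor_adj _ hhH⟩
      · refine ⟨p h, ?_, h, by simp, (hp h hhH).2.1.symm⟩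
        rcases hc with rfl | ⟨hpH, hfp⟩
        · exact Or.inl rfl
        · exact Or.inr ⟨⟨hpH, h, hh, rfl⟩, hfp⟩

theorem IsLayering.card_filter_image_le (hL : IsLayering G X H f L) (hr : 0 < r)
    (hG : ¬ IsMinor (completeBipartiteGraph (Fin 3) (Fin r)) G)
    (hp : ∀ z ∈ H, p z ∈ L z ∧ G.Adj z (p z) ∧ p z ≠ f z) :
    (H.filter fun h => ∃ z ∈ H, p z = h).card ≤ 9 * manyNbrsConst 2 r * X.card := by
  set Q := H.filter fun h => ∃ z ∈ H, p z = h
  have hQH : ∀ h ∈ Q, h ∈ H := fun h hh => (Finset.mem_filter.1 hh).1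
  choose! z hzH hpz using fun h (hh : h ∈ Q) => (Finset.mem_filter.1 hh).2
  have hinj : Set.InjOn z Q := Set.LeftInvOn.injOn (f₁' := p) fun h hh => hpz h hh
  have hz : ∀ h ∈ Q, h ∈ L (z h) ∧ G.Adj h (z h) := fun h hh => by
    obtain ⟨hmem, hadj, -⟩ := hp _ (hzH h hh)
    rw [hpz h hh] at hmem hadj
    exact ⟨hmem, hadj.symm⟩
  obtain ⟨I, hIQ, hI, hcard⟩ := exists_scattered_subset Q z p hinj
  suffices hIcard : I.card ≤ manyNbrsConst 2 r * X.card by linarith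
  refine hL.card_le_of_scattered hr hG hp (fun h hh => hQH h (hIQ hh))
    (fun h hh => hzH h (hIQ hh)) (fun h hh => (hz h (hIQ hh)).2) (fun h hh => (hz h (hIQ hh)).1)
    (fun h hh h' hh' hne => ?_) fun h hh h' hh' => ?_
  · have hzne : z h ≠ z h' := fun heq => hne (hinj (hIQ hh) (hIQ hh') heq)
    simp [hzne.symm, hne.symm, (hI h hh h' hh' hne).1, (hI h' hh' h hh hne.symm).1.symm]
  · rcases eq_or_ne h' h with rfl | hne
    · obtain ⟨hpL, hpadj, -⟩ := hp h' (hQH h' (hIQ hh))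
      refine ⟨fun heq => hL.notMem_older (hzH h' (hIQ hh)) ?_, hpadj.ne'⟩
      exact heq ▸ hL.older_trans _ (hzH h' (hIQ hh)) h' (hz h' (hIQ hh)).1 (hQH h' (hIQ hh)) hpL
    · exact ⟨(hI h' hh' h hh hne).2.2.symm, (hI h' hh' h hh hne).2.1.symm⟩

variable [DecidableRel G.Adj]

variable (G H f L) in
/-- At most `B` vertices of `H` share both the anchor and the set of older neighbours. -/
def ClassesAtMost (B : ℕ) : Prop :=
  ∀ x S, (H.filter fun z => f z = x ∧ (L z).filter (G.Adj z) = S).card ≤ B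

theorem ClassesAtMost.mono {H' : Finset V} (hB : ClassesAtMost G H f L B) (hH : H' ⊆ H) :
    ClassesAtMost G H' f L B :=
  fun x S => (Finset.card_le_card (Finset.filter_subset_filter _ hH)).trans (hB x S)

namespace IsLayering

theorem card_filter_older_nbrs_eq_singleton_le (hL : IsLayering G X H f L)
    (hB : ClassesAtMost G H f L B) :
    (H.filter fun z => (L z).filter (G.Adj z) = {f z}).card ≤ B * X.card := by
  refine Finset.card_le_mul_card_image_of_maps_to (f := f)
    (fun z hz => hL.anchor_mem z (Finset.mem_filter.1 hz).1) B fun x _ => ?_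
  refine (Finset.card_le_card fun z hz => ?_).trans (hB x {x})
  simp only [Finset.mem_filter] at hz ⊢
  obtain ⟨⟨hzH, hnbrs⟩, rfl⟩ := hz
  exact ⟨hzH, rfl, hnbrs⟩

theorem card_filter_not_older_nbrs_subset_le (hL : IsLayering G X H f L) (hr : 0 < r)
    (hG : ¬ IsMinor (completeBipartiteGraph (Fin 3) (Fin r)) G)
    (hp : ∀ z ∈ H, p z ∈ L z ∧ G.Adj z (p z) ∧ p z ≠ f z) (hpX : ∀ z ∈ H, p z ∈ X) :
    (H.filter fun z => ¬ (L z).filter (G.Adj z) ⊆ X).card ≤ 6 * manyNbrsConst 2 r * X.card := by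
  set D := H.filter fun z => ¬ (L z).filter (G.Adj z) ⊆ X
  have hDH : ∀ z ∈ D, z ∈ H := fun z hz => (Finset.mem_filter.1 hz).1
  choose! g hgmem hgX using fun z (hz : z ∈ D) => Finset.not_subset.1 (Finset.mem_filter.1 hz).2
  have hg : ∀ z ∈ D, g z ∈ L z ∧ G.Adj z (g z) := fun z hz => Finset.mem_filter.1 (hgmem z hz)
  have hgH : ∀ z ∈ D, g z ∈ H := fun z hz =>
    (Finset.mem_union.1 (hL.older_subset z (hDH z hz) (hg z hz).1)).resolve_left (hgX z hz)
  have hside : ∀ ρ : V → V, (∀ h ∈ H, ρ h ∈ X ∧ G.Adj (ρ h) h) →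
      (D.filter fun z => p z ≠ ρ (g z)).card ≤ 3 * manyNbrsConst 2 r * X.card := by
    intro ρ hρ
    have hmem : ∀ z ∈ D.filter fun z => p z ≠ ρ (g z), z ∈ D ∧ z ∈ H := fun z hz =>
      ⟨(Finset.mem_filter.1 hz).1, hDH z (Finset.mem_filter.1 hz).1⟩
    refine card_le_of_helper hr hG (a := f) (b := p) (g := g) (ρ := ρ)
      (fun z hz => hL.notMem (hmem z hz).2)
      (fun z hz => ⟨hL.anchor_mem z (hmem z hz).2, (hL.anchor_adj z (hmem z hz).2).symm⟩)
      (fun z hz => ⟨hpX z (hmem z hz).2, (hp z (hmem z hz).2).2.1⟩)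
      (fun z hz => (hp z (hmem z hz).2).2.2.symm)
      (fun z hz => ⟨hgX z (hmem z hz).1, (hg z (hmem z hz).1).2⟩)
      (fun z hz => hρ _ (hgH z (hmem z hz).1)) (fun z hz heq => ?_)
      (fun z hz => (Finset.mem_filter.1 hz).2)
    have hgz := hgH z (hmem z hz).1
    exact hL.not_adj z (hmem z hz).2 _ (hg z (hmem z hz).1).1 hgz (heq ▸ (hρ _ hgz).2)
  have hcover : D ⊆ (D.filter fun z => p z ≠ f (g z)) ∪ D.filter fun z => p z ≠ p (g z) := by
    intro z hz
    simp only [Finset.mem_union, Finset.mem_filter, hz, true_and]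
    by_contra! hboth
    exact (hp _ (hgH z hz)).2.2 (hboth.2.symm.trans hboth.1)
  have hunion := (Finset.card_le_card hcover).trans (Finset.card_union_le _ _)
  have hanchor := hside f fun h hh => ⟨hL.anchor_mem h hh, hL.anchor_adj h hh⟩
  have hsecond := hside p fun h hh => ⟨hpX h hh, (hp h hh).2.1.symm⟩
  linarith

theorem card_filter_older_nbrs_eq_pair_le (hL : IsLayering G X H f L) (hr : 0 < r)
    (hG : ¬ IsMinor (completeBipartiteGraph (Fin 3) (Fin r)) G) (hB : ClassesAtMost G H f L B)
    (hp : ∀ z ∈ H, p z ∈ L z ∧ G.Adj z (p z) ∧ p z ≠ f z) (hpX : ∀ z ∈ H, p z ∈ X) :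
    (H.filter fun z => (L z).filter (G.Adj z) = {f z, p z}).card ≤ 8 * B * r * X.card := by
  set D := H.filter fun z => (L z).filter (G.Adj z) = {f z, p z}
  have hDH : D ⊆ H := Finset.filter_subset _ _
  have hpairing : IsPairing G X D fun z => s(f z, p z) := by
    constructor <;> intro z hz
    · simp [hL.anchor_mem z (hDH hz), hpX z (hDH hz)]
    · simp [(hL.anchor_adj z (hDH hz)).symm, (hp z (hDH hz)).2.1]
    · exact (hp z (hDH hz)).2.2.symm
  have himage := hpairing.card_image_le hr hG (hL.disjoint.mono_right hDH)
  have hfiber : ∀ e ∈ D.image fun z => s(f z, p z),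
      (D.filter fun z => s(f z, p z) = e).card ≤ 2 * B := by
    intro e _
    induction e using Sym2.ind with | _ a b =>
    have hsub : (D.filter fun z => s(f z, p z) = s(a, b)) ⊆
        (H.filter fun z => f z = a ∧ (L z).filter (G.Adj z) = {a, b}) ∪
          H.filter fun z => f z = b ∧ (L z).filter (G.Adj z) = {a, b} := by
      intro z hz
      obtain ⟨hz, he⟩ := Finset.mem_filter.1 hz
      obtain ⟨hzH, hnbrs⟩ := Finset.mem_filter.1 hz
      rw [Finset.mem_union, Finset.mem_filter, Finset.mem_filter, hnbrs]
      rcases Sym2.eq_iff.1 he with ⟨hfa, hpb⟩ | ⟨hfb, hpa⟩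
      · exact Or.inl ⟨hzH, hfa, by rw [hfa, hpb]⟩
      · exact Or.inr ⟨hzH, hfb, by rw [hfb, hpa, Finset.pair_comm]⟩
    have hunion := (Finset.card_le_card hsub).trans (Finset.card_union_le _ _)
    linarith [hB a {a, b}, hB b {a, b}]
  calc D.card ≤ 2 * B * (D.image fun z => s(f z, p z)).card :=
        Finset.card_le_mul_card_image _ _ hfiber
    _ = B * (2 * (D.image fun z => s(f z, p z)).card) := by ring
    _ ≤ B * (2 ^ 3 * r * X.card) := Nat.mul_le_mul_left B himage
    _ = 8 * B * r * X.card := by ring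

theorem card_le_of_second_nbr_mem (hL : IsLayering G X H f L) (hr : 0 < r)
    (hG : ¬ IsMinor (completeBipartiteGraph (Fin 3) (Fin r)) G) (hB : ClassesAtMost G H f L B)
    (hp : ∀ z ∈ H, p z ∈ L z ∧ G.Adj z (p z) ∧ p z ≠ f z) (hpX : ∀ z ∈ H, p z ∈ X) :
    H.card ≤ (7 * manyNbrsConst 2 r + 8 * B * r) * X.card := by
  have hthree : (H.filter fun z => 3 ≤ (X.filter (G.Adj z)).card).card ≤
      manyNbrsConst 2 r * X.card :=
    card_le_of_many_nbrs hr hG (hL.disjoint.mono_right (Finset.filter_subset _ _))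
      fun z hz => (Finset.mem_filter.1 hz).2
  have hcover : H ⊆ (H.filter fun z => ¬ (L z).filter (G.Adj z) ⊆ X) ∪
      ((H.filter fun z => 3 ≤ (X.filter (G.Adj z)).card) ∪
        H.filter fun z => (L z).filter (G.Adj z) = {f z, p z}) := by
    intro z hz
    simp only [Finset.mem_union, Finset.mem_filter, hz, true_and]
    by_contra! hnone
    obtain ⟨hsub, hfew, hne⟩ := hnone
    refine hne (Finset.eq_of_subset_of_card_le ?_ ?_).symm
    · have hfz : f z ∈ (L z).filter (G.Adj z) :=
        Finset.mem_filter.2 ⟨hL.anchor_mem_older z hz, (hL.anchor_adj z hz).symm⟩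
      have hpz : p z ∈ (L z).filter (G.Adj z) := Finset.mem_filter.2 ⟨(hp z hz).1, (hp z hz).2.1⟩
      exact Finset.insert_subset hfz (Finset.singleton_subset_iff.2 hpz)
    · rw [Finset.card_pair (hp z hz).2.2.symm]
      have hle : ((L z).filter (G.Adj z)).card ≤ (X.filter (G.Adj z)).card :=
        Finset.card_le_card fun y hy => Finset.mem_filter.2 ⟨hsub hy, (Finset.mem_filter.1 hy).2⟩
      omega
  have hunion := (Finset.card_le_card hcover).trans ((Finset.card_union_le _ _).trans
    (Nat.add_le_add_left (Finset.card_union_le _ _) _))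
  have houtside := hL.card_filter_not_older_nbrs_subset_le hr hG hp hpX
  have hpairs := hL.card_filter_older_nbrs_eq_pair_le hr hG hB hp hpX
  linarith

end IsLayering

/-- The factor in the linear bound for the size of the closure of a set. -/
def closureConst (r B : ℕ) : ℕ :=
  (1 + 7 * manyNbrsConst 2 r + 8 * B * r) * ((1 + 9 * manyNbrsConst 2 r) * (1 + B))

-- First the vertices without a second older neighbour are absorbed into `X`, then the chosen
-- second older neighbours of the remaining ones.
theorem IsLayering.card_union_le (hL : IsLayering G X H f L) (hr : 0 < r)
    (hG : ¬ IsMinor (completeBipartiteGraph (Fin 3) (Fin r)) G) (hB : ClassesAtMost G H f L B) :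
    (X ∪ H).card ≤ closureConst r B * X.card := by
  set Q₀ := H.filter fun z => (L z).filter (G.Adj z) = {f z}
  have hQ₀ : (X ∪ Q₀).card ≤ (1 + B) * X.card := by
    linarith [Finset.card_union_le X Q₀, hL.card_filter_older_nbrs_eq_singleton_le hB]
  have hsecond : ∀ z ∈ H \ Q₀, ∃ y, y ∈ L z ∧ G.Adj z y ∧ y ≠ f z := by
    intro z hz
    obtain ⟨hzH, hzQ⟩ := Finset.mem_sdiff.1 hz
    by_contra! honly
    refine hzQ (Finset.mem_filter.2
      ⟨hzH, Finset.eq_singleton_iff_unique_mem.2 ⟨?_, fun y hy => ?_⟩⟩)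
    · exact Finset.mem_filter.2 ⟨hL.anchor_mem_older z hzH, (hL.anchor_adj z hzH).symm⟩
    · exact honly y (Finset.mem_filter.1 hy).1 (Finset.mem_filter.1 hy).2
  choose! p hp using hsecond
  have hL₁ := hL.absorb Q₀
  set Q₁ := (H \ Q₀).filter fun h => ∃ z ∈ H \ Q₀, p z = h
  have hQ₁ : (X ∪ Q₀ ∪ Q₁).card ≤ (1 + 9 * manyNbrsConst 2 r) * (X ∪ Q₀).card := by
    linarith [Finset.card_union_le (X ∪ Q₀) Q₁, hL₁.card_filter_image_le hr hG hp]
  have hrest := (hL₁.absorb Q₁).card_le_of_second_nbr_mem hr hG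
    (hB.mono (Finset.sdiff_subset.trans Finset.sdiff_subset))
    (fun z hz => hp z (Finset.sdiff_subset hz)) fun z hz => by
      have hzH := Finset.sdiff_subset hz
      rcases Finset.mem_union.1 (hL₁.older_subset z hzH (hp z hzH).1) with hpX | hpH
      · exact Finset.mem_union_left _ hpX
      · exact Finset.mem_union_right _ (Finset.mem_filter.2 ⟨hpH, z, hzH, rfl⟩)
  have hcover : X ∪ H ⊆ (X ∪ Q₀ ∪ Q₁) ∪ ((H \ Q₀) \ Q₁) := by
    intro z hz
    simp only [Finset.mem_union, Finset.mem_sdiff] at hz ⊢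
    tauto
  calc (X ∪ H).card ≤ (1 + 7 * manyNbrsConst 2 r + 8 * B * r) * (X ∪ Q₀ ∪ Q₁).card := by
        linarith [(Finset.card_le_card hcover).trans (Finset.card_union_le _ _)]
    _ ≤ (1 + 7 * manyNbrsConst 2 r + 8 * B * r) *
        ((1 + 9 * manyNbrsConst 2 r) * ((1 + B) * X.card)) :=
      Nat.mul_le_mul_left _ (hQ₁.trans (Nat.mul_le_mul_left _ hQ₀))
    _ = closureConst r B * X.card := by unfold closureConst; ring

theorem ClosureRecord.exists_isLayering [Fintype V] {K : Finset V}
    (hdom : ∀ z ∈ K, z ∉ X → ∃ x ∈ X, G.Adj x z) (hL : ClosureRecord G X B K L) :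
    ∃ f, IsLayering G X (K \ X) f (L ∘ f) ∧ ClassesAtMost G (K \ X) f (L ∘ f) B := by
  choose! f hfX hfadj using hdom
  have hentry : ∀ z ∈ K \ X, IsEntryStage G X B K L (f z) := fun z hz => by
    obtain ⟨hzK, hzX⟩ := Finset.mem_sdiff.1 hz
    exact hL (f z) (hfX z hzK hzX) ⟨z, hzK, hzX, hfadj z hzK hzX⟩
  have hf : ∀ z ∈ K \ X, f z ∈ X ∧ G.Adj (f z) z := fun z hz =>
    ⟨hfX z (Finset.mem_sdiff.1 hz).1 (Finset.mem_sdiff.1 hz).2,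
      hfadj z (Finset.mem_sdiff.1 hz).1 (Finset.mem_sdiff.1 hz).2⟩
  have hlayering : IsLayering G X (K \ X) f (L ∘ f) :=
    { disjoint := Finset.disjoint_sdiff
      anchor_mem := fun z hz => (hf z hz).1
      anchor_adj := fun z hz => (hf z hz).2
      anchor_mem_older := fun z hz => (hentry z hz).subset_stage (hf z hz).1
      older_subset := fun z hz => by
        rw [Finset.union_sdiff_self_eq_union]
        exact (hentry z hz).stage_subset.trans Finset.subset_union_right
      not_adj := fun z hz h hh hhH => (hentry z hz).not_adj h hh (Finset.mem_sdiff.1 hhH).2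
      older_trans := fun z hz h hh hhH => (hentry z hz).stage_mono h hh
        (Finset.mem_sdiff.1 hhH).2 (f h) (hf h hhH).1 (hf h hhH).2 }
  refine ⟨f, hlayering, fun x S => ?_⟩
  rcases Finset.eq_empty_or_nonempty
    ((K \ X).filter fun z => f z = x ∧ ((L ∘ f) z).filter (G.Adj z) = S) with hempty | ⟨z₀, hz₀⟩
  · rw [hempty]
    exact Nat.zero_le _
  obtain ⟨hz₀, rfl, rfl⟩ := Finset.mem_filter.1 hz₀
  refine (Finset.card_le_card fun z hz => ?_).trans ((hentry z₀ ‹_›).card_nbrClass_lt z₀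
    (hlayering.notMem_older ‹_›) (hf z₀ ‹_›).2).le
  obtain ⟨hz, hfz, hnbrs⟩ := Finset.mem_filter.1 hz
  refine Finset.mem_filter.2 ⟨Finset.mem_univ _, hfz ▸ hlayering.notMem_older hz, ?_⟩
  simpa only [Function.comp_apply, hfz] using hnbrs

theorem ClosureRecord.card_le [Fintype V] {K : Finset V} (hr : 0 < r)
    (hG : ¬ IsMinor (completeBipartiteGraph (Fin 3) (Fin r)) G)
    (hdom : ∀ z ∈ K, z ∉ X → ∃ x ∈ X, G.Adj x z) (hL : ClosureRecord G X B K L) :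
    K.card ≤ closureConst r B * X.card := by
  obtain ⟨f, hlayering, hB⟩ := hL.exists_isLayering hdom
  refine (Finset.card_le_card ?_).trans (hlayering.card_union_le hr hG hB)
  rw [Finset.union_sdiff_self_eq_union]
  exact Finset.subset_union_right

end Layering

/-! ### Reconfiguration through a reservoir -/

section Reach

variable {V : Type*} {G : SimpleGraph V}

theorem isIndepSet_mono {S T : Finset V} (hT : G.IsIndepSet (T : Set V)) (hST : S ⊆ T) :
    G.IsIndepSet (S : Set V) :=
  Set.Pairwise.mono (Finset.coe_subset.2 hST) hT

theorem isIndepSet_union [DecidableEq V] {S T : Finset V} (hS : G.IsIndepSet (S : Set V))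
    (hT : G.IsIndepSet (T : Set V)) (h : ∀ u ∈ S, ∀ v ∈ T, ¬ G.Adj u v) :
    G.IsIndepSet ((S ∪ T : Finset V) : Set V) := by
  rw [Finset.coe_union]
  exact Set.pairwise_union.2
    ⟨hS, hT, fun u hu v hv _ => ⟨h u hu v hv, fun hvu => h u hu v hv hvu.symm⟩⟩

theorem card_insert_erase [DecidableEq V] {A : Finset V} {v w : V} (hv : v ∈ A) (hw : w ∉ A) :
    (insert w (A.erase v)).card = A.card := by
  rw [Finset.card_insert_of_notMem fun h => hw (Finset.mem_of_mem_erase h),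
    Finset.card_erase_add_one hv]

variable [DecidableEq V]

variable (G) in
/-- A token jump between two independent subsets of `M`. -/
structure JumpIn (M A B : Finset V) : Prop where
  source_subset : A ⊆ M
  target_subset : B ⊆ M
  source_indep : G.IsIndepSet (A : Set V)
  jump : Jump G A B

theorem JumpIn.symm {M A B : Finset V} (h : JumpIn G M A B) : JumpIn G M B A := by
  obtain ⟨hA, hB, hiA, v, hv, w, hw, rfl, hiB⟩ := h
  have hvw : v ≠ w := fun h => hw (h ▸ hv)
  refine ⟨hB, hA, hiB, w, Finset.mem_insert_self _ _, v, by simp [hvw], ?_, hiA⟩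
  rw [Finset.erase_insert fun h => hw (Finset.mem_of_mem_erase h), Finset.insert_erase hv]

variable (G) in
/-- Reconfigurability by token jumps between independent subsets of `M`. -/
def Reach (M : Finset V) : Finset V → Finset V → Prop := Relation.ReflTransGen (JumpIn G M)

namespace Reach

variable {M A B : Finset V}

theorem trans {C : Finset V} (h : Reach G M A B) (h' : Reach G M B C) : Reach G M A C :=
  Relation.ReflTransGen.trans h h'

theorem symm (h : Reach G M A B) : Reach G M B A :=
  have : Std.Symm (JumpIn G M) := ⟨fun _ _ => JumpIn.symm⟩
  Relation.ReflTransGen.stdSymm.symm _ _ h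

theorem mono {M' : Finset V} (hM : M ⊆ M') (h : Reach G M A B) : Reach G M' A B :=
  h.lift id fun _ _ h =>
    ⟨h.source_subset.trans hM, h.target_subset.trans hM, h.source_indep, h.jump⟩

theorem card_eq (h : Reach G M A B) : B.card = A.card := by
  induction h with
  | refl => rfl
  | tail _ h ih =>
    obtain ⟨v, hv, w, hw, rfl, -⟩ := h.jump
    rw [card_insert_erase hv hw, ih]

end Reach

theorem reach_insert_erase {M S : Finset V} {s w : V} (hSM : S ⊆ M)
    (hS : G.IsIndepSet (S : Set V)) (hs : s ∈ S) (hwM : w ∈ M) (hwS : w ∉ S)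
    (hw : ∀ t ∈ S.erase s, ¬ G.Adj w t) :
    Reach G M S (insert w (S.erase s)) ∧
      G.IsIndepSet ((insert w (S.erase s) : Finset V) : Set V) := by
  have hind : G.IsIndepSet ((insert w (S.erase s) : Finset V) : Set V) := by
    rw [Finset.insert_eq]
    exact isIndepSet_union (by simp) (isIndepSet_mono hS (Finset.erase_subset _ _))
      (by simpa using hw)
  exact ⟨.single ⟨hSM, Finset.insert_subset hwM ((Finset.erase_subset _ _).trans hSM), hS,
    s, hs, w, hwS, rfl, hind⟩, hind⟩

theorem reach_of_subset {M Q : Finset V} (hQ : G.IsIndepSet (Q : Set V)) (hQM : Q ⊆ M)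
    {A B : Finset V} (hA : A ⊆ Q) (hB : B ⊆ Q) (hAB : A.card = B.card) : Reach G M A B := by
  induction hn : (A \ B).card generalizing A with
  | zero =>
    rw [Finset.card_eq_zero, Finset.sdiff_eq_empty_iff_subset] at hn
    rw [Finset.eq_of_subset_of_card_le hn hAB.ge]
    exact .refl
  | succ n ih =>
    obtain ⟨v, hv⟩ : (A \ B).Nonempty := Finset.card_pos.1 (by omega)
    obtain ⟨w, hw⟩ : (B \ A).Nonempty :=
      Finset.card_pos.1 (by rw [Finset.card_sdiff_comm hAB.symm]; omega)
    have hvA := (Finset.mem_sdiff.1 hv).1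
    obtain ⟨hwB, hwA⟩ := Finset.mem_sdiff.1 hw
    have hA' : insert w (A.erase v) ⊆ Q :=
      Finset.insert_subset (hB hwB) ((Finset.erase_subset _ _).trans hA)
    have hjump : JumpIn G M A (insert w (A.erase v)) :=
      ⟨hA.trans hQM, hA'.trans hQM, isIndepSet_mono hQ hA, v, hvA, w, hwA, rfl,
        isIndepSet_mono hQ hA'⟩
    refine .head hjump (ih hA' ((card_insert_erase hvA hwA).trans hAB) ?_)
    rw [Finset.insert_sdiff_of_mem _ hwB, Finset.erase_sdiff_comm, Finset.card_erase_of_mem hv, hn,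
      Nat.add_sub_cancel]

theorem Reach.exists_exit {M K S T : Finset V} (h : Reach G M S T) (hSK : S ⊆ K)
    (hST : ¬ Reach G K S T) :
    ∃ S₁ ⊆ K, Reach G K S S₁ ∧ G.IsIndepSet (S₁ : Set V) ∧
      ∃ s ∈ S₁, ∃ w, w ∉ K ∧ G.IsIndepSet ((insert w (S₁.erase s) : Finset V) : Set V) := by
  by_contra! hstay
  suffices T ⊆ K ∧ Reach G K S T from hST this.2
  clear hST
  induction h with
  | refl => exact ⟨hSK, .refl⟩
  | tail _ h ih =>
    obtain ⟨hK, hreach⟩ := ih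
    obtain ⟨v, hv, w, -, rfl, hind⟩ := h.jump
    have hwK : w ∈ K := by
      by_contra hwK
      exact hstay _ hK hreach h.source_indep v hv w hwK hind
    have hsub := Finset.insert_subset hwK ((Finset.erase_subset v _).trans hK)
    exact ⟨hsub, .tail hreach ⟨hK, hsub, h.source_indep, h.jump⟩⟩

theorem exists_reach_sdiff_union {M S F W : Finset V} {s : V} (hSM : S ⊆ M)
    (hS : G.IsIndepSet (S : Set V)) (hFS : F ⊆ S) (hs : s ∈ F) (hWM : W ⊆ M)
    (hW : G.IsIndepSet (W : Set V)) (hFW : F.card ≤ W.card) (hSW : Disjoint S W)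
    (hfree : ∀ u ∈ W, ∀ t ∈ S, G.Adj u t → t = s) :
    ∃ U ⊆ W, U.card = F.card ∧ Reach G M S (S \ F ∪ U) ∧
      G.IsIndepSet ((S \ F ∪ U : Finset V) : Set V) := by
  obtain ⟨U, hUW, hUcard⟩ := Finset.exists_subset_card_eq hFW
  obtain ⟨u, hu⟩ : U.Nonempty := Finset.card_pos.1 (hUcard ▸ Finset.card_pos.2 ⟨s, hs⟩)
  have hnadj : ∀ t ∈ S.erase s, ∀ u ∈ W, ¬ G.Adj t u := fun t ht u hu htu =>
    Finset.ne_of_mem_erase ht (hfree u hu t (Finset.mem_of_mem_erase ht) htu.symm)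
  have huS : u ∉ S := Finset.disjoint_right.1 hSW (hUW hu)
  have hind : G.IsIndepSet ((S.erase s ∪ W : Finset V) : Set V) :=
    isIndepSet_union (isIndepSet_mono hS (Finset.erase_subset _ _)) hW hnadj
  have hsub : S \ F ∪ U ⊆ S.erase s ∪ W := by
    refine Finset.union_subset_union (fun x hx => ?_) hUW
    obtain ⟨hxS, hxF⟩ := Finset.mem_sdiff.1 hx
    exact Finset.mem_erase.2 ⟨fun hxs => hxF (hxs ▸ hs), hxS⟩
  have hcard : (insert u (S.erase s)).card = (S \ F ∪ U).card := by
    rw [card_insert_erase (hFS hs) huS,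
      Finset.card_union_of_disjoint (hSW.mono Finset.sdiff_subset hUW), hUcard,
      Finset.card_sdiff_add_card_eq_card hFS]
  have hjump := (reach_insert_erase hSM hS (hFS hs) (hWM (hUW hu)) huS
    fun t ht hut => hnadj t ht u (hUW hu) hut.symm).1
  exact ⟨U, hUW, hUcard, hjump.trans (reach_of_subset hind
    (Finset.union_subset ((Finset.erase_subset _ _).trans hSM) hWM)
    (Finset.insert_subset (Finset.mem_union_right _ (hUW hu)) Finset.subset_union_left) hsub hcard),
    isIndepSet_mono hind hsub⟩

end Reach

section Reservoir

variable {V : Type*} [DecidableEq V] {G : SimpleGraph V} [DecidableRel G.Adj]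

variable (G) in
/-- `Z` is a reservoir for `K` in `M`: an independent set outside `K` whose vertices have at most
two neighbours in `K` and come in groups of at least 14 with the same neighbours in `K`. -/
structure Reservoir (M K Z : Finset V) : Prop where
  core_subset : K ⊆ M
  subset : Z ⊆ M
  notMem : ∀ z ∈ Z, z ∉ K
  indep : G.IsIndepSet (Z : Set V)
  card_nbrs_le : ∀ z ∈ Z, (K.filter (G.Adj z)).card ≤ 2
  le_card_group : ∀ z ∈ Z, 14 ≤ (Z.filter fun z' => K.filter (G.Adj z') = K.filter (G.Adj z)).card

variable (G) in
/-- Tokens can be put on two further vertices of `Z`. -/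
def HasTwoFree (Z S : Finset V) : Prop :=
  ∃ D ⊆ Z, D.card = 2 ∧ Disjoint S D ∧ G.IsIndepSet ((S ∪ D : Finset V) : Set V)

namespace Reservoir

variable {M K Z S : Finset V} {t y : V}

theorem not_adj_of_nbrs_eq (hZ : Reservoir G M K Z) {T : Finset V} (hT : T ⊆ K ∪ Z) {a : V}
    (ha : a ∈ Z) (hay : K.filter (G.Adj a) = K.filter (G.Adj y)) (hy : ∀ x ∈ T, ¬ G.Adj y x) :
    ∀ x ∈ T, ¬ G.Adj a x := by
  intro x hx hax
  rcases Finset.mem_union.1 (hT hx) with hxK | hxZ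
  · have hxy := hay ▸ Finset.mem_filter.2 ⟨hxK, hax⟩
    exact hy x hx (Finset.mem_filter.1 hxy).2
  · exact isIndepSet_iff_forall_not_adj.1 hZ.indep a ha x hxZ hax

theorem hasTwoFree_of_not_adj (hZ : Reservoir G M K Z) (hS : S ⊆ K ∪ Z)
    (hind : G.IsIndepSet (S : Set V)) (hy : y ∈ Z) (hyS : ∀ x ∈ S, ¬ G.Adj y x)
    (hgroup : ∀ a, K.filter (G.Adj a) = K.filter (G.Adj y) → a ∉ S) : HasTwoFree G Z S := by
  obtain ⟨D, hD, hDcard⟩ := Finset.exists_subset_card_eq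
    (le_trans (by norm_num) (hZ.le_card_group y hy) : 2 ≤ _)
  have hDZ : D ⊆ Z := hD.trans (Finset.filter_subset _ _)
  have hDnbrs : ∀ a ∈ D, K.filter (G.Adj a) = K.filter (G.Adj y) := fun a ha =>
    (Finset.mem_filter.1 (hD ha)).2
  exact ⟨D, hDZ, hDcard, Finset.disjoint_right.2 fun a ha => hgroup a (hDnbrs a ha),
    isIndepSet_union hind (isIndepSet_mono hZ.indep hDZ) fun x hx a ha hxa =>
      hZ.not_adj_of_nbrs_eq hS (hDZ ha) (hDnbrs a ha) hyS x hx hxa.symm⟩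

-- The at most two tokens that block `y` jump to the free vertices; they block precisely the group
-- of `y`, which thereby becomes free.
theorem exists_release (hZ : Reservoir G M K Z) (hS : S ⊆ K ∪ Z) (hfree : HasTwoFree G Z S)
    (hy : y ∈ Z) (ht : t ∈ S) (hyt : G.Adj y t) :
    ∃ S' ⊆ K ∪ Z, Reach G M S S' ∧ HasTwoFree G Z S' ∧ S' ∩ K ⊂ S ∩ K := by
  obtain ⟨D, hDZ, hDcard, hSD, hind⟩ := hfree
  have hindep := isIndepSet_iff_forall_not_adj.1 hind
  have hZindep := isIndepSet_iff_forall_not_adj.1 hZ.indep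
  set F := S.filter (G.Adj y)
  have hFS : F ⊆ S := Finset.filter_subset _ _
  have hFK : F ⊆ K.filter (G.Adj y) := fun x hx => by
    obtain ⟨hxS, hyx⟩ := Finset.mem_filter.1 hx
    exact Finset.mem_filter.2
      ⟨(Finset.mem_union.1 (hS hxS)).resolve_right fun hxZ => hZindep y hy x hxZ hyx, hyx⟩
  have htF : t ∈ F := Finset.mem_filter.2 ⟨ht, hyt⟩
  obtain ⟨U, hUD, hUcard⟩ := Finset.exists_subset_card_eq
    (((Finset.card_le_card hFK).trans (hZ.card_nbrs_le y hy)).trans hDcard.ge)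
  have hUZ := hUD.trans hDZ
  have hsub : S \ F ∪ U ⊆ S ∪ D := Finset.union_subset_union Finset.sdiff_subset hUD
  have hcard : S.card = (S \ F ∪ U).card := by
    rw [Finset.card_union_of_disjoint (hSD.mono Finset.sdiff_subset hUD), hUcard,
      Finset.card_sdiff_add_card_eq_card hFS]
  have hSU : S \ F ∪ U ⊆ K ∪ Z :=
    Finset.union_subset (Finset.sdiff_subset.trans hS) (hUZ.trans Finset.subset_union_right)
  have hSDM : S ∪ D ⊆ M := (Finset.union_subset hS (hDZ.trans Finset.subset_union_right)).trans
    (Finset.union_subset hZ.core_subset hZ.subset)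
  refine ⟨S \ F ∪ U, hSU, reach_of_subset hind hSDM Finset.subset_union_left hsub hcard, ?_, ?_⟩
  · have hy_free : ∀ x ∈ S \ F ∪ U, ¬ G.Adj y x := fun x hx hyx => by
      rcases Finset.mem_union.1 hx with hxS | hxU
      · exact (Finset.mem_sdiff.1 hxS).2 (Finset.mem_filter.2 ⟨(Finset.mem_sdiff.1 hxS).1, hyx⟩)
      · exact hZindep y hy x (hUZ hxU) hyx
    refine hZ.hasTwoFree_of_not_adj hSU (isIndepSet_mono hind hsub) hy hy_free fun a hay haS => ?_
    exact hindep a (hsub haS) t (Finset.mem_union_left _ ht)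
      (Finset.mem_filter.1 (hay ▸ hFK htF)).2
  · have hU : ∀ x ∈ U, x ∉ K := fun x hx => hZ.notMem x (hUZ hx)
    refine (Finset.ssubset_iff_of_subset fun x hx => ?_).2
      ⟨t, Finset.mem_inter.2 ⟨ht, (Finset.mem_filter.1 (hFK htF)).1⟩, fun htU => ?_⟩
    · simp only [Finset.mem_inter, Finset.mem_union, Finset.mem_sdiff] at hx ⊢
      exact ⟨(hx.1.resolve_right fun hxU => hU x hxU hx.2).1, hx.2⟩
    · simp only [Finset.mem_inter, Finset.mem_union, Finset.mem_sdiff] at htU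
      exact (htU.1.resolve_right fun htU' => hU t htU' htU.2).2 htF

theorem exists_reach_of_hasTwoFree (hZ : Reservoir G M K Z) (hSZ : S.card ≤ Z.card)
    (hS : S ⊆ K ∪ Z) (hfree : HasTwoFree G Z S) : ∃ A ⊆ Z, Reach G M S A := by
  induction hn : S ∩ K using Finset.strongInduction generalizing S with | H _ ih =>
  subst hn
  by_cases hlock : ∃ y ∈ Z, ∃ t ∈ S, G.Adj y t
  · obtain ⟨y, hy, t, ht, hyt⟩ := hlock
    obtain ⟨S', hS', hreach, hfree', hlt⟩ := hZ.exists_release hS hfree hy ht hyt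
    obtain ⟨A, hA, hreach'⟩ := ih _ hlt (hreach.card_eq.trans_le hSZ) hS' hfree' rfl
    exact ⟨A, hA, hreach.trans hreach'⟩
  · push Not at hlock
    obtain ⟨D, -, -, -, hind⟩ := hfree
    obtain ⟨A, hA, hAcard⟩ := Finset.exists_subset_card_eq hSZ
    have hSM := hS.trans (Finset.union_subset hZ.core_subset hZ.subset)
    exact ⟨A, hA, reach_of_subset (isIndepSet_union
      (isIndepSet_mono hind Finset.subset_union_left) hZ.indep
      fun u hu v hv h => hlock v hv u hu h.symm) (Finset.union_subset hSM hZ.subset)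
      Finset.subset_union_left (hA.trans Finset.subset_union_right) hAcard.symm⟩

-- The tokens on `U` move to `A`, which leaves two further vertices of `A` free.
theorem exists_reach_of_exchange (hZ : Reservoir G M K Z) {T U A : Finset V} (hTK : T ⊆ K)
    (hUM : U ⊆ M) (hTU : Disjoint T U) (hcard : (T ∪ U).card ≤ Z.card) (hAZ : A ⊆ Z)
    (hUA : U.card + 2 ≤ A.card) (hind : G.IsIndepSet ((T ∪ U ∪ A : Finset V) : Set V)) :
    ∃ A' ⊆ Z, Reach G M (T ∪ U) A' := by
  obtain ⟨B, hBA, hBcard⟩ := Finset.exists_subset_card_eq ((Nat.le_add_right _ 2).trans hUA)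
  obtain ⟨D, hDA, hDcard⟩ : ∃ D ⊆ A \ B, D.card = 2 :=
    Finset.exists_subset_card_eq (by rw [Finset.card_sdiff_of_subset hBA]; omega)
  have hTA : Disjoint T A :=
    Finset.disjoint_left.2 fun x hxT hxA => hZ.notMem x (hAZ hxA) (hTK hxT)
  have hTB : T ∪ B ⊆ T ∪ U ∪ A := Finset.union_subset_union Finset.subset_union_left hBA
  have hcardB : (T ∪ U).card = (T ∪ B).card := by
    rw [Finset.card_union_of_disjoint hTU,
      Finset.card_union_of_disjoint (hTA.mono_right hBA), hBcard]
  have hM : T ∪ U ∪ A ⊆ M := Finset.union_subset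
    (Finset.union_subset (hTK.trans hZ.core_subset) hUM) (hAZ.trans hZ.subset)
  have hDA' : D ⊆ A := hDA.trans Finset.sdiff_subset
  have hfree : HasTwoFree G Z (T ∪ B) :=
    ⟨D, hDA'.trans hAZ, hDcard,
      Finset.disjoint_union_left.2
        ⟨hTA.mono_right hDA', Finset.disjoint_sdiff.mono_right hDA⟩,
      isIndepSet_mono hind (Finset.union_subset hTB (hDA'.trans Finset.subset_union_right))⟩
  obtain ⟨A', hA', hreach⟩ := hZ.exists_reach_of_hasTwoFree (hcardB.symm.trans_le hcard)
    (Finset.union_subset_union hTK (hBA.trans hAZ)) hfree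
  exact ⟨A', hA', (reach_of_subset hind hM Finset.subset_union_left hTB hcardB).trans hreach⟩

end Reservoir

end Reservoir

section Room

variable {V : Type*} {G : SimpleGraph V} [DecidableRel G.Adj]

theorem card_filter_lt_mul_card_nbrs_le {q : ℕ} (hdeg : ∀ A : Finset V, degSum G A ≤ q * A.card)
    {U Z : Finset V} (hUZ : U.card ≤ Z.card) (c : ℕ) :
    (U.filter fun u => Z.card < c * (Z.filter (G.Adj u)).card).card ≤ 2 * c * q := by
  classical
  set D := U.filter fun u => Z.card < c * (Z.filter (G.Adj u)).card
  have hDU : D ⊆ U := Finset.filter_subset _ _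
  rcases Z.card.eq_zero_or_pos with hZ | hZ
  · rw [Finset.card_eq_zero.1 (Nat.le_zero.1 (((Finset.card_le_card hDU).trans hUZ).trans hZ.le))]
    exact Nat.zero_le _
  have hsum : ∑ u ∈ D, (Z.filter (G.Adj u)).card ≤ degSum G (U ∪ Z) :=
    (Finset.sum_le_sum fun u _ => Finset.card_le_card
      (Finset.filter_subset_filter _ Finset.subset_union_right)).trans
      (Finset.sum_le_sum_of_subset (hDU.trans Finset.subset_union_left))
  have hunion := Finset.card_union_le U Z
  refine Nat.le_of_mul_le_mul_right ?_ hZ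
  calc D.card * Z.card ≤ ∑ u ∈ D, c * (Z.filter (G.Adj u)).card := by
        rw [← smul_eq_mul]
        exact Finset.card_nsmul_le_sum _ _ _ fun u hu => (Finset.mem_filter.1 hu).2.le
    _ ≤ c * degSum G (U ∪ Z) := by
        rw [← Finset.mul_sum]
        exact Nat.mul_le_mul_left _ hsum
    _ ≤ c * (q * (Z.card + Z.card)) := by
        gcongr
        exact (hdeg _).trans (Nat.mul_le_mul_left _ (by omega))
    _ = 2 * c * q * Z.card := by ring

theorem exists_sparse_isIndepSet {q c m : ℕ} (hdeg : ∀ A : Finset V, degSum G A ≤ q * A.card)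
    {U Z : Finset V} (hU : 2 * c * q + (q + 1) * m ≤ U.card)
    (hZ : 2 * c * q + (q + 1) * m ≤ Z.card) :
    ∃ W ⊆ U, W.card = m ∧ G.IsIndepSet (W : Set V) ∧
      ∀ u ∈ W, c * (Z.filter (G.Adj u)).card ≤ Z.card := by
  classical
  obtain ⟨U', hU', hU'card⟩ := Finset.exists_subset_card_eq hU
  have hbad := card_filter_lt_mul_card_nbrs_le hdeg (hU'card.trans_le hZ) c
  set D := U'.filter fun u => Z.card < c * (Z.filter (G.Adj u)).card
  have hsdiff : (U' \ D).card + D.card = U'.card :=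
    Finset.card_sdiff_add_card_eq_card (Finset.filter_subset _ _)
  obtain ⟨I, hI, hind, hIcard⟩ := exists_isIndepSet_subset hdeg (U' \ D)
  have hmI : m ≤ I.card := by
    refine Nat.le_of_mul_le_mul_left (?_ : (q + 1) * m ≤ (q + 1) * I.card) q.succ_pos
    omega
  obtain ⟨W, hW, hWcard⟩ := Finset.exists_subset_card_eq hmI
  refine ⟨W, hW.trans (hI.trans (Finset.sdiff_subset.trans hU')), hWcard,
    isIndepSet_mono hind hW, fun u hu => ?_⟩
  obtain ⟨huU, huD⟩ := Finset.mem_sdiff.1 (hI (hW hu))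
  by_contra! hlt
  exact huD (Finset.mem_filter.2 ⟨huU, hlt⟩)

theorem mul_card_filter_dominated_le {c : ℕ} {W Z : Finset V}
    (hW : ∀ u ∈ W, c * (Z.filter (G.Adj u)).card ≤ Z.card) :
    c * (Z.filter fun z => ∃ u ∈ W, G.Adj u z).card ≤ W.card * Z.card := by
  classical
  have hsub : (Z.filter fun z => ∃ u ∈ W, G.Adj u z) ⊆ W.biUnion fun u => Z.filter (G.Adj u) := by
    intro z hz
    simp only [Finset.mem_filter, Finset.mem_biUnion] at hz ⊢
    exact hz.2.imp fun u hu => ⟨hu.1, hz.1, hu.2⟩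
  calc c * (Z.filter fun z => ∃ u ∈ W, G.Adj u z).card
      ≤ c * ∑ u ∈ W, (Z.filter (G.Adj u)).card :=
        Nat.mul_le_mul_left _ ((Finset.card_le_card hsub).trans Finset.card_biUnion_le)
    _ = ∑ u ∈ W, c * (Z.filter (G.Adj u)).card := Finset.mul_sum _ _ _
    _ ≤ W.card * Z.card := by
        rw [← smul_eq_mul W.card]
        exact Finset.sum_le_card_nsmul _ _ _ hW

theorem exists_card_fiber_le_two_mul {α β : Type*} [DecidableEq β] {Z Z' : Finset α}
    (hZ : Z.Nonempty) (hZZ' : Z' ⊆ Z) (hcard : Z.card ≤ 2 * Z'.card) (f : α → β) :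
    ∃ y ∈ Z, (Z.filter fun z => f z = f y).card ≤ 2 * (Z'.filter fun z => f z = f y).card := by
  have hsum : ∑ b ∈ Z.image f, (Z.filter fun z => f z = b).card ≤
      ∑ b ∈ Z.image f, 2 * (Z'.filter fun z => f z = b).card := by
    rwa [← Finset.mul_sum, ← Finset.card_eq_sum_card_image, ← Finset.card_eq_sum_card_fiberwise]
    exact fun z hz => Finset.mem_image_of_mem f (hZZ' hz)
  obtain ⟨b, hb, hle⟩ := Finset.exists_le_of_sum_le (hZ.image f) hsum
  obtain ⟨y, hy, rfl⟩ := Finset.mem_image.1 hb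
  exact ⟨y, hy, hle⟩

/-- The size of a class that counts as large. -/
def classConst (r : ℕ) : ℕ := 298 * r + 5

variable [DecidableEq V] {M K Z : Finset V} {r : ℕ}

theorem Reservoir.exists_free_group (hZ : Reservoir G M K Z) (hZne : Z.Nonempty)
    {W : Finset V} (hWcard : W.card = 5) (hW : ∀ u ∈ W, 16 * (Z.filter (G.Adj u)).card ≤ Z.card) :
    ∃ y ∈ Z, ∃ A ⊆ Z, 7 ≤ A.card ∧ (∀ a ∈ A, K.filter (G.Adj a) = K.filter (G.Adj y)) ∧
      ∀ a ∈ A, ∀ u ∈ W, ¬ G.Adj u a := by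
  have hD := mul_card_filter_dominated_le hW
  set D := Z.filter fun z => ∃ u ∈ W, G.Adj u z
  rw [hWcard] at hD
  have hsdiff : (Z \ D).card + D.card = Z.card :=
    Finset.card_sdiff_add_card_eq_card (Finset.filter_subset _ _)
  obtain ⟨y, hy, hle⟩ := exists_card_fiber_le_two_mul hZne
    (Finset.sdiff_subset (s := Z) (t := D)) (by omega) fun z => K.filter (G.Adj z)
  refine ⟨y, hy, (Z \ D).filter fun z => K.filter (G.Adj z) = K.filter (G.Adj y),
    (Finset.filter_subset _ _).trans Finset.sdiff_subset, ?_,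
    fun a ha => (Finset.mem_filter.1 ha).2, fun a ha u hu hua => ?_⟩
  · have := hZ.le_card_group y hy
    omega
  · obtain ⟨haZ, haD⟩ := Finset.mem_sdiff.1 (Finset.mem_filter.1 ha).1
    exact haD (Finset.mem_filter.2 ⟨haZ, u, hu, hua⟩)

theorem Reservoir.exists_subset_blocking (hZ : Reservoir G M K Z) {y : V} (hy : y ∈ Z)
    {S : Finset V} (hSK : (S \ K).card ≤ 2) {s : V} (hs : s ∈ S) :
    ∃ F ⊆ S, s ∈ F ∧ F.card ≤ 5 ∧ ∀ x ∈ S \ F, x ∈ K ∧ ¬ G.Adj y x := by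
  refine ⟨insert s (S \ K ∪ (S ∩ K).filter (G.Adj y)), ?_, Finset.mem_insert_self _ _, ?_,
    fun x hx => ?_⟩
  · exact Finset.insert_subset hs <| Finset.union_subset Finset.sdiff_subset <|
      (Finset.filter_subset _ _).trans Finset.inter_subset_left
  · have hblock := (Finset.card_le_card (Finset.filter_subset_filter (G.Adj y)
      (Finset.inter_subset_right (s₁ := S) (s₂ := K)))).trans (hZ.card_nbrs_le y hy)
    have hinsert := Finset.card_insert_le s (S \ K ∪ (S ∩ K).filter (G.Adj y))
    have hunion := Finset.card_union_le (S \ K) ((S ∩ K).filter (G.Adj y))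
    omega
  · simp only [Finset.mem_sdiff, Finset.mem_insert, Finset.mem_union, Finset.mem_filter,
      Finset.mem_inter] at hx
    tauto

-- Five independent vertices of `U` serve as a parking lot for `s`, the tokens outside `K` and those
-- blocking a suitable group of the reservoir.
theorem Reservoir.exists_reach_of_room (hZ : Reservoir G M K Z)
    (hdeg : ∀ A : Finset V, degSum G A ≤ 8 * r * A.card) (hZcard : classConst r ≤ Z.card)
    {S U : Finset V} (hSM : S ⊆ M) (hS : G.IsIndepSet (S : Set V)) (hSZ : S.card ≤ Z.card)
    (hSK : (S \ K).card ≤ 2) {s : V} (hs : s ∈ S) (hUM : U ⊆ M)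
    (hUcard : 296 * r + 5 ≤ U.card) (hSU : Disjoint S U)
    (hfree : ∀ u ∈ U, ∀ t ∈ S, G.Adj u t → t = s) : ∃ A ⊆ Z, Reach G M S A := by
  unfold classConst at hZcard
  obtain ⟨W, hWU, hWcard, hW, hWsparse⟩ :=
    exists_sparse_isIndepSet (c := 16) (m := 5) (U := U) (Z := Z) hdeg (by omega) (by omega)
  obtain ⟨y, hy, A, hAZ, hAcard, hAnbrs, hAW⟩ :=
    hZ.exists_free_group (Finset.card_pos.1 (by omega)) hWcard hWsparse
  obtain ⟨F, hFS, hsF, hFcard, hSF⟩ := hZ.exists_subset_blocking hy hSK hs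
  obtain ⟨P, hPW, hPcard, hreach, hind⟩ := exists_reach_sdiff_union hSM hS hFS
    hsF (hWU.trans hUM) hW (hFcard.trans hWcard.ge)
    (hSU.mono_right hWU) fun u hu => hfree u (hWU hu)
  have hSFK : S \ F ⊆ K := fun x hx => (hSF x hx).1
  have hindA : G.IsIndepSet ((S \ F ∪ P ∪ A : Finset V) : Set V) := by
    refine isIndepSet_union hind (isIndepSet_mono hZ.indep hAZ) fun x hx a ha hxa => ?_
    rcases Finset.mem_union.1 hx with hxS | hxP
    · exact hZ.not_adj_of_nbrs_eq (hSFK.trans Finset.subset_union_left) (hAZ ha) (hAnbrs a ha)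
        (fun x hx => (hSF x hx).2) x hxS hxa.symm
    · exact hAW a ha x (hPW hxP) hxa
  obtain ⟨A', hA', hreach'⟩ := hZ.exists_reach_of_exchange hSFK (hPW.trans (hWU.trans hUM))
    (hSU.mono Finset.sdiff_subset (hPW.trans hWU)) (hreach.card_eq.trans_le hSZ) hAZ
    (by omega) hindA
  exact ⟨A', hA', hreach.trans hreach'⟩

end Room

/-! ### Reconfiguration sequences in the retained set -/

section Restriction

variable {V : Type*} {G : SimpleGraph V} {r : ℕ}

theorem card_filter_adj_lt [DecidableRel G.Adj]
    (hG : ¬ IsMinor (completeBipartiteGraph (Fin 3) (Fin r)) G)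
    {U : Finset V} {x y v : V} (hxy : x ≠ y) (hvx : v ≠ x) (hvy : v ≠ y)
    (hUx : ∀ u ∈ U, G.Adj u x) (hUy : ∀ u ∈ U, G.Adj u y) :
    (U.filter (G.Adj v)).card < r := by
  classical
  refine card_lt_of_common_nbrs hG (T := {v, x, y})
    (Finset.card_eq_three.2 ⟨v, x, y, hvx, hvy, hxy, rfl⟩).ge fun u hu t ht => ?_
  obtain ⟨huU, hvu⟩ := Finset.mem_filter.1 hu
  simp only [Finset.mem_insert, Finset.mem_singleton] at ht
  rcases ht with rfl | rfl | rfl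
  exacts [hvu.symm, hUx u huU, hUy u huU]

theorem card_le_card_filter_not_adj_add [DecidableEq V] [DecidableRel G.Adj] (U : Finset V)
    (v : V) : U.card ≤
      (U.filter fun u => u ≠ v ∧ ¬ G.Adj v u).card + (U.filter (G.Adj v)).card + 1 := by
  have hcover : U ⊆ insert v (U.filter (fun u => u ≠ v ∧ ¬ G.Adj v u) ∪ U.filter (G.Adj v)) := by
    intro u hu
    simp only [Finset.mem_insert, Finset.mem_union, Finset.mem_filter, hu, true_and]
    tauto
  exact (Finset.card_le_card hcover).trans ((Finset.card_insert_le _ _).trans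
    (Nat.succ_le_succ (Finset.card_union_le _ _)))

variable [DecidableEq V] [DecidableRel G.Adj] {M K Z : Finset V}

theorem Reservoir.exists_reach_of_two_outside (hZ : Reservoir G M K Z)
    (hdeg : ∀ A : Finset V, degSum G A ≤ 8 * r * A.card) (hZcard : classConst r ≤ Z.card)
    {T U : Finset V} {w z : V} (hTK : T ⊆ K) (hwM : w ∈ M) (hzM : z ∈ M)
    (hind : G.IsIndepSet ((insert z (insert w T) : Finset V) : Set V))
    (hcard : (insert z (insert w T)).card ≤ Z.card) (hUM : U ⊆ M) (hUK : ∀ u ∈ U, u ∉ K)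
    (hUw : ∀ u ∈ U, u ≠ w ∧ ¬ G.Adj w u) (hUT : ∀ u ∈ U, ∀ t ∈ T, ¬ G.Adj u t)
    (hUcard : 297 * r + 5 ≤ U.card) (hfew : (U.filter (G.Adj z)).card < r) :
    ∃ A ⊆ Z, Reach G M (insert z (insert w T)) A := by
  have hle := card_le_card_filter_not_adj_add (G := G) U z
  have hsub : U.filter (fun u => u ≠ z ∧ ¬ G.Adj z u) ⊆ U := Finset.filter_subset _ _
  have hne : ∀ u ∈ U.filter (fun u => u ≠ z ∧ ¬ G.Adj z u), u ≠ z :=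
    fun u hu => (Finset.mem_filter.1 hu).2.1
  have houtside : insert z (insert w T) \ K ⊆ {z, w} := by grind
  refine hZ.exists_reach_of_room hdeg hZcard
    (Finset.insert_subset hzM (Finset.insert_subset hwM (hTK.trans hZ.core_subset))) hind hcard
    ((Finset.card_le_card houtside).trans Finset.card_le_two) (Finset.mem_insert_self z _)
    (hsub.trans hUM) (by omega) (Finset.disjoint_right.2 fun u hu huT => ?_)
    fun u hu t ht hut => ?_
  · rcases Finset.mem_insert.1 huT with huz | huT
    · exact hne u hu huz
    · rcases Finset.mem_insert.1 huT with huw | huT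
      exacts [(hUw u (hsub hu)).1 huw, hUK u (hsub hu) (hTK huT)]
  · rcases Finset.mem_insert.1 ht with rfl | ht
    · rfl
    · rcases Finset.mem_insert.1 ht with rfl | ht
      exacts [absurd hut.symm (hUw u (hsub hu)).2, absurd hut (hUT u (hsub hu) t ht)]

theorem Reservoir.exists_reach_of_two_tokens (hZ : Reservoir G M K Z)
    (hdeg : ∀ A : Finset V, degSum G A ≤ 8 * r * A.card) (hZcard : classConst r ≤ Z.card)
    {S U : Finset V} (hSK : S ⊆ K) (hS : G.IsIndepSet (S : Set V)) (hSZ : S.card ≤ Z.card)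
    {s h w : V} (hs : s ∈ S) (hh : h ∈ S.erase s) (hwM : w ∈ M) (hwK : w ∉ K)
    (hw : ∀ t ∈ S.erase s, ¬ G.Adj w t) (hUM : U ⊆ M) (hUK : ∀ u ∈ U, u ∉ K)
    (hUcard : classConst r ≤ U.card) (hfree : ∀ u ∈ U, ∀ t ∈ (S.erase s).erase h, ¬ G.Adj u t)
    (hfew : ∀ v, v ∉ K → (U.filter (G.Adj v)).card < r) : ∃ A ⊆ Z, Reach G M S A := by
  unfold classConst at hUcard
  have hSM := hSK.trans hZ.core_subset
  have herase : (insert w (S.erase s)).erase h = insert w ((S.erase s).erase h) :=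
    Finset.erase_insert_of_ne fun hwh : w = h => hwK (hwh ▸ hSK (Finset.mem_of_mem_erase hh))
  obtain ⟨hreach, hind⟩ := reach_insert_erase hSM hS hs hwM (fun hwS => hwK (hSK hwS)) hw
  have hle := card_le_card_filter_not_adj_add (G := G) U w
  have hw_few := hfew w hwK
  have hsub : U.filter (fun u => u ≠ w ∧ ¬ G.Adj w u) ⊆ U := Finset.filter_subset _ _
  obtain ⟨z, hz⟩ : (U.filter fun u => u ≠ w ∧ ¬ G.Adj w u).Nonempty :=
    Finset.card_pos.1 (by omega)
  obtain ⟨hzU, hzw, hwz⟩ := Finset.mem_filter.1 hz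
  obtain ⟨hreach', hind'⟩ := reach_insert_erase (Finset.insert_subset hwM
      ((Finset.erase_subset _ _).trans hSM)) hind (Finset.mem_insert_of_mem hh) (hUM hzU)
    (by simpa [hzw] using fun _ hzS => hUK z hzU (hSK hzS)) (by
      rw [herase, Finset.forall_mem_insert]
      exact ⟨fun hzw => hwz hzw.symm, hfree z hzU⟩)
  rw [herase] at hreach' hind'
  obtain ⟨A, hAZ, hreach''⟩ := hZ.exists_reach_of_two_outside hdeg hZcard
    (fun t ht => hSK (Finset.mem_of_mem_erase (Finset.mem_of_mem_erase ht))) hwM (hUM hzU) hind'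
    ((hreach.trans hreach').card_eq.trans_le hSZ) (hsub.trans hUM) (fun u hu => hUK u (hsub hu))
    (fun u hu => (Finset.mem_filter.1 hu).2) (fun u hu => hfree u (hsub hu)) (by omega)
    ((Finset.card_le_card (Finset.filter_subset_filter _ hsub)).trans_lt (hfew z (hUK z hzU)))
  exact ⟨A, hAZ, (hreach.trans hreach').trans hreach''⟩

variable [Fintype V]

theorem mem_nbrClass_iff {u z : V} :
    u ∈ nbrClass G K z ↔ u ∉ K ∧ ∀ t ∈ K, (G.Adj u t ↔ G.Adj z t) := by
  simp [nbrClass, Finset.filter_inj']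

/-- The set `M` retained by the kernel: it contains the closure `K` of `X`, a large reservoir `Z`,
and sufficiently many vertices of every class of vertices outside `K`. -/
structure IsRetained (G : SimpleGraph V) [DecidableRel G.Adj] (r : ℕ) (X K Z M : Finset V) :
    Prop where
  reservoir : Reservoir G M K Z
  le_card_reservoir : classConst r ≤ Z.card
  subset_core : X ⊆ K
  supported : ∀ w, w ∉ K → Supported G X (classConst r) K w
  le_card_class : ∀ z, z ∉ K → classConst r ≤ (nbrClass G K z).card →
    classConst r ≤ (nbrClass G K z ∩ M).card
  class_nonempty : ∀ z, z ∉ K → (nbrClass G K z ∩ M).Nonempty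

variable {X : Finset V}

theorem IsRetained.exists_reach_of_not_adj (hM : IsRetained G r X K Z M)
    (hdeg : ∀ A : Finset V, degSum G A ≤ 8 * r * A.card) {S : Finset V} (hSK : S ⊆ K)
    (hS : G.IsIndepSet (S : Set V)) (hSZ : S.card ≤ Z.card) {s z : V} (hs : s ∈ S) (hz : z ∉ K)
    (hlarge : classConst r ≤ (nbrClass G K z).card) (hfree : ∀ t ∈ S.erase s, ¬ G.Adj z t) :
    ∃ A ⊆ Z, Reach G M S A := by
  have hclass := fun u (hu : u ∈ nbrClass G K z ∩ M) =>
    mem_nbrClass_iff.1 (Finset.mem_inter.1 hu).1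
  have hcard := hM.le_card_class z hz hlarge
  unfold classConst at hcard
  refine hM.reservoir.exists_reach_of_room hdeg hM.le_card_reservoir
    (hSK.trans hM.reservoir.core_subset) hS hSZ ?_ hs Finset.inter_subset_right
    (by omega : _ ≤ (nbrClass G K z ∩ M).card)
    (Finset.disjoint_right.2 fun u hu huS => (hclass u hu).1 (hSK huS)) fun u hu t ht hut => ?_
  · rw [Finset.sdiff_eq_empty_iff_subset.2 hSK]
    exact Nat.zero_le _
  · by_contra hts
    exact hfree t (Finset.mem_erase.2 ⟨hts, ht⟩) (((hclass u hu).2 t (hSK ht)).1 hut)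

-- The vertex `w` is supported through some `x ∈ X` by a large class `U`. Apart from `s`, at most
-- one token `h` is adjacent to `U`, as otherwise `U`, `x` and two tokens would form a `K_{3,r}`.
theorem IsRetained.exists_reach_of_exit (hM : IsRetained G r X K Z M) (hr : 0 < r)
    (hG : ¬ IsMinor (completeBipartiteGraph (Fin 3) (Fin r)) G) {S : Finset V} (hSK : S ⊆ K)
    (hS : G.IsIndepSet (S : Set V)) (hSZ : S.card ≤ Z.card) {s w : V} (hs : s ∈ S) (hw : w ∉ K)
    (hSw : G.IsIndepSet ((insert w (S.erase s) : Finset V) : Set V)) :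
    ∃ A ⊆ Z, Reach G M S A := by
  obtain ⟨x, hx, hxw, z, hz, hxz, hzlarge⟩ := hM.supported w hw
  have hdeg := degSum_le_of_not_isMinor hr hG
  by_cases hfree : ∀ t ∈ S.erase s, ¬ G.Adj z t
  · exact hM.exists_reach_of_not_adj hdeg hSK hS hSZ hs hz hzlarge hfree
  push Not at hfree
  obtain ⟨h, hh, hzh⟩ := hfree
  have hUlarge := hM.le_card_class z hz hzlarge
  have hUclass := fun u (hu : u ∈ nbrClass G K z ∩ M) =>
    mem_nbrClass_iff.1 (Finset.mem_inter.1 hu).1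
  have hw_adj : ∀ t ∈ S.erase s, ¬ G.Adj w t := fun t ht =>
    isIndepSet_iff_forall_not_adj.1 hSw w (Finset.mem_insert_self _ _) t
      (Finset.mem_insert_of_mem ht)
  have hxS : x ∉ S.erase s := fun hxS => hw_adj x hxS hxw.symm
  have hhK : h ∈ K := hSK (Finset.mem_of_mem_erase hh)
  have hfew : ∀ v, v ≠ x → v ≠ h → ((nbrClass G K z ∩ M).filter (G.Adj v)).card < r :=
    fun v hvx hvh => card_filter_adj_lt hG (fun hxh : x = h => hxS (hxh ▸ hh)) hvx hvh
      (fun u hu => ((hUclass u hu).2 x (hM.subset_core hx)).2 hxz.symm)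
      (fun u hu => ((hUclass u hu).2 h hhK).2 hzh)
  obtain ⟨w', hw'⟩ := hM.class_nonempty w hw
  obtain ⟨hw'class, hw'M⟩ := Finset.mem_inter.1 hw'
  obtain ⟨hw'K, hw'adj⟩ := mem_nbrClass_iff.1 hw'class
  refine hM.reservoir.exists_reach_of_two_tokens hdeg hM.le_card_reservoir hSK hS hSZ hs hh hw'M
    hw'K (fun t ht hadj => hw_adj t ht ((hw'adj t (hSK (Finset.mem_of_mem_erase ht))).1 hadj))
    Finset.inter_subset_right (fun u hu => (hUclass u hu).1) hUlarge (fun u hu t ht hut => ?_)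
    fun v hv => hfew v (fun hvx => hv (hvx ▸ hM.subset_core hx)) fun hvh => hv (hvh ▸ hhK)
  obtain ⟨hth, htS⟩ := Finset.mem_erase.1 ht
  have htK := hSK (Finset.mem_of_mem_erase htS)
  have hlt := hfew t (fun htx => hxS (htx ▸ htS)) hth
  rw [Finset.filter_true_of_mem fun v hv =>
    (((hUclass v hv).2 t htK).2 (((hUclass u hu).2 t htK).1 hut)).symm] at hlt
  unfold classConst at hUlarge
  omega

theorem IsRetained.reach_or_exists_reach (hM : IsRetained G r X K Z M) (hr : 0 < r)
    (hG : ¬ IsMinor (completeBipartiteGraph (Fin 3) (Fin r)) G) {S T : Finset V} (hSK : S ⊆ K)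
    (hSZ : S.card ≤ Z.card) (h : Reach G Finset.univ S T) :
    Reach G M S T ∨ ∃ A ⊆ Z, Reach G M S A := by
  have hKM := hM.reservoir.core_subset
  by_cases hK : Reach G K S T
  · exact Or.inl (hK.mono hKM)
  obtain ⟨S₁, hS₁K, hreach, hS₁, s, hs, w, hw, hind⟩ := h.exists_exit hSK hK
  obtain ⟨A, hA, hreach'⟩ :=
    hM.exists_reach_of_exit hr hG hS₁K hS₁ (hreach.card_eq.trans_le hSZ) hs hw hind
  exact Or.inr ⟨A, hA, (hreach.mono hKM).trans hreach'⟩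

theorem IsRetained.reach (hM : IsRetained G r X K Z M) (hr : 0 < r)
    (hG : ¬ IsMinor (completeBipartiteGraph (Fin 3) (Fin r)) G) {S T : Finset V} (hSK : S ⊆ K)
    (hTK : T ⊆ K) (hSZ : S.card ≤ Z.card) (h : Reach G Finset.univ S T) : Reach G M S T := by
  rcases hM.reach_or_exists_reach hr hG hSK hSZ h with hST | ⟨A, hA, hSA⟩
  · exact hST
  rcases hM.reach_or_exists_reach hr hG hTK (h.card_eq.trans_le hSZ) h.symm with hTS | ⟨B, hB, hTB⟩
  · exact hTS.symm
  have hAB : Reach G M A B := reach_of_subset hM.reservoir.indep hM.reservoir.subset hA hB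
    (by rw [hSA.card_eq, hTB.card_eq, h.card_eq])
  exact (hSA.trans hAB).trans hTB.symm

end Restriction

/-! ### The vertex set of the kernel -/

section FirstElements

variable {α : Type*} [LinearOrder α]

/-- The `m` smallest elements of `S`, or all of `S` if there are fewer. -/
def firstOf (S : Finset α) (m : ℕ) : Finset α := S.filter fun v => (S.filter (· < v)).card < m

variable {S : Finset α} {m : ℕ}

theorem firstOf_subset (S : Finset α) (m : ℕ) : firstOf S m ⊆ S := Finset.filter_subset _ _

theorem strictMonoOn_card_filter_lt (S : Finset α) :
    StrictMonoOn (fun v => (S.filter (· < v)).card) (S : Set α) := fun u hu _ _ huv =>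
  Finset.card_lt_card <| (Finset.ssubset_iff_of_subset
    (Finset.monotone_filter_right _ fun _ _ hxu => hxu.trans huv)).2
    ⟨u, Finset.mem_filter.2 ⟨hu, huv⟩, fun huu => lt_irrefl u (Finset.mem_filter.1 huu).2⟩

theorem card_filter_lt_lt_card {v : α} (hv : v ∈ S) : (S.filter (· < v)).card < S.card :=
  Finset.card_lt_card (Finset.filter_ssubset.2 ⟨v, hv, lt_irrefl v⟩)

theorem card_firstOf_le (S : Finset α) (m : ℕ) : (firstOf S m).card ≤ m := by
  simpa using Finset.card_le_card_of_injOn (s := firstOf S m) (t := Finset.range m)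
    (fun v => (S.filter (· < v)).card)
    (fun v hv => Finset.mem_coe.2 (Finset.mem_range.2 (Finset.mem_filter.1 hv).2))
    ((strictMonoOn_card_filter_lt S).injOn.mono (Finset.coe_subset.2 (firstOf_subset S m)))

theorem le_card_firstOf (h : m ≤ S.card) : m ≤ (firstOf S m).card := by
  have hrest : (S \ firstOf S m).card ≤ (Finset.Ico m S.card).card := by
    refine Finset.card_le_card_of_injOn (fun v => (S.filter (· < v)).card) (fun v hv => ?_)
      ((strictMonoOn_card_filter_lt S).injOn.mono (Finset.coe_subset.2 Finset.sdiff_subset))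
    obtain ⟨hvS, hv⟩ := Finset.mem_sdiff.1 (Finset.mem_coe.1 hv)
    refine Finset.mem_coe.2 (Finset.mem_Ico.2 ⟨?_, card_filter_lt_lt_card hvS⟩)
    by_contra! hlt
    exact hv (Finset.mem_filter.2 ⟨hvS, hlt⟩)
  have hsdiff := Finset.card_sdiff_add_card_eq_card (firstOf_subset S m)
  rw [Nat.card_Ico] at hrest
  omega

theorem firstOf_eq_self (h : S.card ≤ m) : firstOf S m = S :=
  Finset.filter_true_of_mem fun _ hv => (card_filter_lt_lt_card hv).trans_le h

theorem firstOf_nonempty (hm : 0 < m) (hS : S.Nonempty) : (firstOf S m).Nonempty :=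
  ⟨S.min' hS, Finset.mem_filter.2 ⟨S.min'_mem hS, by
    rwa [Finset.filter_false_of_mem fun v hv => not_lt.2 (S.min'_le v hv)]⟩⟩

end FirstElements

section Classes

variable {V : Type*} {G : SimpleGraph V} [DecidableRel G.Adj] {r : ℕ}

theorem two_mul_card_image_nbrs_le [DecidableEq V] {s : ℕ} (hr : 0 < r)
    (hG : ¬ IsMinor (completeBipartiteGraph (Fin s) (Fin r)) G) {K W : Finset V}
    (hd : Disjoint K W) (hW : ∀ z ∈ W, (K.filter (G.Adj z)).card = 2) :
    2 * (W.image fun z => K.filter (G.Adj z)).card ≤ 2 ^ s * r * K.card := by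
  have hpair : ∀ z, ∃ e : Sym2 V, z ∈ W → ¬ e.IsDiag ∧ e.toFinset = K.filter (G.Adj z) := by
    intro z
    by_cases hz : z ∈ W
    · obtain ⟨a, b, hab, hnbrs⟩ := Finset.card_eq_two.1 (hW z hz)
      exact ⟨s(a, b), fun _ => ⟨hab, by rw [hnbrs, Sym2.toFinset_mk_eq]⟩⟩
    · exact ⟨s(z, z), fun hzW => absurd hzW hz⟩
  choose p hp using hpair
  have hmem : ∀ z ∈ W, ∀ a ∈ p z, a ∈ K ∧ G.Adj z a := fun z hz a ha => by
    rwa [← Sym2.mem_toFinset, (hp z hz).2, Finset.mem_filter] at ha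
  have hpairing : IsPairing G K W p := ⟨fun z hz a ha => (hmem z hz a ha).1,
    fun z hz a ha => (hmem z hz a ha).2, fun z hz => (hp z hz).1⟩
  have himage : (W.image fun z => K.filter (G.Adj z)) = (W.image p).image Sym2.toFinset := by
    rw [Finset.image_image]
    exact Finset.image_congr fun z hz => ((hp z hz).2).symm
  refine (Nat.mul_le_mul_left 2 ?_).trans (hpairing.card_image_le hr hG hd)
  rw [himage]
  exact Finset.card_image_le

/-- Bound for the number of classes outside a set, per vertex of that set. -/
def groupConst (r : ℕ) : ℕ := manyNbrsConst 2 r + 4 * r + 2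

theorem card_image_nbrs_le [DecidableEq V] (hr : 0 < r)
    (hG : ¬ IsMinor (completeBipartiteGraph (Fin 3) (Fin r)) G) {K W : Finset V}
    (hd : Disjoint K W) (hK : K.Nonempty) :
    (W.image fun z => K.filter (G.Adj z)).card ≤ groupConst r * K.card := by
  set nbrs : V → Finset V := fun z => K.filter (G.Adj z)
  set W₂ := W.filter fun z => (nbrs z).card = 2
  set W₃ := W.filter fun z => 3 ≤ (nbrs z).card
  have hW₂ : 2 * (W₂.image nbrs).card ≤ 2 ^ 3 * r * K.card :=
    two_mul_card_image_nbrs_le hr hG (hd.mono_right (Finset.filter_subset _ _))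
      fun z hz => (Finset.mem_filter.1 hz).2
  have hW₃ : (W₃.image nbrs).card ≤ manyNbrsConst 2 r * K.card := Finset.card_image_le.trans
    (card_le_of_many_nbrs hr hG (hd.mono_right (Finset.filter_subset _ _))
      fun z (hz : z ∈ W₃) => (Finset.mem_filter.1 hz).2)
  have hcover : W.image nbrs ⊆
      insert ∅ (K.image fun x => {x}) ∪ (W₂.image nbrs ∪ W₃.image nbrs) := by
    simp only [Finset.subset_iff, Finset.forall_mem_image, Finset.mem_union, Finset.mem_insert]
    intro z hz
    have hcases : (nbrs z).card = 0 ∨ (nbrs z).card = 1 ∨ (nbrs z).card = 2 ∨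
      3 ≤ (nbrs z).card := by omega
    rcases hcases with hnone | hone | htwo | hmany
    · exact Or.inl (Or.inl (Finset.card_eq_zero.1 hnone))
    · obtain ⟨x, hx⟩ := Finset.card_eq_one.1 hone
      have hxK : x ∈ K := Finset.filter_subset (G.Adj z) K (hx.ge (Finset.mem_singleton_self x))
      exact Or.inl (Or.inr (Finset.mem_image.2 ⟨x, hxK, hx.symm⟩))
    · exact Or.inr (Or.inl (Finset.mem_image_of_mem _ (Finset.mem_filter.2 ⟨hz, htwo⟩)))
    · exact Or.inr (Or.inr (Finset.mem_image_of_mem _ (Finset.mem_filter.2 ⟨hz, hmany⟩)))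
  have hK := hK.card_pos
  calc (W.image nbrs).card ≤ (K.card + 1) + ((W₂.image nbrs).card + (W₃.image nbrs).card) :=
        (Finset.card_le_card hcover).trans ((Finset.card_union_le _ _).trans (add_le_add
          ((Finset.card_insert_le _ _).trans (Nat.succ_le_succ Finset.card_image_le))
          (Finset.card_union_le _ _)))
    _ ≤ (K.card + K.card) + (4 * r * K.card + manyNbrsConst 2 r * K.card) := by
        gcongr <;> [exact hK; linarith]
    _ = groupConst r * K.card := by unfold groupConst; ring

theorem card_filter_card_fiber_le {α β : Type*} [DecidableEq β] (W : Finset α) (f : α → β)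
    (m : ℕ) : (W.filter fun z => (W.filter fun z' => f z' = f z).card ≤ m).card ≤
      m * (W.image f).card := by
  refine (Finset.card_le_mul_card_image _ m fun b hb => ?_).trans (Nat.mul_le_mul_left m
    (Finset.card_le_card (Finset.image_subset_image (Finset.filter_subset _ _))))
  obtain ⟨z, hz, rfl⟩ := Finset.mem_image.1 hb
  exact (Finset.card_le_card (Finset.filter_subset_filter _ (Finset.filter_subset _ _))).trans
    (Finset.mem_filter.1 hz).2

theorem exists_reservoir [DecidableEq V] (hr : 0 < r)
    (hG : ¬ IsMinor (completeBipartiteGraph (Fin 3) (Fin r)) G) {M K W : Finset V} (hKM : K ⊆ M)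
    (hWM : W ⊆ M) (hd : Disjoint K W) (hK : K.Nonempty) {m : ℕ}
    (h : (8 * r + 1) * (m + 13 * (groupConst r * K.card)) + manyNbrsConst 2 r * K.card ≤ W.card) :
    ∃ Z ⊆ W, Reservoir G M K Z ∧ m ≤ Z.card := by
  have hmany := card_le_of_many_nbrs hr hG (W := W.filter fun z => ¬ (K.filter (G.Adj z)).card ≤ 2)
    (hd.mono_right (Finset.filter_subset _ _))
    fun z hz => Nat.lt_of_not_le (Finset.mem_filter.1 hz).2
  have hfew := Finset.card_filter_add_card_filter_not (s := W)
    fun z => (K.filter (G.Adj z)).card ≤ 2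
  obtain ⟨I, hIW, hI, hIcard⟩ := exists_isIndepSet_subset (q := 8 * r)
    (degSum_le_of_not_isMinor hr hG) (W.filter fun z => (K.filter (G.Adj z)).card ≤ 2)
  have hIle : m + 13 * (groupConst r * K.card) ≤ I.card :=
    Nat.le_of_mul_le_mul_left (by omega : (8 * r + 1) * _ ≤ (8 * r + 1) * I.card)
      (Nat.succ_pos _)
  have hIW' : I ⊆ W := hIW.trans (Finset.filter_subset _ _)
  have hsmall := (card_filter_card_fiber_le I (fun z => K.filter (G.Adj z)) 13).trans
    (Nat.mul_le_mul_left 13 (card_image_nbrs_le hr hG (hd.mono_right hIW') hK))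
  have hgroups := Finset.card_filter_add_card_filter_not (s := I)
    fun z => (I.filter fun z' => K.filter (G.Adj z') = K.filter (G.Adj z)).card ≤ 13
  set Z := I.filter fun z =>
    ¬ (I.filter fun z' => K.filter (G.Adj z') = K.filter (G.Adj z)).card ≤ 13
  have hZI : Z ⊆ I := Finset.filter_subset _ _
  refine ⟨Z, hZI.trans hIW', ⟨hKM, (hZI.trans hIW').trans hWM,
    fun z hz => Finset.disjoint_right.1 hd (hIW' (hZI hz)), isIndepSet_mono hI hZI,
    fun z hz => (Finset.mem_filter.1 (hIW (hZI hz))).2, fun z hz => ?_⟩, by omega⟩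
  refine (Nat.lt_of_not_le (Finset.mem_filter.1 hz).2).trans_le (Finset.card_le_card fun w hw => ?_)
  obtain ⟨hwI, hwz⟩ := Finset.mem_filter.1 hw
  refine Finset.mem_filter.2 ⟨Finset.mem_filter.2 ⟨hwI, ?_⟩, hwz⟩
  rw [hwz]
  exact (Finset.mem_filter.1 hz).2

variable [Fintype V]

variable (G) in
/-- The first `B` vertices of every class of vertices outside `K`. -/
def classReps [LinearOrder V] (B : ℕ) (K : Finset V) : Finset V :=
  Finset.univ.filter fun w => w ∉ K ∧ ((nbrClass G K w).filter (· < w)).card < B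

theorem nbrClass_eq [DecidableEq V] {K : Finset V} {z w : V} (h : w ∈ nbrClass G K z) :
    nbrClass G K w = nbrClass G K z := by
  rw [nbrClass, (Finset.mem_filter.1 h).2.2, nbrClass]

variable [LinearOrder V] {B : ℕ} {K : Finset V}

theorem firstOf_subset_classReps (z : V) : firstOf (nbrClass G K z) B ⊆ classReps G B K := by
  intro w hw
  obtain ⟨hwz, hlt⟩ := Finset.mem_filter.1 hw
  exact Finset.mem_filter.2
    ⟨Finset.mem_univ w, (mem_nbrClass_iff.1 hwz).1, by rwa [nbrClass_eq hwz]⟩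

theorem card_classReps_le (hr : 0 < r) (hG : ¬ IsMinor (completeBipartiteGraph (Fin 3) (Fin r)) G)
    (B : ℕ) (hK : K.Nonempty) : (classReps G B K).card ≤ B * (groupConst r * K.card) := by
  have hd : Disjoint K (classReps G B K) :=
    Finset.disjoint_right.2 fun w hw => (Finset.mem_filter.1 hw).2.1
  refine (Finset.card_le_mul_card_image (f := fun z => K.filter (G.Adj z)) _ B fun c hc => ?_).trans
    (Nat.mul_le_mul_left _ (card_image_nbrs_le hr hG hd hK))
  obtain ⟨z, -, rfl⟩ := Finset.mem_image.1 hc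
  refine (Finset.card_le_card fun w hw => ?_).trans (card_firstOf_le (nbrClass G K z) B)
  obtain ⟨hw, hwz⟩ := Finset.mem_filter.1 hw
  obtain ⟨-, hwK, hlt⟩ := Finset.mem_filter.1 hw
  have hmem : w ∈ nbrClass G K z := Finset.mem_filter.2 ⟨Finset.mem_univ _, hwK, hwz⟩
  exact Finset.mem_filter.2 ⟨hmem, by rwa [nbrClass_eq hmem] at hlt⟩

end Classes

section ClosureOf

theorem iterate_card_fixed {V : Type*} [Fintype V] {f : Finset V → Finset V} (hf : ∀ K, K ⊆ f K)
    (X : Finset V) : f (f^[Fintype.card V] X) = f^[Fintype.card V] X := by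
  have hgrow : ∀ i, i ≤ (f^[i] X).card ∨ f (f^[i] X) = f^[i] X := by
    intro i
    induction i with
    | zero => exact Or.inl (Nat.zero_le _)
    | succ i ih =>
      rw [Function.iterate_succ_apply']
      by_cases hfix : f (f^[i] X) = f^[i] X
      · exact Or.inr (by rw [hfix, hfix])
      · exact Or.inl ((ih.resolve_right hfix).trans_lt
          (Finset.card_lt_card ((hf _).ssubset_of_ne (Ne.symm hfix))))
  rcases hgrow (Fintype.card V) with hcard | hfix
  · have huniv := Finset.eq_univ_of_card _ (hcard.antisymm' (Finset.card_le_univ _))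
    exact (huniv ▸ Finset.subset_univ _ : _ ⊆ f^[Fintype.card V] X).antisymm (hf _)
  · exact hfix

variable {V : Type*} [Fintype V] [DecidableEq V] (G : SimpleGraph V) [DecidableRel G.Adj]
  (X : Finset V) (B : ℕ)

/-- The closure of `X`: unsupported vertices are added until there are none left, for which as many
rounds as there are vertices suffice. -/
noncomputable def closureOf : Finset V := (closureStep G X B)^[Fintype.card V] X

theorem subset_iterate_closureStep (i : ℕ) : X ⊆ (closureStep G X B)^[i] X := by
  induction i with
  | zero => exact subset_rfl
  | succ i ih =>
    rw [Function.iterate_succ_apply']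
    exact ih.trans Finset.subset_union_left

theorem exists_closureRecord_iterate (i : ℕ) :
    ∃ L, ClosureRecord G X B ((closureStep G X B)^[i] X) L := by
  induction i with
  | zero => exact ⟨fun _ => ∅, closureRecord_self G X B _⟩
  | succ i ih =>
    obtain ⟨L, hL⟩ := ih
    rw [Function.iterate_succ_apply']
    exact hL.exists_step (subset_iterate_closureStep G X B i)

variable {G X B}

theorem supported_of_notMem_closureOf {w : V} (hw : w ∉ closureOf G X B) :
    Supported G X B (closureOf G X B) w := by
  classical
  by_contra hunsupported
  have hfix : closureStep G X B (closureOf G X B) = closureOf G X B :=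
    iterate_card_fixed (fun _ => Finset.subset_union_left) X
  rw [← hfix] at hw
  exact hw (Finset.mem_union_right _ (Finset.mem_filter.2 ⟨Finset.mem_univ w, hunsupported⟩))

end ClosureOf

section Kernel

variable {V : Type*} [Fintype V] [LinearOrder V] (G : SimpleGraph V) [DecidableRel G.Adj] (r : ℕ)

/-- The vertices that are neither in `X` nor adjacent to a vertex of `X`. -/
def freeOf (X : Finset V) : Finset V := Finset.univ.filter fun v => v ∉ X ∧ ∀ x ∈ X, ¬ G.Adj x v

/-- The set of which the closure is taken: the tokens of the source `S` and of the target `T`, and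
so many free vertices that they contain an independent set of size `|S|`. -/
def startSet (S T : Finset V) : Finset V :=
  S ∪ T ∪ firstOf (freeOf G (S ∪ T)) ((8 * r + 1) * S.card)

/-- Bound for the size of the closure, per token. -/
def coreConst : ℕ := closureConst r (classConst r) * (8 * r + 3)

/-- The number of further vertices outside the closure that are kept, per token. -/
def extraConst : ℕ :=
  (8 * r + 1) * (classConst r + 13 * (groupConst r * coreConst r)) +
    manyNbrsConst 2 r * coreConst r

/-- The vertices to be kept for `k` tokens if `K` is the closure of the start set. -/
def retainedSet (k : ℕ) (K : Finset V) : Finset V :=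
  K ∪ classReps G (classConst r) K ∪ firstOf Kᶜ (extraConst r * k)

/-- The vertices to be kept: the start set itself if it has many free vertices, and otherwise those
given by its closure `K`. -/
def keepFrom (S T K : Finset V) : Finset V :=
  if (8 * r + 1) * S.card ≤ (freeOf G (S ∪ T)).card then startSet G r S T
  else retainedSet G r S.card K

/-- The vertex set of the kernel of the instance `(G, S, T)`. -/
noncomputable def keepSet (S T : Finset V) : Finset V :=
  keepFrom G r S T (closureOf G (startSet G r S T) (classConst r))

/-- Bound for the number of vertices to be kept, per token. -/
def keepConst : ℕ :=
  coreConst r + classConst r * (groupConst r * coreConst r) + extraConst r + (8 * r + 3)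

variable {G r} {S T K : Finset V}

theorem card_startSet_le (hST : S.card = T.card) :
    (startSet G r S T).card ≤ (8 * r + 3) * S.card :=
  calc (startSet G r S T).card ≤ S.card + T.card + (8 * r + 1) * S.card :=
        (Finset.card_union_le _ _).trans
          (add_le_add (Finset.card_union_le S T) (card_firstOf_le _ _))
    _ = (8 * r + 3) * S.card := by rw [← hST]; ring

theorem reach_startSet (hdeg : ∀ A : Finset V, degSum G A ≤ 8 * r * A.card)
    (hS : G.IsIndepSet (S : Set V)) (hT : G.IsIndepSet (T : Set V)) (hST : S.card = T.card)
    (hfree : (8 * r + 1) * S.card ≤ (freeOf G (S ∪ T)).card) :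
    Reach G (startSet G r S T) S T := by
  obtain ⟨Q, hQsub, hQ, hQcard⟩ :=
    exists_isIndepSet_subset hdeg (firstOf (freeOf G (S ∪ T)) ((8 * r + 1) * S.card))
  obtain ⟨J, hJQ, hJcard⟩ := Finset.exists_subset_card_eq
    (Nat.le_of_mul_le_mul_left ((le_card_firstOf hfree).trans hQcard) (Nat.succ_pos _))
  have hreachJ : ∀ A : Finset V, G.IsIndepSet (A : Set V) → A ⊆ S ∪ T → A.card = S.card →
      Reach G (startSet G r S T) A J := by
    intro A hA hAST hAcard
    have hind := isIndepSet_union hA hQ fun u hu v hv =>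
      (Finset.mem_filter.1 (firstOf_subset _ _ (hQsub hv))).2.2 u (hAST hu)
    exact reach_of_subset hind (Finset.union_subset_union hAST hQsub) Finset.subset_union_left
      (hJQ.trans Finset.subset_union_right) (hAcard.trans hJcard.symm)
  exact (hreachJ S hS Finset.subset_union_left rfl).trans
    (hreachJ T hT Finset.subset_union_right hST.symm).symm

theorem exists_adj_of_notMem_startSet
    (hfree : (freeOf G (S ∪ T)).card ≤ (8 * r + 1) * S.card) {z : V}
    (hz : z ∉ startSet G r S T) : ∃ x ∈ startSet G r S T, G.Adj x z := by
  by_contra! hno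
  rw [startSet, firstOf_eq_self hfree, Finset.mem_union, not_or] at hz
  exact hz.2 (Finset.mem_filter.2 ⟨Finset.mem_univ z, hz.1,
    fun x hx => hno x (Finset.mem_union_left _ hx)⟩)

theorem card_closureOf_startSet_le (hr : 0 < r)
    (hG : ¬ IsMinor (completeBipartiteGraph (Fin 3) (Fin r)) G) (hST : S.card = T.card)
    (hfree : (freeOf G (S ∪ T)).card ≤ (8 * r + 1) * S.card) :
    (closureOf G (startSet G r S T) (classConst r)).card ≤ coreConst r * S.card := by
  obtain ⟨L, hL⟩ :=
    exists_closureRecord_iterate G (startSet G r S T) (classConst r) (Fintype.card V)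
  refine (ClosureRecord.card_le hr hG (fun z _ hz => exists_adj_of_notMem_startSet hfree hz)
    hL).trans ?_
  rw [coreConst, mul_assoc]
  exact Nat.mul_le_mul_left _ (card_startSet_le hST)

theorem subset_retainedSet (k : ℕ) : K ⊆ retainedSet G r k K :=
  Finset.subset_union_left.trans Finset.subset_union_left

theorem card_retainedSet_le (hr : 0 < r)
    (hG : ¬ IsMinor (completeBipartiteGraph (Fin 3) (Fin r)) G) {k : ℕ} (hK : K.Nonempty)
    (hKcard : K.card ≤ coreConst r * k) : (retainedSet G r k K).card ≤ keepConst r * k :=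
  calc (retainedSet G r k K).card
      ≤ K.card + classConst r * (groupConst r * K.card) + extraConst r * k :=
        (Finset.card_union_le _ _).trans (add_le_add ((Finset.card_union_le _ _).trans
          (Nat.add_le_add_left (card_classReps_le hr hG _ hK) _)) (card_firstOf_le _ _))
    _ ≤ coreConst r * k + classConst r * (groupConst r * (coreConst r * k)) + extraConst r * k +
        (8 * r + 3) * k := by
        refine Nat.le_add_right_of_le ?_
        gcongr
    _ = keepConst r * k := by unfold keepConst; ring

theorem exists_isRetained_retainedSet (hr : 0 < r)
    (hG : ¬ IsMinor (completeBipartiteGraph (Fin 3) (Fin r)) G) {k : ℕ} (hk : 0 < k)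
    {X : Finset V} (hXK : X ⊆ K) (hK : K.Nonempty) (hKcard : K.card ≤ coreConst r * k)
    (hsupported : ∀ w, w ∉ K → Supported G X (classConst r) K w)
    (hlarge : extraConst r * k ≤ Kᶜ.card) :
    ∃ Z, k ≤ Z.card ∧ IsRetained G r X K Z (retainedSet G r k K) := by
  have hB : 0 < classConst r := by unfold classConst; omega
  have hd : Disjoint K (firstOf Kᶜ (extraConst r * k)) :=
    Finset.disjoint_right.2 fun x hx => Finset.mem_compl.1 (firstOf_subset _ _ hx)
  have hextra : (8 * r + 1) * (classConst r * k + 13 * (groupConst r * K.card)) +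
      manyNbrsConst 2 r * K.card ≤ (firstOf Kᶜ (extraConst r * k)).card :=
    calc (8 * r + 1) * (classConst r * k + 13 * (groupConst r * K.card)) +
          manyNbrsConst 2 r * K.card
        ≤ (8 * r + 1) * (classConst r * k + 13 * (groupConst r * (coreConst r * k))) +
          manyNbrsConst 2 r * (coreConst r * k) := by gcongr
      _ = extraConst r * k := by unfold extraConst; ring
      _ ≤ (firstOf Kᶜ (extraConst r * k)).card := le_card_firstOf hlarge
  obtain ⟨Z, -, hZ, hZcard⟩ := exists_reservoir (M := retainedSet G r k K) hr hG
    (subset_retainedSet k) Finset.subset_union_right hd hK hextra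
  have hreps : ∀ z, firstOf (nbrClass G K z) (classConst r) ⊆
      nbrClass G K z ∩ retainedSet G r k K := fun z =>
    Finset.subset_inter (firstOf_subset _ _) ((firstOf_subset_classReps z).trans
      (Finset.subset_union_right.trans Finset.subset_union_left))
  refine ⟨Z, (Nat.le_mul_of_pos_left k hB).trans hZcard, hZ,
    (Nat.le_mul_of_pos_right _ hk).trans hZcard, hXK, hsupported, fun z _ hz => ?_, fun z hz => ?_⟩
  · exact (le_card_firstOf hz).trans (Finset.card_le_card (hreps z))
  · exact (firstOf_nonempty hB ⟨z, mem_nbrClass_iff.2 ⟨hz, fun _ _ => Iff.rfl⟩⟩).mono (hreps z)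

theorem reach_retainedSet (hr : 0 < r)
    (hG : ¬ IsMinor (completeBipartiteGraph (Fin 3) (Fin r)) G)
    {X : Finset V} (hXK : X ⊆ K) (hK : K.Nonempty) (hKcard : K.card ≤ coreConst r * S.card)
    (hsupported : ∀ w, w ∉ K → Supported G X (classConst r) K w)
    (hS : 0 < S.card) (hSK : S ⊆ K) (hTK : T ⊆ K) (h : Reach G Finset.univ S T) :
    Reach G (retainedSet G r S.card K) S T := by
  by_cases hfew : Kᶜ.card ≤ extraConst r * S.card
  · have huniv : retainedSet G r S.card K = Finset.univ := by
      rw [retainedSet, firstOf_eq_self hfew, Finset.union_right_comm, Finset.union_compl,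
        Finset.union_eq_left.2 (Finset.subset_univ _)]
    rwa [huniv]
  · obtain ⟨Z, hZ, hM⟩ :=
      exists_isRetained_retainedSet hr hG hS hXK hK hKcard hsupported (Nat.le_of_not_le hfew)
    exact hM.reach hr hG hSK hTK hZ h

theorem keepSet_spec (hr : 0 < r) (hG : ¬ IsMinor (completeBipartiteGraph (Fin 3) (Fin r)) G)
    (hS : G.IsIndepSet (S : Set V)) (hT : G.IsIndepSet (T : Set V)) (hST : S.card = T.card) :
    S ∪ T ⊆ keepSet G r S T ∧ (keepSet G r S T).card ≤ keepConst r * S.card ∧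
      (Reach G (keepSet G r S T) S T ↔ Reach G Finset.univ S T) := by
  have hstart : S ∪ T ⊆ startSet G r S T := Finset.subset_union_left
  by_cases hfree : (8 * r + 1) * S.card ≤ (freeOf G (S ∪ T)).card
  · have hkeep : keepSet G r S T = startSet G r S T := if_pos hfree
    have hreach := reach_startSet (degSum_le_of_not_isMinor hr hG) hS hT hST hfree
    rw [hkeep]
    refine ⟨hstart, (card_startSet_le hST).trans (Nat.mul_le_mul_right _ ?_),
      fun h => h.mono (Finset.subset_univ _), fun _ => hreach⟩
    exact Nat.le_add_left _ _
  · have hkeep : keepSet G r S T = retainedSet G r S.card _ := if_neg hfree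
    have hXK := subset_iterate_closureStep G (startSet G r S T) (classConst r) (Fintype.card V)
    have hSTK := hstart.trans hXK
    have hpos : 0 < S.card := by
      by_contra! hzero
      exact hfree (by simp [Nat.le_zero.1 hzero])
    have hSK := Finset.subset_union_left.trans hSTK
    have hK := (Finset.card_pos.1 hpos).mono hSK
    have hKcard := card_closureOf_startSet_le hr hG hST (Nat.le_of_not_le hfree)
    rw [hkeep]
    exact ⟨hSTK.trans (subset_retainedSet _), card_retainedSet_le hr hG hK hKcard,
      fun h => h.mono (Finset.subset_univ _), reach_retainedSet hr hG hXK hK hKcard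
        (fun w hw => supported_of_notMem_closureOf hw) hpos hSK
        (Finset.subset_union_right.trans hSTK)⟩

end Kernel

/-! ### Restriction of instances -/

section Embedding

variable {V W : Type*} {G : SimpleGraph V} {φ : W ↪ V}

theorem isIndepSet_map_iff {A : Finset W} :
    G.IsIndepSet (A.map φ : Set V) ↔ (G.comap φ).IsIndepSet (A : Set W) := by
  simp [isIndepSet_iff_forall_not_adj]

variable [DecidableEq V]

theorem reach_univ_iff [Fintype V] {A B : Finset V} (hA : G.IsIndepSet (A : Set V)) :
    Reach G Finset.univ A B ↔ Relation.ReflTransGen (Jump G) A B := by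
  refine ⟨fun h => h.lift id fun _ _ h => h.jump, fun h => ?_⟩
  suffices Reach G Finset.univ A B ∧ G.IsIndepSet (B : Set V) from this.1
  induction h with
  | refl => exact ⟨.refl, hA⟩
  | tail _ hjump ih =>
    have ⟨_, _, _, _, _, hB⟩ := hjump
    exact ⟨ih.1.tail ⟨Finset.subset_univ _, Finset.subset_univ _, ih.2, hjump⟩, hB⟩

variable [DecidableEq W]

theorem jumpIn_map_iff [Fintype W] {M : Finset V} (hM : ∀ x, x ∈ M ↔ ∃ u, φ u = x)
    {A : Finset W} {C : Finset V} :
    JumpIn G M (A.map φ) C ↔ ∃ B, B.map φ = C ∧ JumpIn (G.comap φ) Finset.univ A B := by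
  have hmap : ∀ B : Finset W, B.map φ ⊆ M := fun B x hx => by
    obtain ⟨u, -, rfl⟩ := Finset.mem_map.1 hx
    exact (hM _).2 ⟨u, rfl⟩
  have hmove : ∀ v w, insert (φ w) ((A.map φ).erase (φ v)) = (insert w (A.erase v)).map φ :=
    fun v w => by rw [Finset.map_insert, Finset.map_erase]
  constructor
  · rintro ⟨-, htarget, hsource, _, hv, _, hw, rfl, hind⟩
    obtain ⟨v, hvA, rfl⟩ := Finset.mem_map.1 hv
    obtain ⟨w, rfl⟩ := (hM _).1 (htarget (Finset.mem_insert_self _ _))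
    rw [hmove] at hind
    exact ⟨_, (hmove v w).symm, Finset.subset_univ _, Finset.subset_univ _,
      isIndepSet_map_iff.1 hsource, v, hvA, w, fun hwA => hw (Finset.mem_map_of_mem φ hwA), rfl,
      isIndepSet_map_iff.1 hind⟩
  · rintro ⟨_, rfl, -, -, hsource, v, hv, w, hw, rfl, hind⟩
    exact ⟨hmap _, hmap _, isIndepSet_map_iff.2 hsource, φ v, Finset.mem_map_of_mem φ hv, φ w,
      mt (Finset.mem_map' φ).1 hw, (hmove v w).symm, isIndepSet_map_iff.2 hind⟩

theorem reach_map_iff [Fintype W] {M : Finset V} (hM : ∀ x, x ∈ M ↔ ∃ u, φ u = x)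
    {A B : Finset W} :
    Reach G M (A.map φ) (B.map φ) ↔ Reach (G.comap φ) Finset.univ A B := by
  constructor
  · intro h
    suffices ∀ C, Reach G M (A.map φ) C →
        ∃ B, B.map φ = C ∧ Reach (G.comap φ) Finset.univ A B by
      obtain ⟨B', hB', hreach⟩ := this _ h
      rwa [← Finset.map_injective φ hB']
    intro C hC
    induction hC with
    | refl => exact ⟨A, rfl, .refl⟩
    | tail _ hjump ih =>
      obtain ⟨D, rfl, hD⟩ := ih
      obtain ⟨B, rfl, hB⟩ := (jumpIn_map_iff hM).1 hjump
      exact ⟨B, rfl, hD.tail hB⟩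
  · exact fun h => h.lift (Finset.map φ) fun _ B hjump => (jumpIn_map_iff hM).2 ⟨B, rfl, hjump⟩

end Embedding

section Restrict

variable {n : ℕ} (M : Finset (Fin n))

/-- The increasing enumeration of `M`, by which the vertices of a kernel are named. -/
def nameOf : Fin M.card ↪ Fin n := (M.orderEmbOfFin rfl).toEmbedding

theorem mem_iff_exists_nameOf (x : Fin n) : x ∈ M ↔ ∃ u, nameOf M u = x :=
  Set.ext_iff.1 (M.range_orderEmbOfFin rfl).symm x

theorem nameOf_mem (u : Fin M.card) : nameOf M u ∈ M := M.orderEmbOfFin_mem rfl u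

theorem card_filter_le_nameOf (i : Fin M.card) : (M.filter (· ≤ nameOf M i)).card = i + 1 := by
  have hmap : M.filter (· ≤ nameOf M i) = (Finset.Iic i).map (nameOf M) := by
    ext x
    simp only [Finset.mem_filter, mem_iff_exists_nameOf, Finset.mem_map, Finset.mem_Iic]
    constructor
    · rintro ⟨⟨u, rfl⟩, hu⟩
      exact ⟨u, (M.orderEmbOfFin rfl).le_iff_le.1 hu, rfl⟩
    · rintro ⟨u, hu, rfl⟩
      exact ⟨⟨u, rfl⟩, (M.orderEmbOfFin rfl).le_iff_le.2 hu⟩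
  rw [hmap, Finset.card_map, Fin.card_Iic]

theorem card_filter_le_le_iff (u : Fin n) (i : Fin M.card) :
    (M.filter (· ≤ u)).card ≤ i ↔ u < nameOf M i := by
  have hi := card_filter_le_nameOf M i
  constructor
  · contrapose!
    intro hle
    have hmono := Finset.card_le_card (Finset.monotone_filter_right M
      (p := (· ≤ nameOf M i)) fun _ _ hx => hx.trans hle)
    omega
  · intro hlt
    have hmono : M.filter (· ≤ u) ⊂ M.filter (· ≤ nameOf M i) :=
      (Finset.ssubset_iff_of_subset
        (Finset.monotone_filter_right M fun _ _ hx => hx.trans hlt.le)).2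
        ⟨_, Finset.mem_filter.2 ⟨nameOf_mem M i, le_rfl⟩,
          fun hmem => hlt.not_ge (Finset.mem_filter.1 hmem).2⟩
    have hcard := Finset.card_lt_card hmono
    omega

theorem card_filter_rank_le (i : Fin M.card) :
    (Finset.univ.filter fun u : Fin n => (M.filter (· ≤ u)).card ≤ i).card = nameOf M i := by
  simp only [card_filter_le_le_iff, Finset.filter_gt_eq_Iio, Fin.card_Iio]

variable {M}

theorem map_filter_nameOf {S : Finset (Fin n)} (hS : S ⊆ M) :
    (Finset.univ.filter fun u => nameOf M u ∈ S).map (nameOf M) = S := by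
  ext x
  simp only [Finset.mem_map, Finset.mem_filter, Finset.mem_univ, true_and]
  constructor
  · rintro ⟨u, hu, rfl⟩
    exact hu
  · intro hx
    obtain ⟨u, rfl⟩ := (mem_iff_exists_nameOf M x).1 (hS hx)
    exact ⟨u, hx, rfl⟩

end Restrict

namespace Instance

variable (I : Instance)

theorem isYes_iff_reach : I.IsYes ↔ Reach I.graph Finset.univ I.source I.target :=
  (reach_univ_iff I.source_indep).symm

variable (M : Finset (Fin I.n))

theorem map_source_restrict (hM : I.source ∪ I.target ⊆ M) :
    (Finset.univ.filter fun u => nameOf M u ∈ I.source).map (nameOf M) = I.source :=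
  map_filter_nameOf (Finset.subset_union_left.trans hM)

theorem map_target_restrict (hM : I.source ∪ I.target ⊆ M) :
    (Finset.univ.filter fun u => nameOf M u ∈ I.target).map (nameOf M) = I.target :=
  map_filter_nameOf (Finset.subset_union_right.trans hM)

variable (hM : I.source ∪ I.target ⊆ M)

/-- The instance induced by `I` on a set of vertices containing the source and the target. -/
def restrict : Instance where
  n := M.card
  graph := I.graph.comap (nameOf M)
  source := Finset.univ.filter fun u => nameOf M u ∈ I.source
  target := Finset.univ.filter fun u => nameOf M u ∈ I.target
  source_indep := by
    rw [← isIndepSet_map_iff, I.map_source_restrict M hM]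
    exact I.source_indep
  target_indep := by
    rw [← isIndepSet_map_iff, I.map_target_restrict M hM]
    exact I.target_indep
  card_eq := by
    rw [← Finset.card_map (nameOf M), I.map_source_restrict M hM, I.card_eq,
      ← Finset.card_map (nameOf M), I.map_target_restrict M hM]

theorem mem_source_restrict (u : Fin M.card) :
    u ∈ (I.restrict M hM).source ↔ nameOf M u ∈ I.source :=
  Finset.mem_filter_univ (p := fun u => nameOf M u ∈ I.source) u

theorem mem_target_restrict (u : Fin M.card) :
    u ∈ (I.restrict M hM).target ↔ nameOf M u ∈ I.target :=
  Finset.mem_filter_univ (p := fun u => nameOf M u ∈ I.target) u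

theorem isSubinstance_restrict : IsSubinstance (I.restrict M hM) I (nameOf M) :=
  ⟨fun _ _ h => h, I.map_source_restrict M hM, I.map_target_restrict M hM⟩

theorem isYes_restrict_iff :
    (I.restrict M hM).IsYes ↔ Reach I.graph M I.source I.target := by
  have hreach := reach_map_iff (G := I.graph) (mem_iff_exists_nameOf M)
    (A := Finset.univ.filter fun u => nameOf M u ∈ I.source)
    (B := Finset.univ.filter fun u => nameOf M u ∈ I.target)
  rw [I.map_source_restrict M hM, I.map_target_restrict M hM] at hreach
  exact (isYes_iff_reach _).trans hreach.symm

end Instance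

/-! ### Running time on the random access machine -/

section Machine

/-- The program `p`, started on `σ`, halts after at most `c` steps with a memory satisfying `Q`. -/
def Runs (p : Prog) (σ : Store) (c : ℕ) (Q : Store → Prop) : Prop :=
  ∃ t σ', Exec p σ t σ' ∧ t ≤ c ∧ Q σ'

/-- The memory after `v` is written to cell `i` of array `a`. -/
def setCell (σ : Store) (a i v : ℕ) : Store :=
  Function.update σ a (Function.update (σ a) i v)

theorem setCell_self (σ : Store) (a i v : ℕ) : setCell σ a i v a i = v := by simp [setCell]

theorem setCell_of_ne_cell (σ : Store) (a v : ℕ) {i j : ℕ} (h : j ≠ i) :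
    setCell σ a i v a j = σ a j := by simp [setCell, h]

theorem setCell_of_ne (σ : Store) (i v : ℕ) {a b : ℕ} (h : b ≠ a) :
    setCell σ a i v b = σ b := by simp [setCell, h]

namespace Runs

variable {p q : Prog} {σ : Store} {c c' : ℕ} {Q R : Store → Prop}

theorem mono (h : Runs p σ c Q) (hc : c ≤ c') (hQ : ∀ σ', Q σ' → R σ') : Runs p σ c' R := by
  obtain ⟨t, σ', hexec, ht, hσ'⟩ := h
  exact ⟨t, σ', hexec, ht.trans hc, hQ _ hσ'⟩

theorem seq (hp : Runs p σ c Q) (hq : ∀ σ', Q σ' → Runs q σ' c' R) :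
    Runs (.seq p q) σ (c + c') R := by
  obtain ⟨s, σ', hexec, hs, hσ'⟩ := hp
  obtain ⟨t, σ'', hexec', ht, hσ''⟩ := hq _ hσ'
  exact ⟨_, _, .seq hexec hexec', Nat.add_le_add hs ht, hσ''⟩

theorem write {a : ℕ} {i e : Expr} (h : Q (setCell σ a (i.eval σ) (e.eval σ)))
    (hc : i.cost + e.cost + 1 ≤ c) : Runs (.write a i e) σ c Q :=
  ⟨_, _, .write a i e σ, hc, h⟩

theorem loop {e : Expr} {Inv : ℕ → Store → Prop} {m : ℕ}
    (hguard : ∀ i σ, i ≤ m → Inv i σ → e.eval σ = m - i)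
    (hbody : ∀ i σ, i < m → Inv i σ → Runs p σ c (Inv (i + 1))) (hinit : Inv 0 σ) :
    Runs (.loop e p) σ ((m + 1) * (c + e.cost + 1)) (Inv m) := by
  suffices hrest : ∀ j i σ, i + j = m → Inv i σ →
      Runs (.loop e p) σ ((j + 1) * (c + e.cost + 1)) (Inv m) from
    hrest m 0 σ (Nat.zero_add m) hinit
  intro j
  induction j with
  | zero =>
    intro i σ hi h
    obtain rfl : i = m := by omega
    exact ⟨_, _, .loop_false (by rw [hguard i σ le_rfl h]; omega), by omega, h⟩
  | succ j ih =>
    intro i σ hi h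
    obtain ⟨s, σ', hexec, hs, hσ'⟩ := hbody i σ (by omega) h
    obtain ⟨t, σ'', hexec', ht, hσ''⟩ := ih (i + 1) σ' (by omega) hσ'
    refine ⟨_, _, .loop_true (by rw [hguard i σ (by omega) h]; omega) hexec hexec', ?_, hσ''⟩
    rw [Nat.succ_mul (j + 1)]
    omega

end Runs

/-- Repeats `p` with cell `0` of array `x` running from `0` up to the value of `N`. -/
def forTo (x : ℕ) (N : Expr) (p : Prog) : Prog :=
  .seq (.write x (.const 0) (.const 0))
    (.loop (.monus N (.read x (.const 0)))
      (.seq p (.write x (.const 0) (.plus (.read x (.const 0)) (.const 1)))))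

theorem Runs.forTo {x : ℕ} {N : Expr} {p : Prog} {Inv : ℕ → Store → Prop} {m c : ℕ} {σ : Store}
    (hN : ∀ i σ, Inv i σ → N.eval σ = m) (hx : ∀ i σ, Inv i σ → σ x 0 = i)
    (hinit : Inv 0 (setCell σ x 0 0))
    (hbody : ∀ i σ, i < m → Inv i σ → Runs p σ c fun σ' =>
      σ' x 0 = i ∧ Inv (i + 1) (setCell σ' x 0 (i + 1))) :
    Runs (forTo x N p) σ ((m + 1) * (c + N.cost + 10) + 3) (Inv m) := by
  have hguard (i : ℕ) (σ : Store) (_ : i ≤ m) (hσ : Inv i σ) :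
      (Expr.monus N (.read x (.const 0))).eval σ = m - i := by
    simp only [Expr.eval]
    rw [hN i σ hσ, hx i σ hσ]
  have hround (i : ℕ) (σ : Store) (hi : i < m) (hσ : Inv i σ) :
      Runs (.seq p (.write x (.const 0) (.plus (.read x (.const 0)) (.const 1)))) σ (c + 6)
        (Inv (i + 1)) := by
    refine (hbody i σ hi hσ).seq fun σ' ⟨hcounter, hinv⟩ => .write ?_ le_rfl
    simp only [Expr.eval]
    rw [hcounter]
    exact hinv
  refine (Runs.seq (.write hinit le_rfl) fun _ => Runs.loop hguard hround).mono ?_ fun _ h => h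
  simp only [Expr.cost]
  have hround_cost : c + 6 + (N.cost + (1 + 1) + 1) + 1 = c + N.cost + 10 := by ring
  rw [hround_cost]
  omega

/-- The array that holds the `j`-th variable. -/
def varArr (j : ℕ) : ℕ := 100 + 2 * j

/-- The array that holds the `j`-th intermediate result. -/
def outArr (j : ℕ) : ℕ := 101 + 2 * j

theorem outArr_ne_varArr (i j : ℕ) : outArr i ≠ varArr j := by unfold outArr varArr; omega

theorem ne_varArr_of_lt {b : ℕ} (hb : b < 100) (j : ℕ) : b ≠ varArr j := by unfold varArr; omega

/-- `σ'` agrees with `σ` on the arrays below `100`, which hold the data of an algorithm, with the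
possible exception of the array `a`. -/
def SameExcept (a : ℕ) (σ σ' : Store) : Prop := ∀ b < 100, b ≠ a → σ' b = σ b

/-- Arithmetic terms with finite sums over the vertices.  The variable bound by a sum is numbered
by the number of sums around it. -/
inductive Term where
  | const (c : ℕ)
  | var (j : ℕ)
  | read (a : ℕ) (t : Term)
  | plus (s t : Term)
  | monus (s t : Term)
  | sum (t : Term)

namespace Term

/-- The value of a term in a memory that describes a graph with `n` vertices, where the first `d`
variables are bound to the values `ρ`. -/
def eval (n : ℕ) (σ : Store) : (ℕ → ℕ) → ℕ → Term → ℕ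
  | _, _, .const c => c
  | ρ, _, .var j => ρ j
  | ρ, d, .read a t => σ a (t.eval n σ ρ d)
  | ρ, d, .plus s t => s.eval n σ ρ d + t.eval n σ ρ d
  | ρ, d, .monus s t => s.eval n σ ρ d - t.eval n σ ρ d
  | ρ, d, .sum t => ∑ i : Fin n, t.eval n σ (Function.update ρ d i) (d + 1)

/-- The variables of the term are bound, and it reads arrays below `100` other than `a` only. -/
def Ok (a : ℕ) : ℕ → Term → Prop
  | _, .const _ => True
  | d, .var j => j < d
  | d, .read b t => b < 100 ∧ b ≠ a ∧ t.Ok a d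
  | d, .plus s t => s.Ok a d ∧ t.Ok a d
  | d, .monus s t => s.Ok a d ∧ t.Ok a d
  | d, .sum t => t.Ok a (d + 1)

theorem eval_congr {n a : ℕ} {σ σ' : Store} (hσ : SameExcept a σ σ') (t : Term) {d : ℕ}
    {ρ ρ' : ℕ → ℕ} (hρ : ∀ j < d, ρ' j = ρ j) (ht : t.Ok a d) :
    t.eval n σ' ρ' d = t.eval n σ ρ d := by
  induction t generalizing d ρ ρ' with
  | const c => rfl
  | var j => exact hρ j ht
  | read b t ih =>
    simp only [eval]
    rw [hσ b ht.1 ht.2.1, ih hρ ht.2.2]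
  | plus s t ihs iht =>
    simp only [eval]
    rw [ihs hρ ht.1, iht hρ ht.2]
  | monus s t ihs iht =>
    simp only [eval]
    rw [ihs hρ ht.1, iht hρ ht.2]
  | sum t ih =>
    refine Finset.sum_congr rfl fun i _ => ih (fun j hj => ?_) ht
    rcases eq_or_ne j d with rfl | hne
    · simp
    · simp [hne, hρ j (by omega)]

/-- A program that evaluates a term with `d` bound variables into the intermediate result `l`. -/
def compile : ℕ → ℕ → Term → Prog
  | _, l, .const c => .write (outArr l) (.const 0) (.const c)
  | _, l, .var j => .write (outArr l) (.const 0) (.read (varArr j) (.const 0))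
  | d, l, .read a t => .seq (t.compile d l)
      (.write (outArr l) (.const 0) (.read a (.read (outArr l) (.const 0))))
  | d, l, .plus s t => .seq (s.compile d l) (.seq (t.compile d (l + 1))
      (.write (outArr l) (.const 0)
        (.plus (.read (outArr l) (.const 0)) (.read (outArr (l + 1)) (.const 0)))))
  | d, l, .monus s t => .seq (s.compile d l) (.seq (t.compile d (l + 1))
      (.write (outArr l) (.const 0)
        (.monus (.read (outArr l) (.const 0)) (.read (outArr (l + 1)) (.const 0)))))
  | d, l, .sum t => .seq (.write (outArr l) (.const 0) (.const 0))
      (forTo (varArr d) (.read 0 (.const 0)) (.seq (t.compile (d + 1) (l + 1))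
        (.write (outArr l) (.const 0)
          (.plus (.read (outArr l) (.const 0)) (.read (outArr (l + 1)) (.const 0))))))

end Term

/-- `σ'` agrees with `σ` on the arrays below `100`, the first `d` variables and the first `l`
intermediate results. -/
structure Frame (d l : ℕ) (σ σ' : Store) : Prop where
  low : ∀ b < 100, σ' b = σ b
  var : ∀ j < d, σ' (varArr j) = σ (varArr j)
  out : ∀ j < l, σ' (outArr j) = σ (outArr j)

namespace Frame

variable {d l : ℕ} {σ σ' σ'' : Store}

theorem refl (d l : ℕ) (σ : Store) : Frame d l σ σ :=
  ⟨fun _ _ => rfl, fun _ _ => rfl, fun _ _ => rfl⟩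

theorem trans (h : Frame d l σ σ') (h' : Frame d l σ' σ'') : Frame d l σ σ'' :=
  ⟨fun b hb => (h'.low b hb).trans (h.low b hb), fun b hb => (h'.var b hb).trans (h.var b hb),
    fun b hb => (h'.out b hb).trans (h.out b hb)⟩

theorem mono {d' l' : ℕ} (h : Frame d l σ σ') (hd : d' ≤ d) (hl : l' ≤ l) : Frame d' l' σ σ' :=
  ⟨h.low, fun j hj => h.var j (by omega), fun j hj => h.out j (by omega)⟩

theorem sameExcept (h : Frame d l σ σ') (a : ℕ) : SameExcept a σ σ' := fun b hb _ => h.low b hb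

theorem setOut (h : Frame d l σ σ') (v : ℕ) : Frame d l σ (setCell σ' (outArr l) 0 v) := by
  refine h.trans ⟨fun b hb => ?_, fun j _ => ?_, fun j hj => ?_⟩ <;> refine setCell_of_ne _ _ _ ?_
  · unfold outArr; omega
  · unfold outArr varArr; omega
  · unfold outArr; omega

theorem setVar (h : Frame d l σ σ') (v : ℕ) : Frame d l σ (setCell σ' (varArr d) 0 v) := by
  refine h.trans ⟨fun b hb => ?_, fun j hj => ?_, fun j _ => ?_⟩ <;> refine setCell_of_ne _ _ _ ?_
  · unfold varArr; omega
  · unfold varArr; omega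
  · unfold outArr varArr; omega

end Frame

open Polynomial

/-- When cell `0` of array `0` holds `n` and the first `d` variables are `ρ`, the program `p` writes
`value n σ ρ` to the intermediate result `l` in time polynomial in `n`, and leaves the data, the
bound variables and the earlier intermediate results alone. -/
def Computes (p : Prog) (d l : ℕ) (value : ℕ → Store → (ℕ → ℕ) → ℕ) : Prop :=
  ∃ P : ℕ[X], ∀ (n : ℕ) (σ : Store) (ρ : ℕ → ℕ), σ 0 0 = n → (∀ j < d, σ (varArr j) 0 = ρ j) →
    Runs p σ (P.eval n) fun σ' => σ' (outArr l) 0 = value n σ ρ ∧ Frame d l σ σ'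

namespace Term

variable {a d l : ℕ} {s t : Term}

theorem computes_const (c d l : ℕ) :
    Computes ((const c).compile d l) d l fun _ _ _ => c :=
  ⟨3, fun _ σ _ _ _ => .write ⟨setCell_self _ _ _ _, (Frame.refl d l σ).setOut _⟩
    (by simp [Expr.cost])⟩

theorem computes_var {j : ℕ} (hj : j < d) (l : ℕ) :
    Computes ((var j).compile d l) d l fun _ _ ρ => ρ j := by
  refine ⟨4, fun n σ ρ _ hρ => .write ⟨?_, (Frame.refl d l σ).setOut _⟩ (by simp [Expr.cost])⟩
  simp only [Expr.eval]
  rw [setCell_self, hρ j hj]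

theorem computes_read {b : ℕ} (hb : b < 100)
    (ht : Computes (t.compile d l) d l fun n σ ρ => t.eval n σ ρ d) :
    Computes ((read b t).compile d l) d l fun n σ ρ => (read b t).eval n σ ρ d := by
  obtain ⟨P, hP⟩ := ht
  refine ⟨P + 5, fun n σ ρ hn hρ => ?_⟩
  refine ((hP n σ ρ hn hρ).seq fun σ₁ ⟨hout, hframe⟩ => .write (c := 5)
    ⟨?_, hframe.setOut _⟩ (by simp [Expr.cost])).mono (by simp) fun _ h => h
  simp only [Expr.eval]
  rw [setCell_self, hout, hframe.low b hb]
  rfl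

theorem computes_binary {op : Expr → Expr → Expr} {f : ℕ → ℕ → ℕ}
    (heval : ∀ x y σ, (op x y).eval σ = f (x.eval σ) (y.eval σ))
    (hcost : ∀ x y, (op x y).cost = x.cost + y.cost + 1) (htOk : t.Ok a d)
    (hs : Computes (s.compile d l) d l fun n σ ρ => s.eval n σ ρ d)
    (ht : Computes (t.compile d (l + 1)) d (l + 1) fun n σ ρ => t.eval n σ ρ d) :
    Computes (.seq (s.compile d l) (.seq (t.compile d (l + 1)) (.write (outArr l) (.const 0)
      (op (.read (outArr l) (.const 0)) (.read (outArr (l + 1)) (.const 0)))))) d l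
      fun n σ ρ => f (s.eval n σ ρ d) (t.eval n σ ρ d) := by
  obtain ⟨P, hP⟩ := hs
  obtain ⟨Q, hQ⟩ := ht
  refine ⟨P + (Q + 7), fun n σ ρ hn hρ => ?_⟩
  refine ((hP n σ ρ hn hρ).seq fun σ₁ ⟨hout₁, hframe₁⟩ => Runs.seq
    (hQ n σ₁ ρ (by rw [hframe₁.low 0 (by norm_num)]; exact hn)
      fun j hj => by rw [hframe₁.var j hj]; exact hρ j hj)
    fun σ₂ ⟨hout₂, hframe₂⟩ => .write (c := 7) ?_ (by simp [hcost, Expr.cost])).mono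
    (by simp) fun _ h => h
  rw [heval]
  simp only [Expr.eval]
  rw [hout₂, hframe₂.out l (by omega), hout₁]
  beta_reduce
  rw [t.eval_congr (hframe₁.sameExcept a) (fun _ _ => rfl) htOk]
  exact ⟨setCell_self _ _ _ _, (hframe₁.trans (hframe₂.mono le_rfl (by omega))).setOut _⟩

/-- The memory `σ'` after `i` rounds of the loop that, started on `σ`, computes `sum t`. -/
structure SumInv (t : Term) (n : ℕ) (σ : Store) (ρ : ℕ → ℕ) (d l i : ℕ) (σ' : Store) : Prop where
  counter : σ' (varArr d) 0 = i
  frame : Frame d l σ σ'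
  partialSum : σ' (outArr l) 0 =
    ∑ j ∈ Finset.range i, t.eval n σ (Function.update ρ d j) (d + 1)

theorem SumInv.step {n i : ℕ} {σ σ₁ σ₂ : Store} {ρ : ℕ → ℕ} (ht : t.Ok a (d + 1))
    (h : SumInv t n σ ρ d l i σ₁) (hframe : Frame (d + 1) (l + 1) σ₁ σ₂)
    (hout : σ₂ (outArr (l + 1)) 0 = t.eval n σ₁ (Function.update ρ d i) (d + 1)) :
    SumInv t n σ ρ d l (i + 1) (setCell (setCell σ₂ (outArr l) 0
      (σ₂ (outArr l) 0 + σ₂ (outArr (l + 1)) 0)) (varArr d) 0 (i + 1)) where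
  counter := setCell_self _ _ _ _
  frame := ((h.frame.trans (hframe.mono (by omega) (by omega))).setOut _).setVar _
  partialSum := by
    rw [setCell_of_ne _ _ _ (outArr_ne_varArr l d), setCell_self, hout, hframe.out l (by omega),
      h.partialSum, Finset.sum_range_succ,
      t.eval_congr (h.frame.sameExcept a) (fun _ _ => rfl) ht]

theorem SumInv.runs_body {n i c : ℕ} {σ σ₁ : Store} {ρ : ℕ → ℕ} (ht : t.Ok a (d + 1))
    (h : SumInv t n σ ρ d l i σ₁) (hrun : Runs (t.compile (d + 1) (l + 1)) σ₁ c fun σ' =>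
      σ' (outArr (l + 1)) 0 = t.eval n σ₁ (Function.update ρ d i) (d + 1) ∧
        Frame (d + 1) (l + 1) σ₁ σ') :
    Runs (.seq (t.compile (d + 1) (l + 1)) (.write (outArr l) (.const 0)
        (.plus (.read (outArr l) (.const 0)) (.read (outArr (l + 1)) (.const 0))))) σ₁ (c + 7)
      fun σ' => σ' (varArr d) 0 = i ∧
        SumInv t n σ ρ d l (i + 1) (setCell σ' (varArr d) 0 (i + 1)) := by
  refine hrun.seq fun σ₂ ⟨hout, hframe⟩ => .write ⟨?_, h.step ht hframe hout⟩
    (by simp [Expr.cost])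
  rw [setCell_of_ne _ _ _ (outArr_ne_varArr l d).symm, hframe.var d (by omega)]
  exact h.counter

theorem computes_sum (htOk : t.Ok a (d + 1))
    (ht : Computes (t.compile (d + 1) (l + 1)) (d + 1) (l + 1) fun n σ ρ => t.eval n σ ρ (d + 1)) :
    Computes ((sum t).compile d l) d l fun n σ ρ => (sum t).eval n σ ρ d := by
  obtain ⟨P, hP⟩ := ht
  refine ⟨3 + ((X + 1) * (P + 7 + 2 + 10) + 3), fun n σ ρ hn hρ => ?_⟩
  have hinit (σ₁ : Store) (h : σ₁ (outArr l) 0 = 0 ∧ Frame d l σ σ₁) :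
      SumInv t n σ ρ d l 0 (setCell σ₁ (varArr d) 0 0) :=
    ⟨setCell_self _ _ _ _, h.2.setVar _,
      by rw [setCell_of_ne _ _ _ (outArr_ne_varArr l d), h.1]; rfl⟩
  have hbound (i : ℕ) (σ₁ : Store) (h : SumInv t n σ ρ d l i σ₁) :
      (Expr.read 0 (.const 0)).eval σ₁ = n := by
    simp only [Expr.eval]
    rw [h.frame.low 0 (by norm_num), hn]
  have hvar (i : ℕ) (σ₁ : Store) (h : SumInv t n σ ρ d l i σ₁) :
      ∀ j < d + 1, σ₁ (varArr j) 0 = Function.update ρ d i j := by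
    intro j hj
    rcases eq_or_ne j d with rfl | hne
    · simp [h.counter]
    · rw [Function.update_of_ne hne, h.frame.var j (by omega), hρ j (by omega)]
  refine (Runs.seq (.write (c := 3) (Q := fun σ₁ => σ₁ (outArr l) 0 = 0 ∧ Frame d l σ σ₁)
    ⟨setCell_self _ _ _ _, (Frame.refl d l σ).setOut _⟩ (by simp [Expr.cost])) fun σ₁ h₁ =>
    Runs.forTo hbound (fun _ _ h => h.counter) (hinit σ₁ h₁) fun i σ₂ _ h₂ =>
      h₂.runs_body htOk (hP n σ₂ _ (hbound i σ₂ h₂) (hvar i σ₂ h₂))).mono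
    (by simp [Expr.cost]) fun σ' h => ⟨?_, h.frame⟩
  rw [h.partialSum, Finset.sum_range]
  rfl

theorem computes_compile (ht : t.Ok a d) (l : ℕ) :
    Computes (t.compile d l) d l fun n σ ρ => t.eval n σ ρ d := by
  induction t generalizing d l with
  | const c => exact computes_const c d l
  | var j => exact computes_var ht l
  | read b t ih => exact computes_read ht.1 (ih ht.2.2 l)
  | plus s t ihs iht =>
    exact computes_binary (fun _ _ _ => rfl) (fun _ _ => rfl) ht.2 (ihs ht.1 l) (iht ht.2 (l + 1))
  | monus s t ihs iht =>
    exact computes_binary (fun _ _ _ => rfl) (fun _ _ => rfl) ht.2 (ihs ht.1 l) (iht ht.2 (l + 1))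
  | sum t ih => exact computes_sum ht (ih ht (l + 1))

end Term

/-- Writes the value of a closed term to cell `0` of array `a`. -/
def assign (a : ℕ) (t : Term) : Prog :=
  .seq (t.compile 0 0) (.write a (.const 0) (.read (outArr 0) (.const 0)))

/-- Writes the values of a term with one variable to the first cells of array `a`. -/
def fill (a : ℕ) (t : Term) : Prog :=
  forTo (varArr 0) (.read 0 (.const 0)) (.seq (t.compile 1 0)
    (.write a (.read (varArr 0) (.const 0)) (.read (outArr 0) (.const 0))))

theorem runs_assign {a : ℕ} (t : Term) (ht : t.Ok a 0) :
    ∃ P : ℕ[X], ∀ (n : ℕ) (σ : Store), σ 0 0 = n → Runs (assign a t) σ (P.eval n) fun σ' =>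
      SameExcept a σ σ' ∧ σ' a 0 = t.eval n σ (fun _ => 0) 0 := by
  obtain ⟨P, hP⟩ := Term.computes_compile ht 0
  refine ⟨P + 4, fun n σ hn => ?_⟩
  refine ((hP n σ (fun _ => 0) hn fun j hj => absurd hj (by omega)).seq fun σ₁ ⟨hout, hframe⟩ =>
    .write (c := 4) ⟨fun b hb hba => ?_, ?_⟩ (by simp [Expr.cost])).mono (by simp) fun _ h => h
  · rw [setCell_of_ne _ _ _ hba, hframe.low b hb]
  · simp only [Expr.eval]
    rw [setCell_self, hout]

/-- The memory `σ'` after `i` rounds of `fill a t` started on `σ`. -/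
structure FillInv (a : ℕ) (t : Term) (n : ℕ) (σ : Store) (i : ℕ) (σ' : Store) : Prop where
  counter : σ' (varArr 0) 0 = i
  same : SameExcept a σ σ'
  cells : ∀ w < i, σ' a w = t.eval n σ (fun _ => w) 1

theorem FillInv.step {a n i : ℕ} {t : Term} {σ σ₁ σ₂ : Store} (ha : a < 100) (ht : t.Ok a 1)
    (h : FillInv a t n σ i σ₁) (hframe : Frame 1 0 σ₁ σ₂)
    (hout : σ₂ (outArr 0) 0 = t.eval n σ₁ (fun _ => i) 1) :
    FillInv a t n σ (i + 1)
      (setCell (setCell σ₂ a i (σ₂ (outArr 0) 0)) (varArr 0) 0 (i + 1)) where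
  counter := setCell_self _ _ _ _
  same b hb hba := by
    rw [setCell_of_ne _ _ _ (ne_varArr_of_lt hb 0), setCell_of_ne _ _ _ hba, hframe.low b hb,
      h.same b hb hba]
  cells w hw := by
    rw [setCell_of_ne _ _ _ (ne_varArr_of_lt ha 0)]
    rcases eq_or_ne w i with rfl | hne
    · rw [setCell_self, hout]
      exact t.eval_congr h.same (fun _ _ => rfl) ht
    · rw [setCell_of_ne_cell _ _ _ hne, hframe.low a ha, h.cells w (by omega)]

theorem runs_fill {a : ℕ} (ha : a ≠ 0) (ha' : a < 100) (t : Term) (ht : t.Ok a 1) :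
    ∃ P : ℕ[X], ∀ (n : ℕ) (σ : Store), σ 0 0 = n → Runs (fill a t) σ (P.eval n) fun σ' =>
      SameExcept a σ σ' ∧ ∀ w : Fin n, σ' a w = t.eval n σ (fun _ => w) 1 := by
  obtain ⟨P, hP⟩ := Term.computes_compile ht 0
  refine ⟨(X + 1) * (P + 5 + 2 + 10) + 3, fun n σ hn => ?_⟩
  have hinit : FillInv a t n σ 0 (setCell σ (varArr 0) 0 0) :=
    ⟨setCell_self _ _ _ _, fun b hb _ => setCell_of_ne _ _ _ (ne_varArr_of_lt hb 0),
      fun w hw => absurd hw w.not_lt_zero⟩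
  have hbound (i : ℕ) (σ₁ : Store) (h : FillInv a t n σ i σ₁) :
      (Expr.read 0 (.const 0)).eval σ₁ = n := by
    simp only [Expr.eval]
    rw [h.same 0 (by norm_num) ha.symm, hn]
  refine (Runs.forTo (c := P.eval n + 5) hbound (fun _ _ h => h.counter) hinit
    fun i σ₁ _ h₁ => ?_).mono (by simp [Expr.cost]) fun σ' h => ⟨h.same, fun w => h.cells w w.2⟩
  have hvar : ∀ j < 1, σ₁ (varArr j) 0 = i := fun j hj => by
    rw [Nat.lt_one_iff.1 hj]
    exact h₁.counter
  refine (hP n σ₁ (fun _ => i) (hbound i σ₁ h₁) hvar).seq fun σ₂ ⟨hout, hframe⟩ =>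
    .write ?_ (by simp [Expr.cost])
  have hcounter : σ₂ (varArr 0) 0 = i := by rw [hframe.var 0 one_pos, h₁.counter]
  simp only [Expr.eval]
  rw [hcounter]
  exact ⟨by rw [setCell_of_ne _ _ _ (ne_varArr_of_lt ha' 0).symm, hcounter],
    h₁.step ha' ht hframe hout⟩

end Machine

/-! ### The kernel as arithmetic terms -/

section Program

open Classical in
/-- The truth value of `P` as a number. -/
noncomputable def bit (P : Prop) : ℕ := if P then 1 else 0

theorem bit_congr {P Q : Prop} (h : P ↔ Q) : bit P = bit Q := by rw [propext h]

theorem bit_eq_ite {P Q : Prop} [Decidable Q] (h : P ↔ Q) : bit P = if Q then 1 else 0 := by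
  by_cases hQ : Q <;> simp [bit, h, hQ]

theorem bit_of_true {P : Prop} (h : P) : bit P = 1 := if_pos h

theorem bit_of_false {P : Prop} (h : ¬ P) : bit P = 0 := if_neg h

theorem bit_eq_zero (P : Prop) : bit P = 0 ↔ ¬ P := by
  by_cases hP : P <;> simp [bit, hP]

theorem bit_and (P Q : Prop) : bit P + bit Q - 1 = bit (P ∧ Q) := by
  by_cases hP : P <;> by_cases hQ : Q <;> simp [bit, hP, hQ]

theorem bit_add_pos (P Q : Prop) : 0 < bit P + bit Q ↔ P ∨ Q := by
  by_cases hP : P <;> by_cases hQ : Q <;> simp [bit, hP, hQ]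

theorem bit_not_iff (P Q : Prop) : bit P - bit Q + (bit Q - bit P) = bit (¬ (P ↔ Q)) := by
  by_cases hP : P <;> by_cases hQ : Q <;> simp [bit, hP, hQ]

theorem sum_bit {α : Type*} [Fintype α] {p : α → Prop} {S : Finset α} (h : ∀ i, p i ↔ i ∈ S) :
    ∑ i, bit (p i) = S.card := by
  classical
  rw [show S = Finset.univ.filter p by ext i; simp [h], Finset.card_filter]
  exact Finset.sum_congr rfl fun i _ => bit_eq_ite Iff.rfl

theorem sum_bit_eq_zero {α : Type*} [Fintype α] (p : α → Prop) :
    ∑ i, bit (p i) = 0 ↔ ∀ i, ¬ p i := by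
  simp [bit_eq_zero]

theorem sum_bit_pos {α : Type*} [Fintype α] (p : α → Prop) : 0 < ∑ i, bit (p i) ↔ ∃ i, p i := by
  rw [Nat.pos_iff_ne_zero, Ne, sum_bit_eq_zero, not_forall_not]

namespace Term

/-- Negation of a truth value. -/
def not (t : Term) : Term := .monus (.const 1) t

/-- Conjunction of truth values. -/
def and (s t : Term) : Term := .monus (.plus s t) (.const 1)

/-- Disjunction of truth values. -/
def or (s t : Term) : Term := .not (.not (.plus s t))

/-- Whether two truth values differ. -/
def ne (s t : Term) : Term := .plus (.monus s t) (.monus t s)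

/-- The truth value of `s ≤ t`. -/
def le (s t : Term) : Term := .not (.monus s t)

/-- The truth value of `s < t`. -/
def lt (s t : Term) : Term := .le (.plus s (.const 1)) t

/-- Existential quantification over the vertices. -/
def any (t : Term) : Term := .not (.not (.sum t))

/-- Multiplication by a constant. -/
def scale : ℕ → Term → Term
  | 0, _ => .const 0
  | c + 1, t => .plus (scale c t) t

/-- The entry of the adjacency matrix, where array `9` holds the offsets of the rows. -/
def adj (s t : Term) : Term := .read 1 (.plus (.read 9 s) t)

variable (n : ℕ) (σ : Store) (ρ : ℕ → ℕ) (d : ℕ)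

theorem eval_not (t : Term) : t.not.eval n σ ρ d = bit (t.eval n σ ρ d = 0) := by
  simp only [Term.not, Term.eval]
  by_cases h : t.eval n σ ρ d = 0
  · rw [bit_of_true h, h]
  · rw [bit_of_false h]
    omega

theorem eval_not_not (t : Term) : t.not.not.eval n σ ρ d = bit (0 < t.eval n σ ρ d) := by
  rw [eval_not, eval_not]
  exact bit_congr ((bit_eq_zero _).trans Nat.pos_iff_ne_zero.symm)

theorem eval_or (s t : Term) :
    (s.or t).eval n σ ρ d = bit (0 < s.eval n σ ρ d + t.eval n σ ρ d) :=
  eval_not_not n σ ρ d (.plus s t)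

theorem eval_any (t : Term) :
    t.any.eval n σ ρ d = bit (0 < ∑ i : Fin n, t.eval n σ (Function.update ρ d i) (d + 1)) :=
  eval_not_not n σ ρ d (.sum t)

theorem eval_le (s t : Term) : (s.le t).eval n σ ρ d = bit (s.eval n σ ρ d ≤ t.eval n σ ρ d) :=
  (eval_not n σ ρ d _).trans (bit_congr Nat.sub_eq_zero_iff_le)

theorem eval_lt (s t : Term) : (s.lt t).eval n σ ρ d = bit (s.eval n σ ρ d < t.eval n σ ρ d) :=
  eval_le n σ ρ d _ _

theorem eval_scale (c : ℕ) (t : Term) : (scale c t).eval n σ ρ d = c * t.eval n σ ρ d := by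
  induction c with
  | zero => simp [scale, Term.eval]
  | succ c ih => simp only [scale, Term.eval, ih, Nat.succ_mul]

theorem ok_scale {a d c : ℕ} {t : Term} (h : t.Ok a d) : (scale c t).Ok a d := by
  induction c with
  | zero => trivial
  | succ c ih => exact ⟨ih, h⟩

end Term

namespace Instance

open scoped Classical in
/-- The vertices of `I` that are neither terminals nor adjacent to one. -/
noncomputable abbrev free (I : Instance) : Finset (Fin I.n) :=
  freeOf I.graph (I.source ∪ I.target)

open scoped Classical in
/-- The set of vertices of `I` from which the closure starts. -/
noncomputable abbrev start (I : Instance) (r : ℕ) : Finset (Fin I.n) :=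
  startSet I.graph r I.source I.target

open scoped Classical in
/-- The vertices of `I` to be kept when the closure has reached the stage `K`. -/
noncomputable abbrev kept (I : Instance) (r : ℕ) (K : Finset (Fin I.n)) : Finset (Fin I.n) :=
  keepFrom I.graph r I.source I.target K

end Instance

/-- The intended contents of the arrays, while `K` is the current stage of the closure.  The input
is in the arrays `0` to `3`; the output will go to the arrays `4` to `8`. -/
def Spec (I : Instance) (r : ℕ) (K : Finset (Fin I.n)) : ℕ → (ℕ → ℕ) → Prop
  | 0, f => f 0 = I.n
  | 1, f => ∀ u v : Fin I.n, f (u * I.n + v) = bit (I.graph.Adj u v)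
  | 2, f => ∀ u : Fin I.n, f u = bit (u ∈ I.source)
  | 3, f => ∀ u : Fin I.n, f u = bit (u ∈ I.target)
  | 9, f => ∀ u : Fin I.n, f u = u * I.n
  | 10, f => f 0 = I.k
  | 11, f => ∀ u : Fin I.n, f u = bit (u ∈ I.source ∪ I.target)
  | 12, f => ∀ u : Fin I.n, f u = bit (u ∈ I.free)
  | 13, f => ∀ u : Fin I.n, f u = bit (u ∈ I.start r)
  | 14, f => ∀ u : Fin I.n, f u = bit (u ∈ K)
  | 15, f => ∀ u : Fin I.n, f u = bit (u ∈ I.kept r K)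
  | _, _ => True

/-- The arrays below `m` have their intended contents. -/
def Done (I : Instance) (r : ℕ) (K : Finset (Fin I.n)) (m : ℕ) (σ : Store) : Prop :=
  ∀ a < m, Spec I r K a (σ a)

variable {I : Instance} {r m : ℕ} {K : Finset (Fin I.n)} {σ σ' : Store}

namespace Done

theorem congr (h : Done I r K m σ) (hσ : ∀ a < m, σ' a = σ a) : Done I r K m σ' :=
  fun a ha => by rw [hσ a ha]; exact h a ha

theorem succ (h : Done I r K m σ) (hm : m ≤ 100) (hσ : SameExcept m σ σ')
    (hs : Spec I r K m (σ' m)) : Done I r K (m + 1) σ' := by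
  intro a ha
  rcases eq_or_ne a m with rfl | hne
  · exact hs
  · rw [hσ a (by omega) hne]
    exact h a (by omega)

theorem size (h : Done I r K m σ) (hm : 0 < m) : σ 0 0 = I.n := h 0 hm

theorem source (h : Done I r K m σ) (hm : 2 < m) (u : Fin I.n) : σ 2 u = bit (u ∈ I.source) :=
  h 2 hm u

theorem target (h : Done I r K m σ) (hm : 3 < m) (u : Fin I.n) : σ 3 u = bit (u ∈ I.target) :=
  h 3 hm u

theorem terminal (h : Done I r K m σ) (hm : 11 < m) (u : Fin I.n) :
    σ 11 u = bit (u ∈ I.source ∪ I.target) := h 11 hm u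

theorem free (h : Done I r K m σ) (hm : 12 < m) (u : Fin I.n) : σ 12 u = bit (u ∈ I.free) :=
  h 12 hm u

theorem start (h : Done I r K m σ) (hm : 13 < m) (u : Fin I.n) : σ 13 u = bit (u ∈ I.start r) :=
  h 13 hm u

theorem stage (h : Done I r K m σ) (hm : 14 < m) (u : Fin I.n) : σ 14 u = bit (u ∈ K) :=
  h 14 hm u

theorem kept (h : Done I r K m σ) (hm : 15 < m) (u : Fin I.n) : σ 15 u = bit (u ∈ I.kept r K) :=
  h 15 hm u

theorem eval_adj (h : Done I r K m σ) (hm : 9 < m) {s t : Term} {ρ : ℕ → ℕ} {d : ℕ}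
    {u v : Fin I.n} (hs : s.eval I.n σ ρ d = u) (ht : t.eval I.n σ ρ d = v) :
    (Term.adj s t).eval I.n σ ρ d = bit (I.graph.Adj u v) := by
  simp only [Term.adj, Term.eval, hs, ht]
  rw [h 9 hm u]
  exact h 1 (by omega) u v

end Done

/-- The offsets of the rows of the adjacency matrix. -/
def rowTerm : Term := .sum (.var 0)

theorem eval_rowTerm (n : ℕ) (σ : Store) (w : ℕ) : rowTerm.eval n σ (fun _ => w) 1 = w * n := by
  simp [rowTerm, Term.eval, mul_comm]

/-- The number of tokens. -/
def sizeTerm : Term := .sum (.read 2 (.var 0))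

theorem eval_sizeTerm (h : Done I r K 10 σ) : sizeTerm.eval I.n σ (fun _ => 0) 0 = I.k := by
  simp only [sizeTerm, Term.eval, Function.update_self, h.source (by norm_num)]
  exact sum_bit fun _ => Iff.rfl

/-- Membership in the source or the target. -/
def terminalTerm : Term := .or (.read 2 (.var 0)) (.read 3 (.var 0))

theorem eval_terminalTerm (h : Done I r K 11 σ) (w : Fin I.n) :
    terminalTerm.eval I.n σ (fun _ => w) 1 = bit (w ∈ I.source ∪ I.target) := by
  simp only [terminalTerm, Term.eval_or, Term.eval, h.source (by norm_num),
    h.target (by norm_num), bit_add_pos, Finset.mem_union]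

/-- Membership in the set of free vertices. -/
def freeTerm : Term :=
  .and (.not (.read 11 (.var 0))) (.not (.sum (.and (.read 11 (.var 1)) (.adj (.var 1) (.var 0)))))

theorem eval_freeTerm (h : Done I r K 12 σ) (w : Fin I.n) :
    freeTerm.eval I.n σ (fun _ => w) 1 = bit (w ∈ I.free) := by
  have hadj (i : Fin I.n) : (Term.adj (.var 1) (.var 0)).eval I.n σ
      (Function.update (fun _ => (w : ℕ)) 1 i) 2 = bit (I.graph.Adj i w) :=
    h.eval_adj (by norm_num) (by simp [Term.eval]) (by simp [Term.eval])
  simp only [freeTerm, Term.and, Term.eval_not, Term.eval, Function.update_self,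
    h.terminal (by norm_num), hadj, bit_eq_zero, bit_and, sum_bit_eq_zero]
  refine bit_congr ?_
  simp only [freeOf, Finset.mem_filter, Finset.mem_univ, true_and, not_and]

/-- A constant multiple of the number of tokens. -/
def tokensTerm (c : ℕ) : Term := .scale c (.read 10 (.const 0))

theorem eval_tokensTerm (h : Done I r K m σ) (hm : 10 < m) (c : ℕ) (ρ : ℕ → ℕ) (d : ℕ) :
    (tokensTerm c).eval I.n σ ρ d = c * I.source.card := by
  have htokens : σ 10 0 = I.k := h 10 hm
  rw [tokensTerm, Term.eval_scale]
  simp only [Term.eval, htokens, Instance.k]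

/-- Membership in the set from which the closure starts. -/
def startTerm (r : ℕ) : Term :=
  .or (.read 11 (.var 0)) (.and (.read 12 (.var 0))
    (.lt (.sum (.and (.read 12 (.var 1)) (.lt (.var 1) (.var 0)))) (tokensTerm (8 * r + 1))))

theorem eval_startTerm (h : Done I r K 13 σ) (w : Fin I.n) :
    (startTerm r).eval I.n σ (fun _ => w) 1 = bit (w ∈ I.start r) := by
  simp only [startTerm, Term.eval_or, Term.and, Term.eval_lt, Term.eval, Function.update_self,
    Function.update_of_ne (zero_ne_one' ℕ), h.terminal (by norm_num), h.free (by norm_num),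
    eval_tokensTerm h (by norm_num), bit_and, bit_add_pos]
  rw [sum_bit (S := I.free.filter (· < w)) (by simp)]
  refine bit_congr ?_
  simp only [startSet, firstOf, Finset.mem_union, Finset.mem_filter]

/-- Whether vertex `1` is in the class of vertex `0`. -/
def classTerm : Term :=
  .and (.not (.read 14 (.var 1))) (.not (.sum (.and (.read 14 (.var 2))
    (.ne (.adj (.var 1) (.var 2)) (.adj (.var 0) (.var 2))))))

open scoped Classical in
theorem eval_classTerm (h : Done I r K 15 σ) (u w : Fin I.n) :
    classTerm.eval I.n σ (Function.update (fun _ => w) 1 u) 2 =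
      bit (u ∈ nbrClass I.graph K w) := by
  have hadj_u (i : Fin I.n) : (Term.adj (.var 1) (.var 2)).eval I.n σ
      (Function.update (Function.update (fun _ => (w : ℕ)) 1 u) 2 i) 3 = bit (I.graph.Adj u i) :=
    h.eval_adj (by norm_num) (by simp [Term.eval]) (by simp [Term.eval])
  have hadj_w (i : Fin I.n) : (Term.adj (.var 0) (.var 2)).eval I.n σ
      (Function.update (Function.update (fun _ => (w : ℕ)) 1 u) 2 i) 3 = bit (I.graph.Adj w i) :=
    h.eval_adj (by norm_num) (by simp [Term.eval]) (by simp [Term.eval])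
  simp only [classTerm, Term.and, Term.eval_not, Term.ne, Term.eval, Function.update_self,
    h.stage (by norm_num), hadj_u, hadj_w, bit_eq_zero, bit_not_iff, bit_and, sum_bit_eq_zero]
  refine bit_congr ?_
  simp only [nbrClass, Finset.mem_filter, Finset.mem_univ, true_and, not_and, not_not,
    Finset.ext_iff, and_congr_right_iff]

/-- The size of the class of a vertex. -/
def classSizeTerm : Term := .sum classTerm

open scoped Classical in
theorem eval_classSizeTerm (h : Done I r K 15 σ) (w : Fin I.n) :
    classSizeTerm.eval I.n σ (fun _ => w) 1 = (nbrClass I.graph K w).card := by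
  simp only [classSizeTerm, Term.eval, eval_classTerm h]
  exact sum_bit fun _ => Iff.rfl

/-- Membership in the next stage of the closure, where array `20` holds the sizes of the
classes. -/
def closureTerm (r : ℕ) : Term :=
  .or (.read 14 (.var 0)) (.not (.any (.and (.and (.read 13 (.var 1)) (.adj (.var 1) (.var 0)))
    (.any (.and (.not (.read 14 (.var 2))) (.and (.adj (.var 1) (.var 2))
      (.le (.const (classConst r)) (.read 20 (.var 2)))))))))

open scoped Classical in
theorem eval_closureTerm (h : Done I r K 15 σ)
    (hclass : ∀ u : Fin I.n, σ 20 u = (nbrClass I.graph K u).card) (w : Fin I.n) :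
    (closureTerm r).eval I.n σ (fun _ => w) 1 =
      bit (w ∈ closureStep I.graph (I.start r) (classConst r) K) := by
  have hadj_w (x : Fin I.n) : (Term.adj (.var 1) (.var 0)).eval I.n σ
      (Function.update (fun _ => (w : ℕ)) 1 x) 2 = bit (I.graph.Adj x w) :=
    h.eval_adj (by norm_num) (by simp [Term.eval]) (by simp [Term.eval])
  have hadj_z (x z : Fin I.n) : (Term.adj (.var 1) (.var 2)).eval I.n σ
      (Function.update (Function.update (fun _ => (w : ℕ)) 1 x) 2 z) 3 = bit (I.graph.Adj x z) :=
    h.eval_adj (by norm_num) (by simp [Term.eval]) (by simp [Term.eval])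
  simp only [closureTerm, Term.eval_or, Term.eval_any, Term.and, Term.eval_not, Term.eval_le,
    Term.eval, Function.update_self, h.start (by norm_num), h.stage (by norm_num), hclass, hadj_w,
    hadj_z, bit_eq_zero, bit_and, sum_bit_pos, bit_add_pos]
  refine bit_congr ?_
  rw [closureStep, Finset.mem_union, Finset.mem_filter]
  simp only [Supported, Finset.mem_univ, true_and, and_assoc]

/-- The truth value of the inequality that makes the free vertices alone suffice. -/
def plentyFreeTerm (r : ℕ) : Term :=
  .le (tokensTerm (8 * r + 1)) (.sum (.read 12 (.var 1)))

theorem eval_plentyFreeTerm (h : Done I r K 15 σ) (w : ℕ) :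
    (plentyFreeTerm r).eval I.n σ (fun _ => w) 1 =
      bit ((8 * r + 1) * I.source.card ≤ I.free.card) := by
  simp only [plentyFreeTerm, Term.eval_le, eval_tokensTerm h (by norm_num), Term.eval,
    Function.update_self, h.free (by norm_num)]
  rw [sum_bit (S := I.free) fun _ => Iff.rfl]

/-- Membership in the set of vertices to be kept when there are few free vertices. -/
def retainedTerm (r : ℕ) : Term :=
  .or (.or (.read 14 (.var 0)) (.and (.not (.read 14 (.var 0)))
      (.lt (.sum (.and classTerm (.lt (.var 1) (.var 0)))) (.const (classConst r)))))
    (.and (.not (.read 14 (.var 0))) (.lt (.sum (.and (.not (.read 14 (.var 1)))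
      (.lt (.var 1) (.var 0)))) (tokensTerm (extraConst r))))

open scoped Classical in
theorem eval_retainedTerm (h : Done I r K 15 σ) (w : Fin I.n) :
    (retainedTerm r).eval I.n σ (fun _ => w) 1 =
      bit (w ∈ retainedSet I.graph r I.source.card K) := by
  have hclass : ∑ u, bit (u ∈ nbrClass I.graph K w ∧ (u : ℕ) < w) =
      ((nbrClass I.graph K w).filter (· < w)).card := sum_bit (by simp)
  have hextra : ∑ u, bit (u ∉ K ∧ (u : ℕ) < w) = (Kᶜ.filter (· < w)).card := sum_bit (by simp)
  simp only [retainedTerm, Term.eval_or, Term.and, Term.eval_not, Term.eval_lt, Term.eval,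
    Function.update_self, Function.update_of_ne (zero_ne_one' ℕ), eval_classTerm h,
    h.stage (by norm_num), eval_tokensTerm h (by norm_num), bit_eq_zero, bit_and, bit_add_pos,
    hclass, hextra]
  refine bit_congr ?_
  simp only [retainedSet, classReps, firstOf, Finset.mem_union, Finset.mem_filter, Finset.mem_univ,
    true_and, Finset.mem_compl]

/-- Membership in the set of vertices to be kept. -/
def keepTerm (r : ℕ) : Term :=
  .or (.and (plentyFreeTerm r) (.read 13 (.var 0)))
    (.and (.not (plentyFreeTerm r)) (retainedTerm r))

theorem eval_keepTerm (h : Done I r K 15 σ) (w : Fin I.n) :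
    (keepTerm r).eval I.n σ (fun _ => w) 1 = bit (w ∈ I.kept r K) := by
  simp only [keepTerm, Term.eval_or, Term.and, Term.eval_not, Term.eval, eval_plentyFreeTerm h,
    eval_retainedTerm h, h.start (by norm_num), bit_eq_zero, bit_and, bit_add_pos]
  refine bit_congr ?_
  unfold Instance.kept keepFrom
  split_ifs with hplenty <;> simp [hplenty]

/-- The number of vertices to be kept. -/
def countTerm : Term := .sum (.read 15 (.var 0))

theorem eval_countTerm (h : Done I r K 16 σ) :
    countTerm.eval I.n σ (fun _ => 0) 0 = (I.kept r K).card := by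
  simp only [countTerm, Term.eval, Function.update_self, h.kept (by norm_num)]
  exact sum_bit fun _ => Iff.rfl

/-- The name of a vertex of the output. -/
def nameTerm : Term :=
  .sum (.le (.sum (.and (.read 15 (.var 2)) (.le (.var 2) (.var 1)))) (.var 0))

-- The name of `i` is the number of vertices of rank at most `i` among those that are kept.
theorem eval_nameTerm (h : Done I r K 16 σ) (i : Fin (I.kept r K).card) :
    nameTerm.eval I.n σ (fun _ => i) 1 = nameOf (I.kept r K) i := by
  have hrank (u : Fin I.n) : ∑ v, bit (v ∈ I.kept r K ∧ (v : ℕ) ≤ u) =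
      ((I.kept r K).filter (· ≤ u)).card := sum_bit (by simp)
  simp only [nameTerm, Term.and, Term.eval_le, Term.eval, Function.update_self,
    Function.update_of_ne (Nat.one_lt_two.ne), Function.update_of_ne (zero_ne_one' ℕ),
    h.kept (by norm_num), bit_and, hrank]
  rw [← card_filter_rank_le]
  exact sum_bit (by simp)

end Program

/-! ### The kernelization algorithm -/

section Algorithm

open Polynomial

/-- From every memory satisfying `A x`, the program `p` halts in time polynomial in `size x`, with a
memory satisfying `B x`. -/
def PolyRuns {ι : Type*} (size : ι → ℕ) (p : Prog) (A B : ι → Store → Prop) : Prop :=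
  ∃ P : ℕ[X], ∀ x σ, A x σ → Runs p σ (P.eval (size x)) (B x)

namespace PolyRuns

variable {ι : Type*} {size : ι → ℕ} {p q : Prog} {A B C : ι → Store → Prop} {a : ℕ} {t : Term}

theorem seq (hp : PolyRuns size p A B) (hq : PolyRuns size q B C) :
    PolyRuns size (.seq p q) A C := by
  obtain ⟨P, hP⟩ := hp
  obtain ⟨Q, hQ⟩ := hq
  refine ⟨P + Q, fun x σ hσ => ?_⟩
  rw [eval_add]
  exact (hP x σ hσ).seq (hQ x)

theorem assign (hsize : ∀ x σ, A x σ → σ 0 0 = size x) (ht : t.Ok a 0)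
    (hB : ∀ x σ σ', A x σ → SameExcept a σ σ' → σ' a 0 = t.eval (size x) σ (fun _ => 0) 0 →
      B x σ') : PolyRuns size (assign a t) A B := by
  obtain ⟨P, hP⟩ := runs_assign t ht
  exact ⟨P, fun x σ hσ => (hP _ σ (hsize x σ hσ)).mono le_rfl fun σ' h => hB x σ σ' hσ h.1 h.2⟩

theorem fill (hsize : ∀ x σ, A x σ → σ 0 0 = size x) (ha : a ≠ 0) (ha' : a < 100)
    (ht : t.Ok a 1) (hB : ∀ x σ σ', A x σ → SameExcept a σ σ' →
      (∀ w : Fin (size x), σ' a w = t.eval (size x) σ (fun _ => w) 1) → B x σ') :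
    PolyRuns size (fill a t) A B := by
  obtain ⟨P, hP⟩ := runs_fill ha ha' t ht
  exact ⟨P, fun x σ hσ => (hP _ σ (hsize x σ hσ)).mono le_rfl fun σ' h => hB x σ σ' hσ h.1 h.2⟩

theorem forTo {c : ℕ} {Inv : ι → ℕ → Store → Prop}
    (hsize : ∀ x i σ, Inv x i σ → σ 0 0 = size x)
    (hcounter : ∀ x i σ v, Inv x i σ → Inv x i (setCell σ c 0 v))
    (hbody : PolyRuns (fun y : ι × ℕ => size y.1) p (fun y σ => σ c 0 = y.2 ∧ Inv y.1 y.2 σ)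
      fun y σ => σ c 0 = y.2 ∧ Inv y.1 (y.2 + 1) σ) :
    PolyRuns size (forTo c (.read 0 (.const 0)) p) (fun x => Inv x 0)
      fun x => Inv x (size x) := by
  obtain ⟨P, hP⟩ := hbody
  refine ⟨(X + 1) * (P + 12) + 3, fun x σ hσ => ?_⟩
  simp only [eval_add, eval_mul, eval_X, eval_one, eval_ofNat]
  refine (Runs.forTo (N := .read 0 (.const 0)) (Inv := fun i σ => σ c 0 = i ∧ Inv x i σ)
    (fun i σ h => hsize x i σ h.2)
    (fun _ _ h => h.1) ⟨setCell_self _ _ _ _, hcounter x 0 σ 0 hσ⟩ fun i σ _ h =>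
      (hP (x, i) σ h).mono le_rfl fun σ' h' =>
        ⟨h'.1, setCell_self _ _ _ _, hcounter x (i + 1) σ' _ h'.2⟩).mono le_rfl fun _ h => h.2

end PolyRuns

theorem done_input (I : Instance) (r : ℕ) (K : Finset (Fin I.n)) : Done I r K 9 I.input := by
  classical
  obtain ⟨hsize, hadj, hsource, htarget⟩ := I.stored_input
  intro a ha
  interval_cases a
  · exact hsize
  · exact fun u v => (hadj u v).trans (bit_eq_ite Iff.rfl).symm
  · exact fun u => (hsource u).trans (bit_eq_ite Iff.rfl).symm
  · exact fun u => (htarget u).trans (bit_eq_ite Iff.rfl).symm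
  all_goals trivial

theorem polyRuns_fill_done {r m : ℕ} {K : (I : Instance) → Finset (Fin I.n)} {t : Term}
    (hm : m ≠ 0) (hm' : m < 100) (ht : t.Ok m 1)
    (hspec : ∀ (I : Instance) (σ : Store) (f : ℕ → ℕ), Done I r (K I) m σ →
      (∀ w : Fin I.n, f w = t.eval I.n σ (fun _ => w) 1) → Spec I r (K I) m f) :
    PolyRuns Instance.n (fill m t) (fun I => Done I r (K I) m) fun I => Done I r (K I) (m + 1) :=
  .fill (fun _ _ h => h.size (by omega)) hm hm' ht fun I σ _ h hsame hfill =>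
    h.succ hm'.le hsame (hspec I σ _ h hfill)

theorem ok_tokensTerm {a d c : ℕ} (ha : a ≠ 10) : (tokensTerm c).Ok a d :=
  Term.ok_scale ⟨by norm_num, ha.symm, trivial⟩

/-- Computes the set from which the closure starts, and makes it the current stage. -/
def setupProg (r : ℕ) : Prog :=
  .seq (fill 9 rowTerm) (.seq (assign 10 sizeTerm) (.seq (fill 11 terminalTerm)
    (.seq (fill 12 freeTerm) (.seq (fill 13 (startTerm r)) (fill 14 (.read 13 (.var 0)))))))

theorem polyRuns_setupProg (r : ℕ) :
    PolyRuns Instance.n (setupProg r) (fun I σ => σ = I.input)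
      fun I => Done I r (I.start r) 15 := by
  have hinput : PolyRuns Instance.n (fill 9 rowTerm) (fun I σ => σ = I.input)
      fun I => Done I r (I.start r) 10 :=
    .fill (by rintro I _ rfl; exact I.stored_input.1) (by norm_num) (by norm_num)
      (by simp [rowTerm, Term.Ok]) fun I _ _ hσ hsame h =>
        (hσ ▸ done_input I r _ : Done I r (I.start r) 9 _).succ (by norm_num) hsame
          fun u => (h u).trans (eval_rowTerm ..)
  refine hinput.seq <| .seq (B := fun I => Done I r (I.start r) 11) ?_ <|
    (polyRuns_fill_done (by norm_num) (by norm_num) ?_ ?_).seq <|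
    (polyRuns_fill_done (by norm_num) (by norm_num) ?_ ?_).seq <|
    (polyRuns_fill_done (by norm_num) (by norm_num) ?_ ?_).seq <|
    polyRuns_fill_done (by norm_num) (by norm_num) ?_ ?_
  · exact .assign (fun _ _ h => h.size (by norm_num)) (by simp [sizeTerm, Term.Ok])
      fun _ _ _ hσ hsame h => hσ.succ (by norm_num) hsame (h.trans (eval_sizeTerm hσ))
  · simp [terminalTerm, Term.Ok, Term.or, Term.not]
  · exact fun _ _ _ hσ h u => (h u).trans (eval_terminalTerm hσ u)
  · simp [freeTerm, Term.Ok, Term.and, Term.not, Term.adj]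
  · exact fun _ _ _ hσ h u => (h u).trans (eval_freeTerm hσ u)
  · simp [startTerm, Term.Ok, Term.and, Term.not, Term.or, Term.lt, Term.le, ok_tokensTerm]
  · exact fun _ _ _ hσ h u => (h u).trans (eval_startTerm hσ u)
  · simp [Term.Ok]
  · exact fun _ _ _ hσ h u => (h u).trans (hσ.start (by norm_num) u)

open scoped Classical in
/-- The set that the closure has reached after `i` rounds. -/
noncomputable def Instance.stage (I : Instance) (r i : ℕ) : Finset (Fin I.n) :=
  (closureStep I.graph (I.start r) (classConst r))^[i] (I.start r)

open scoped Classical in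
theorem Instance.stage_succ (I : Instance) (r i : ℕ) :
    I.stage r (i + 1) = closureStep I.graph (I.start r) (classConst r) (I.stage r i) :=
  Function.iterate_succ_apply' _ _ _

/-- One round of the closure. -/
def closurePass (r : ℕ) : Prog :=
  .seq (fill 20 classSizeTerm) (.seq (fill 21 (closureTerm r)) (fill 14 (.read 21 (.var 0))))

theorem Spec.change_stage {I : Instance} {r : ℕ} {K K' : Finset (Fin I.n)} {a : ℕ} {f : ℕ → ℕ}
    (ha : a < 14) (h : Spec I r K a f) : Spec I r K' a f := by
  interval_cases a <;> exact h

open scoped Classical in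
theorem polyRuns_closurePass (r : ℕ) :
    PolyRuns (fun y : Instance × ℕ => y.1.n) (closurePass r)
      (fun y σ => σ 22 0 = y.2 ∧ Done y.1 r (y.1.stage r y.2) 15 σ)
      fun y σ => σ 22 0 = y.2 ∧ Done y.1 r (y.1.stage r (y.2 + 1)) 15 σ := by
  refine .seq (B := fun y σ => σ 22 0 = y.2 ∧ Done y.1 r (y.1.stage r y.2) 15 σ ∧
      ∀ u : Fin y.1.n, σ 20 u = (nbrClass y.1.graph (y.1.stage r y.2) u).card) ?_ <|
    .seq (B := fun y σ => σ 22 0 = y.2 ∧ Done y.1 r (y.1.stage r y.2) 15 σ ∧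
      ∀ u : Fin y.1.n, σ 21 u = bit (u ∈ y.1.stage r (y.2 + 1))) ?_ ?_
  · refine .fill (fun _ _ h => h.2.size (by norm_num)) (by norm_num) (by norm_num)
      (by simp [classSizeTerm, classTerm, Term.Ok, Term.not, Term.and, Term.adj, Term.ne]) ?_
    rintro y σ σ' ⟨hcounter, hσ⟩ hsame hfill
    exact ⟨by rw [hsame 22 (by norm_num) (by norm_num), hcounter],
      hσ.congr fun a ha => hsame a (by omega) (by omega),
      fun u => (hfill u).trans (eval_classSizeTerm hσ u)⟩
  · refine .fill (fun _ _ h => h.2.1.size (by norm_num)) (by norm_num) (by norm_num)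
      (by simp [closureTerm, Term.Ok, Term.not, Term.and, Term.adj, Term.or, Term.any, Term.le]) ?_
    rintro y σ σ' ⟨hcounter, hσ, hclass⟩ hsame hfill
    refine ⟨by rw [hsame 22 (by norm_num) (by norm_num), hcounter],
      hσ.congr fun a ha => hsame a (by omega) (by omega), fun u => ?_⟩
    rw [Instance.stage_succ, ← eval_closureTerm hσ hclass u]
    exact hfill u
  · refine .fill (fun _ _ h => h.2.1.size (by norm_num)) (by norm_num) (by norm_num)
      (by simp [Term.Ok]) ?_
    rintro y σ σ' ⟨hcounter, hσ, hnext⟩ hsame hfill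
    refine ⟨by rw [hsame 22 (by norm_num) (by norm_num), hcounter], ?_⟩
    have hinput : Done y.1 r (y.1.stage r (y.2 + 1)) 14 σ :=
      fun a ha => (hσ a (by omega)).change_stage ha
    exact hinput.succ (by norm_num) hsame fun u => (hfill u).trans (hnext u)

/-- Iterates the closure until it is stable. -/
def closureProg (r : ℕ) : Prog := forTo 22 (.read 0 (.const 0)) (closurePass r)

theorem polyRuns_closureProg (r : ℕ) :
    PolyRuns Instance.n (closureProg r) (fun I => Done I r (I.start r) 15)
      fun I => Done I r (I.stage r I.n) 15 :=
  .forTo (Inv := fun I i => Done I r (I.stage r i) 15) (fun _ _ _ h => h.size (by norm_num))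
    (fun _ _ _ _ h => h.congr fun _ _ => setCell_of_ne _ _ _ (by omega)) (polyRuns_closurePass r)

theorem polyRuns_keepTerm (r : ℕ) :
    PolyRuns Instance.n (fill 15 (keepTerm r)) (fun I => Done I r (I.stage r I.n) 15)
      fun I => Done I r (I.stage r I.n) 16 := by
  refine polyRuns_fill_done (K := fun I => I.stage r I.n) (by norm_num) (by norm_num) ?_
    fun _ _ _ hσ h u => (h u).trans (eval_keepTerm hσ u)
  simp [keepTerm, plentyFreeTerm, retainedTerm, classTerm, Term.Ok, Term.and, Term.not, Term.or,
    Term.lt, Term.le, Term.ne, Term.adj, ok_tokensTerm]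

/-- The arrays `4`, `6`, `7` and `8` describe the vertices, the source and the target of the
restriction of `I` to `M`. -/
structure VertexOutput (I : Instance) (M : Finset (Fin I.n)) (σ : Store) : Prop where
  card : σ 4 0 = M.card
  name : ∀ u : Fin M.card, σ 8 u = nameOf M u
  source : ∀ u : Fin M.card, σ 6 u = bit (nameOf M u ∈ I.source)
  target : ∀ u : Fin M.card, σ 7 u = bit (nameOf M u ∈ I.target)

/-- The arrays `4` to `8` describe the restriction of `I` to `M`. -/
structure Output (I : Instance) (M : Finset (Fin I.n)) (σ : Store) : Prop
    extends VertexOutput I M σ where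
  adj : ∀ u v : Fin M.card,
    σ 5 (u * M.card + v) = bit (I.graph.Adj (nameOf M u) (nameOf M v))

theorem Done.write_output {I : Instance} {r a : ℕ} {K : Finset (Fin I.n)} {σ σ' : Store}
    (h : Done I r K 16 σ) (ha : 4 ≤ a) (ha' : a ≤ 8) (hsame : SameExcept a σ σ') :
    Done I r K 16 σ' := by
  intro b hb
  by_cases hout : 4 ≤ b ∧ b ≤ 8
  · obtain ⟨hb4, hb8⟩ := hout
    interval_cases b <;> trivial
  · rw [hsame b (by omega) (by omega)]
    exact h b hb

/-- Writes the output except for the adjacency matrix. -/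
def vertexProg : Prog :=
  .seq (assign 4 countTerm) (.seq (fill 8 nameTerm) (.seq (fill 6 (.read 2 (.read 8 (.var 0))))
    (fill 7 (.read 3 (.read 8 (.var 0))))))

theorem card_le_size {I : Instance} (M : Finset (Fin I.n)) : M.card ≤ I.n := by
  simpa using M.card_le_univ

theorem polyRuns_vertexProg (r : ℕ) (K : (I : Instance) → Finset (Fin I.n)) :
    PolyRuns Instance.n vertexProg (fun I => Done I r (K I) 16) fun I σ =>
      Done I r (K I) 16 σ ∧ VertexOutput I (I.kept r (K I)) σ := by
  refine .seq (B := fun I σ => Done I r (K I) 16 σ ∧ σ 4 0 = (I.kept r (K I)).card) ?_ <|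
    .seq (B := fun I σ => Done I r (K I) 16 σ ∧ σ 4 0 = (I.kept r (K I)).card ∧
      ∀ u : Fin (I.kept r (K I)).card, σ 8 u = nameOf (I.kept r (K I)) u) ?_ <|
    .seq (B := fun I σ => Done I r (K I) 16 σ ∧ σ 4 0 = (I.kept r (K I)).card ∧
      (∀ u : Fin (I.kept r (K I)).card, σ 8 u = nameOf (I.kept r (K I)) u) ∧
      ∀ u : Fin (I.kept r (K I)).card, σ 6 u = bit (nameOf (I.kept r (K I)) u ∈ I.source)) ?_ ?_
  · exact .assign (fun _ _ h => h.size (by norm_num)) (by simp [countTerm, Term.Ok])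
      fun I σ σ' hσ hsame h => ⟨hσ.write_output (by norm_num) (by norm_num) hsame,
        h.trans (eval_countTerm hσ)⟩
  · refine .fill (fun _ _ h => h.1.size (by norm_num)) (by norm_num) (by norm_num)
      (by simp [nameTerm, Term.Ok, Term.le, Term.and, Term.not])
      fun I σ σ' ⟨hσ, hcard⟩ hsame h => ⟨hσ.write_output (by norm_num) (by norm_num) hsame,
        by rw [hsame 4 (by norm_num) (by norm_num), hcard], fun u => ?_⟩
    exact (h (u.castLE (card_le_size _))).trans (eval_nameTerm hσ u)
  · refine .fill (fun _ _ h => h.1.size (by norm_num)) (by norm_num) (by norm_num)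
      (by simp [Term.Ok]) fun I σ σ' ⟨hσ, hcard, hname⟩ hsame h =>
        ⟨hσ.write_output (by norm_num) (by norm_num) hsame,
          by rw [hsame 4 (by norm_num) (by norm_num), hcard],
          by rwa [hsame 8 (by norm_num) (by norm_num)], fun u => ?_⟩
    rw [← hσ.source (by norm_num), ← hname]
    exact h (u.castLE (card_le_size _))
  · refine .fill (fun _ _ h => h.1.size (by norm_num)) (by norm_num) (by norm_num)
      (by simp [Term.Ok]) fun I σ σ' ⟨hσ, hcard, hname, hsource⟩ hsame h =>
        ⟨hσ.write_output (by norm_num) (by norm_num) hsame,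
          by rw [hsame 4 (by norm_num) (by norm_num), hcard],
          by rwa [hsame 8 (by norm_num) (by norm_num)],
          by rwa [hsame 6 (by norm_num) (by norm_num)], fun u => ?_⟩
    rw [← hσ.target (by norm_num), ← hname]
    exact h (u.castLE (card_le_size _))

/-- The entry of the adjacency matrix of the output at row `i` and column `j`, read off the input
matrix in array `1` through the row offsets in array `9` and the names in array `8`. -/
def matrixEntry (σ : Store) (i j : ℕ) : ℕ := σ 1 (σ 9 (σ 8 i) + σ 8 j)

/-- The expression for `matrixEntry`, with the row in array `23` and the column in array `24`. -/
def entryExpr : Expr :=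
  .read 1 (.plus (.read 9 (.read 8 (.read 23 (.const 0)))) (.read 8 (.read 24 (.const 0))))

/-- Writes the adjacency matrix of the output; array `25` holds the current position. -/
def matrixProg : Prog :=
  .seq (.write 25 (.const 0) (.const 0)) (forTo 23 (.read 4 (.const 0))
    (forTo 24 (.read 4 (.const 0)) (.seq (.write 5 (.read 25 (.const 0)) entryExpr)
      (.write 25 (.const 0) (.plus (.read 25 (.const 0)) (.const 1))))))

/-- The memory `τ` reached from `σ` when the `N × N` matrix of the output has been written up to,
but excluding, the entry at row `i` and column `j`. -/
structure MatrixInv (σ : Store) (N i j : ℕ) (τ : Store) : Prop where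
  same : ∀ b < 20, b ≠ 5 → τ b = σ b
  row : τ 23 0 = i
  position : τ 25 0 = i * N + j
  written : ∀ i' j', j' < N → i' < i ∨ i' = i ∧ j' < j → τ 5 (i' * N + j') = matrixEntry σ i' j'

namespace MatrixInv

variable {σ τ : Store} {N i j : ℕ}

theorem size (h : MatrixInv σ N i j τ) : τ 4 = σ 4 := h.same 4 (by norm_num) (by norm_num)

theorem set_column (h : MatrixInv σ N i j τ) (v : ℕ) : MatrixInv σ N i j (setCell τ 24 0 v) where
  same b hb hb' := by rw [setCell_of_ne _ _ _ (by omega), h.same b hb hb']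
  row := by rw [setCell_of_ne _ _ _ (by norm_num), h.row]
  position := by rw [setCell_of_ne _ _ _ (by norm_num), h.position]
  written i' j' hj' hlt := by rw [setCell_of_ne _ _ _ (by norm_num), h.written i' j' hj' hlt]

theorem eval_entryExpr (h : MatrixInv σ N i j τ) (hj : τ 24 0 = j) :
    entryExpr.eval τ = matrixEntry σ i j := by
  simp only [entryExpr, Expr.eval, h.row, hj, matrixEntry]
  rw [h.same 1 (by norm_num) (by norm_num), h.same 9 (by norm_num) (by norm_num),
    h.same 8 (by norm_num) (by norm_num)]

theorem write_entry (h : MatrixInv σ N i j τ) :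
    MatrixInv σ N i (j + 1) (setCell (setCell τ 5 (i * N + j) (matrixEntry σ i j)) 25 0
      (i * N + j + 1)) where
  same b hb hb' := by
    rw [setCell_of_ne _ _ _ (by omega), setCell_of_ne _ _ _ hb', h.same b hb hb']
  row := by rw [setCell_of_ne _ _ _ (by norm_num), setCell_of_ne _ _ _ (by norm_num), h.row]
  position := setCell_self _ _ _ _
  written i' j' hj' hlt := by
    rw [setCell_of_ne _ _ _ (by norm_num)]
    by_cases heq : i' = i ∧ j' = j
    · rw [heq.1, heq.2, setCell_self]
    · have hbefore : i' < i ∨ i' = i ∧ j' < j := by omega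
      have hpos : i' * N + j' ≠ i * N + j := by
        rcases hbefore with hrow | ⟨rfl, hcol⟩
        · have := Nat.mul_le_mul_right N (Nat.succ_le_of_lt hrow)
          rw [Nat.succ_mul] at this
          omega
        · omega
      rw [setCell_of_ne_cell _ _ _ hpos, h.written i' j' hj' hbefore]

theorem next_row (h : MatrixInv σ N i N τ) :
    MatrixInv σ N (i + 1) 0 (setCell τ 23 0 (i + 1)) where
  same b hb hb' := by rw [setCell_of_ne _ _ _ (by omega), h.same b hb hb']
  row := setCell_self _ _ _ _
  position := by rw [setCell_of_ne _ _ _ (by norm_num), h.position]; ring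
  written i' j' hj' hlt := by
    rw [setCell_of_ne _ _ _ (by norm_num), h.written i' j' hj' (by omega)]

end MatrixInv

theorem runs_matrixRow {σ τ : Store} {N i : ℕ} (hN : σ 4 0 = N) (h : MatrixInv σ N i 0 τ) :
    Runs (forTo 24 (.read 4 (.const 0)) (.seq (.write 5 (.read 25 (.const 0)) entryExpr)
      (.write 25 (.const 0) (.plus (.read 25 (.const 0)) (.const 1))))) τ
      ((N + 1) * 42 + 3) (MatrixInv σ N i N) := by
  refine (Runs.forTo (N := .read 4 (.const 0)) (c := 30)
    (Inv := fun j τ => MatrixInv σ N i j τ ∧ τ 24 0 = j)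
    (fun j τ hτ => (congrFun hτ.1.size 0).trans hN) (fun j τ hτ => hτ.2)
    ⟨h.set_column 0, setCell_self _ _ _ _⟩ ?_).mono le_rfl fun _ hτ => hτ.1
  rintro j τ - ⟨hτ, hcolumn⟩
  refine Runs.mono (c := 15 + 15) (Runs.seq (.write (Q := fun τ' =>
    τ' = setCell τ 5 (i * N + j) (matrixEntry σ i j)) ?_ (by simp [Expr.cost, entryExpr])) ?_)
    le_rfl fun _ hτ' => hτ'
  · simp only [hτ.eval_entryExpr hcolumn, Expr.eval, hτ.position]
  · rintro _ rfl
    refine .write ?_ (by simp [Expr.cost])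
    have hposition : setCell τ 5 (i * N + j) (matrixEntry σ i j) 25 0 = i * N + j := by
      rw [setCell_of_ne _ _ _ (by norm_num), hτ.position]
    simp only [Expr.eval, hposition]
    refine ⟨?_, hτ.write_entry.set_column _, setCell_self _ _ _ _⟩
    rw [setCell_of_ne _ _ _ (by norm_num), setCell_of_ne _ _ _ (by norm_num), hcolumn]

theorem runs_matrixProg {σ : Store} {N : ℕ} (hN : σ 4 0 = N) :
    Runs matrixProg σ ((N + 1) * ((N + 1) * 42 + 15) + 6) (MatrixInv σ N N 0) := by
  refine (Runs.seq (.write (Q := fun τ => τ = setCell σ 25 0 0) rfl le_rfl) ?_).mono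
    (c := 3 + ((N + 1) * ((N + 1) * 42 + 15) + 3)) (by omega) fun _ h => h
  rintro _ rfl
  refine Runs.forTo (N := .read 4 (.const 0)) (c := (N + 1) * 42 + 3)
    (fun i τ h => (congrFun h.size 0).trans hN) (fun i τ h => h.row) ?_
    fun i τ _ h => (runs_matrixRow hN h).mono le_rfl fun _ h' => ⟨h'.row, h'.next_row⟩
  refine ⟨fun b hb _ => ?_, setCell_self _ _ _ _, ?_, by omega⟩
  · rw [setCell_of_ne _ _ _ (by omega), setCell_of_ne _ _ _ (by omega)]
  · rw [setCell_of_ne _ _ _ (by norm_num), setCell_self, zero_mul]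

theorem VertexOutput.output {I : Instance} {r : ℕ} {K M : Finset (Fin I.n)} {σ τ : Store}
    (h : VertexOutput I M σ) (hσ : Done I r K 16 σ) (hτ : MatrixInv σ M.card M.card 0 τ) :
    Output I M τ where
  card := by rw [hτ.size, h.card]
  name := by rw [hτ.same 8 (by norm_num) (by norm_num)]; exact h.name
  source := by rw [hτ.same 6 (by norm_num) (by norm_num)]; exact h.source
  target := by rw [hτ.same 7 (by norm_num) (by norm_num)]; exact h.target
  adj u v := by
    rw [hτ.written u v v.2 (.inl u.2), matrixEntry, h.name, h.name, hσ 9 (by norm_num) _]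
    exact hσ 1 (by norm_num) _ _

theorem polyRuns_matrixProg (r : ℕ) (K M : (I : Instance) → Finset (Fin I.n)) :
    PolyRuns Instance.n matrixProg (fun I σ => Done I r (K I) 16 σ ∧ VertexOutput I (M I) σ)
      fun I => Output I (M I) := by
  refine ⟨(X + 1) * ((X + 1) * 42 + 15) + 6, fun I σ ⟨hσ, hvertex⟩ => ?_⟩
  simp only [eval_add, eval_mul, eval_X, eval_one, eval_ofNat]
  have := card_le_size (M I)
  exact (runs_matrixProg hvertex.card).mono (by gcongr) fun τ hτ => hvertex.output hσ hτ

/-- The kernelization. -/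
def kernelProg (r : ℕ) : Prog :=
  .seq (setupProg r) (.seq (closureProg r) (.seq (fill 15 (keepTerm r))
    (.seq vertexProg matrixProg)))

open scoped Classical in
/-- The vertices of the kernel of an instance. -/
noncomputable abbrev Instance.kernelSet (I : Instance) (r : ℕ) : Finset (Fin I.n) :=
  keepSet I.graph r I.source I.target

theorem Instance.kept_stage (I : Instance) (r : ℕ) : I.kept r (I.stage r I.n) = I.kernelSet r := by
  rw [kernelSet, keepSet, closureOf, Fintype.card_fin]
  rfl

theorem polyRuns_kernelProg (r : ℕ) :
    PolyRuns Instance.n (kernelProg r) (fun I σ => σ = I.input)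
      fun I => Output I (I.kernelSet r) := by
  refine (polyRuns_setupProg r).seq <| (polyRuns_closureProg r).seq <|
    (polyRuns_keepTerm r).seq <| (polyRuns_vertexProg r _).seq ?_
  simp only [Instance.kept_stage]
  exact polyRuns_matrixProg r _ _

theorem Output.stored_restrict {I : Instance} {M : Finset (Fin I.n)} {σ : Store}
    (h : Output I M σ) (hM : I.source ∪ I.target ⊆ M) : Stored σ 4 (I.restrict M hM) := by
  classical
  exact ⟨h.card, fun u v => (h.adj u v).trans (bit_eq_ite Iff.rfl),
    fun u => (h.source u).trans (bit_eq_ite (I.mem_source_restrict M hM u).symm),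
    fun u => (h.target u).trans (bit_eq_ite (I.mem_target_restrict M hM u).symm)⟩

end Algorithm

end TokenJumping

open TokenJumping in
theorem mainTheorem1 (r : ℕ) (hr : 0 < r) :
    ∃ (c : ℕ) (kernel : Prog) (P : Polynomial ℕ),
      ∀ I : Instance, ¬ IsMinor (completeBipartiteGraph (Fin 3) (Fin r)) I.graph →
        ∃ (t : ℕ) (σ : Store) (J : Instance) (φ : Fin J.n ↪ Fin I.n),
          -- in polynomial time, the program outputs `J` and the names `φ` of its vertices
          Exec kernel I.input t σ ∧ t ≤ P.eval I.n ∧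
          Stored σ 4 J ∧ (∀ u : Fin J.n, σ 8 u = φ u) ∧
          -- `J` is an equivalent instance `(G', I_s, I_t)` with `G'` a subgraph of order `O(k)`
          IsSubinstance J I φ ∧
          ¬ IsMinor (completeBipartiteGraph (Fin 3) (Fin r)) J.graph ∧
          (J.IsYes ↔ I.IsYes) ∧
          J.n ≤ c * I.k := by
  obtain ⟨P, hP⟩ := polyRuns_kernelProg r
  refine ⟨keepConst r, kernelProg r, P, fun I hI => ?_⟩
  classical
  obtain ⟨t, σ, hexec, ht, hσ⟩ := hP I I.input rfl
  obtain ⟨hsub, hcard, hreach⟩ :=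
    keepSet_spec hr hI I.source_indep I.target_indep I.card_eq
  exact ⟨t, σ, I.restrict (I.kernelSet r) hsub, nameOf (I.kernelSet r), hexec, ht,
    hσ.stored_restrict hsub, hσ.name, I.isSubinstance_restrict _ hsub,
    fun h => hI (h.trans (isMinor_comap I.graph _)),
    (I.isYes_restrict_iff _ hsub).trans (hreach.trans I.isYes_iff_reach.symm), hcard⟩
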